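/- Let $d\ge 1$, let $\varrho$ be a nonzero finite positive measure with compact support in $(0,\infty)$, and let $$V(s):=-\log\int\varrho(\mathrm{d}k)\,e^{-\frac12 k s^2},\qquad s\in\mathbb R .$$ Let $\mathbb B$ be the set of positively oriented nearest-neighbor edges $(x,x+\hat e_i)$ of $\mathbb Z^d$. A configuration $\eta=(\eta_b)\in\mathbb R^{\mathbb B}$ obeys the *loop condition* if its signed sum around every cycle of length four of $\mathbb Z^d$ vanishes; then there is a unique $\phi=\phi(\eta)\in\mathbb R^{\mathbb Z^d}$ with $\phi_0=0$ and $\eta_{xy}=\phi_y-\phi_x$ for every $(x,y)\in\mathbb B$. A probability measure $\mu$ on $\mathbb R^{\mathbb B}$ is a *gradient Gibbs measure* for $V$ if $\mu$-a.e. $\eta$ obeys the loop condition and, for each finite $\Lambda\subset\mathbb Z^d$, the conditional law under $\mu$ given $\sigma(\phi_y-\phi_x: x,y\notin\Lambda)$ is, for $\mu$-a.e. $\eta$, the law of the gradients of the field which equals $\phi(\eta)$ outside $\Lambda$ and whose restriction to $\Lambda$ has the law $$\frac1Z\exp\Bigl\{-\sum_{\langle x,y\rangle:\,\{x,y\}\cap\Lambda\ne\emptyset}V(\phi_y-\phi_x)\Bigr\}\prod_{x\in\Lambda}\mathrm{d}\phi_x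 .$$ The measure $\mu$ has *zero tilt* if each $\eta_b$ is $\mu$-integrable with $E_\mu(\eta_b)=0$. The *extension* of $\mu$ is the unique measure $\tilde\mu$ on $\mathbb R^{\mathbb B}\times\mathbb R^{\mathbb B}\ni(\eta,\kappa)$ such that, for each finite $S\subset\mathbb B$ and all Borel sets $A\subset\mathbb R^{\mathbb B}$ and $B\subset\mathbb R^{S}$, $$\tilde\mu\bigl(\eta\in A,\ (\kappa_b)_{b\in S}\in B\bigr)=\int_B\prod_{b\in S}\varrho(\mathrm{d}\kappa_b)\;E_\mu\Bigl(1_A(\eta)\prod_{b\in S}e^{V(\eta_b)-\frac12\kappa_b\eta_b^2}\Bigr).$$ For $\kappa\in(0,\infty)^{\mathbb B}$ let $(\mathcal L_\kappa g)(x):=\sum_{y:|y-x|=1}\kappa_{xy}[g(y)-g(x)]$, where $\kappa_{xy}=\kappa_{yx}$. For $f:\mathbb Z^d\to\mathbb R$ with finite support and $\sum_x f(x)=0$, write $(-\mathcal L_\kappa)^{-1}f$ for a function $g$ which satisfies $-\mathcal L_\kappa g=f$ and which is a limit of finitely supported functions $h_n$ in the Dirichlet energy, that is, $\sum_{(x,y)\in\mathbb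 B}\kappa_{xy}\bigl[(g-h_n)(y)-(g-h_n)(x)\bigr]^2\to0$. **Lemma.** Let $\mu$ be a translation-invariant, ergodic gradient Gibbs measure for $V$ with zero tilt, let $\tilde\mu$ be its extension, and let $\mathscr F:=\sigma(\kappa_b: b\in\mathbb B)$. For $\tilde\mu$-a.e. $\kappa$, the regular conditional law of $\phi=\phi(\eta)$ under $\tilde\mu$ given $\mathscr F$ is carried by $\{\phi:\phi_0=0\}$ and is Gaussian with mean zero, $$E_{\tilde\mu}(\phi_x\,|\,\mathscr F)(\kappa)=0,\qquad x\in\mathbb Z^d,$$ and with covariance $(-\mathcal L_\kappa)^{-1}$: for all $f,f':\mathbb Z^d\to\mathbb R$ with finite support and zero sum, $(-\mathcal L_\kappa)^{-1}f$ exists and, for each such function (they differ by constants), $$\operatorname{Cov}_{\tilde\mu}\Bigl(\sum_x f'(x)\phi_x,\ \sum_x f(x)\phi_x\,\Big|\,\mathscr F\Bigr)(\kappa)=\sum_x f'(x)\,\bigl((-\mathcal L_\kappa)^{-1}f\bigr)(x);$$ in particular $$\operatorname{Var}_{\tilde\mu}\Bigl(\sum_x f(x)\phi_x\,\Big|\,\mathscr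 F\Bigr)(\kappa)=\sum_x f(x)\,\bigl((-\mathcal L_\kappa)^{-1}f\bigr)(x).$$ -/

import Mathlib

namespace GradientGibbs

open MeasureTheory ProbabilityTheory Filter Topology
open scoped ENNReal

/-- The vertices of the hypercubic lattice `ℤ^d`. -/
abbrev Lattice (d : ℕ) : Type := Fin d → ℤ

/-- The positively oriented nearest-neighbour edges of `ℤ^d`: the pair `(x, i)` is the edge
from `x` to `x + e_i`. -/
abbrev Edge (d : ℕ) : Type := Lattice d × Fin d

/-- The coordinate unit vector `e_i`. -/
def unitVec {d : ℕ} (i : Fin d) : Lattice d := Pi.single i 1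

/-- The gradient of a field: `η_{xy} = φ_y - φ_x` on each positively oriented edge. -/
def grad {d : ℕ} (φ : Lattice d → ℝ) : Edge d → ℝ :=
  fun b => φ (b.1 + unitVec b.2) - φ b.1

/-- The loop condition: the signed sum of `η` around every cycle of length four
`x, x + e_i, x + e_i + e_j, x + e_j` vanishes. -/
def LoopCondition {d : ℕ} (η : Edge d → ℝ) : Prop :=
  ∀ (x : Lattice d) (i j : Fin d),
    η (x, i) + η (x + unitVec i, j) - η (x + unitVec j, i) - η (x, j) = 0

open Classical in
/-- The field `φ` with `φ_0 = 0` and gradient `η`. It exists (and is unique) exactly when `η` obeys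
the loop condition; it is set to `0` for all other `η`. -/
noncomputable def field {d : ℕ} (η : Edge d → ℝ) : Lattice d → ℝ :=
  if h : ∃ φ : Lattice d → ℝ, φ 0 = 0 ∧ grad φ = η then h.choose else 0

/-- The potential `V(s) = -log ∫ ϱ(dk) exp(-k s² / 2)`. -/
noncomputable def potential (ϱ : Measure ℝ) (s : ℝ) : ℝ :=
  -Real.log (∫ k, Real.exp (-(1 / 2 * k * s ^ 2)) ∂ϱ)

/-- The edges with at least one endpoint in `Λ`. -/
def touching {d : ℕ} (Λ : Finset (Lattice d)) : Finset (Edge d) :=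
  (Λ ×ˢ Finset.univ) ∪
    (Λ ×ˢ (Finset.univ : Finset (Fin d))).image fun b => (b.1 - unitVec b.2, b.2)

/-- The field that equals `ψ` on `Λ` and the boundary condition `φ` outside `Λ`. -/
def glue {d : ℕ} (Λ : Finset (Lattice d)) (φ : Lattice d → ℝ) (ψ : Λ → ℝ) : Lattice d → ℝ :=
  fun x => if h : x ∈ Λ then ψ ⟨x, h⟩ else φ x

/-- The Boltzmann weight `exp(-∑ V(η_b))`, the sum being over all edges that touch `Λ`. -/
noncomputable def weight {d : ℕ} (ϱ : Measure ℝ) (Λ : Finset (Lattice d)) (η : Edge d → ℝ) :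
    ℝ≥0∞ :=
  ENNReal.ofReal (Real.exp (-∑ b ∈ touching Λ, potential ϱ (η b)))

/-- The specification `γ_Λ(· | η)`: the law of the gradients of the field that equals the field of
`η` outside `Λ` and is distributed on `Λ` according to the normalized Boltzmann weight times
Lebesgue measure. -/
noncomputable def specification {d : ℕ} (ϱ : Measure ℝ) (Λ : Finset (Lattice d))
    (η : Edge d → ℝ) : Measure (Edge d → ℝ) :=
  (∫⁻ ψ : Λ → ℝ, weight ϱ Λ (grad (glue Λ (field η) ψ)))⁻¹ •
    ((volume : Measure (Λ → ℝ)).withDensity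
      fun ψ => weight ϱ Λ (grad (glue Λ (field η) ψ))).map
        fun ψ => grad (glue Λ (field η) ψ)

/-- The `σ`-algebra generated by the differences `φ_y - φ_x` of the field over all vertices
`x, y` outside `Λ`. -/
@[reducible] noncomputable def outside {d : ℕ} (Λ : Finset (Lattice d)) : MeasurableSpace (Edge d → ℝ) :=
  ⨆ (x : Lattice d) (_ : x ∉ Λ) (y : Lattice d) (_ : y ∉ Λ),
    MeasurableSpace.comap (fun η => field η y - field η x) (borel ℝ)

/-- A gradient Gibbs measure for the potential `V`: it is carried by the configurations that obey
the loop condition, and for each finite `Λ` the conditional law given the gradient field outside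
`Λ` is `γ_Λ`. -/
def IsGradientGibbs {d : ℕ} (ϱ : Measure ℝ) (μ : Measure (Edge d → ℝ)) : Prop :=
  (∀ᵐ η ∂μ, LoopCondition η) ∧
  ∀ (Λ : Finset (Lattice d)) (A : Set (Edge d → ℝ)), MeasurableSet A →
    μ[A.indicator (fun _ => (1 : ℝ)) | outside Λ] =ᵐ[μ]
      fun η => (specification ϱ Λ η A).toReal

/-- The translation `(τ_x η)_{yz} = η_{y+x,z+x}`. -/
def translate {d : ℕ} (x : Lattice d) (η : Edge d → ℝ) : Edge d → ℝ :=
  fun b => η (b.1 + x, b.2)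

def IsTranslationInvariant {d : ℕ} (μ : Measure (Edge d → ℝ)) : Prop :=
  ∀ x : Lattice d, μ.map (translate x) = μ

/-- Every translation-invariant event has probability `0` or `1`. -/
def IsErgodic {d : ℕ} (μ : Measure (Edge d → ℝ)) : Prop :=
  ∀ A : Set (Edge d → ℝ), MeasurableSet A → (∀ x : Lattice d, translate x ⁻¹' A = A) →
    μ A = 0 ∨ μ A = 1

def HasZeroTilt {d : ℕ} (μ : Measure (Edge d → ℝ)) : Prop :=
  ∀ b : Edge d, Integrable (fun η => η b) μ ∧ ∫ η, η b ∂μ = 0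

/-- `μt` is the extension of `μ` to pairs `(η, κ)`: its projection to `η` and `(κ_b)_{b ∈ S}` is
`∏_{b ∈ S} ϱ(dκ_b) exp(V(η_b) - κ_b η_b² / 2) μ(dη)` for each finite set `S` of edges. This
determines `μt` uniquely. -/
def IsExtension {d : ℕ} (ϱ : Measure ℝ) (μ : Measure (Edge d → ℝ))
    (μt : Measure ((Edge d → ℝ) × (Edge d → ℝ))) : Prop :=
  ∀ (S : Finset (Edge d)) (A : Set (Edge d → ℝ)) (B : Set (S → ℝ)),
    MeasurableSet A → MeasurableSet B →
    μt (A ×ˢ {κ | (fun b : S => κ b) ∈ B}) =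
      ∫⁻ k in B, (∫⁻ η in A, ∏ b : S,
        ENNReal.ofReal (Real.exp (potential ϱ (η b) - 1 / 2 * k b * η b ^ 2)) ∂μ)
        ∂(Measure.pi fun _ : S => ϱ)

/-- The law of the field `φ` (with `φ_0 = 0`) under the regular conditional distribution of `μt`
given the conductances `κ`. -/
noncomputable def condLaw {d : ℕ} (μt : Measure ((Edge d → ℝ) × (Edge d → ℝ)))
    [IsFiniteMeasure μt] : Kernel (Edge d → ℝ) (Lattice d → ℝ) :=
  condDistrib (fun ω => field ω.1) (fun ω => ω.2) μt

/-- The generator `(L_κ g)(x) = ∑_{y : |y - x| = 1} κ_{xy} (g(y) - g(x))`. -/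
def generator {d : ℕ} (κ : Edge d → ℝ) (g : Lattice d → ℝ) (x : Lattice d) : ℝ :=
  ∑ i : Fin d, (κ (x, i) * (g (x + unitVec i) - g x) +
    κ (x - unitVec i, i) * (g (x - unitVec i) - g x))

/-- The Dirichlet energy `∑_b κ_b (∇g)_b²`. -/
noncomputable def energy {d : ℕ} (κ : Edge d → ℝ) (g : Lattice d → ℝ) : ℝ≥0∞ :=
  ∑' b : Edge d, ENNReal.ofReal (κ b * grad g b ^ 2)

/-- `g = (-L_κ)⁻¹ f`: the function `g` solves `-L_κ g = f` and lies in the closure, in the Dirichlet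
energy, of the finitely supported functions. For uniformly elliptic `κ` and finitely supported `f`
with zero sum there is such a `g`, and it is unique up to an additive constant. -/
def IsInverseImage {d : ℕ} (κ : Edge d → ℝ) (f : Lattice d →₀ ℝ) (g : Lattice d → ℝ) : Prop :=
  (∀ x, -generator κ g x = f x) ∧
  ∃ h : ℕ → Lattice d →₀ ℝ, Tendsto (fun n => energy κ (fun x => g x - h n x)) atTop (𝓝 0)

/-- The pairing `∑_x f(x) φ_x`. -/
def pair {d : ℕ} (f : Lattice d →₀ ℝ) (φ : Lattice d → ℝ) : ℝ :=
  f.sum fun x a => a * φ x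

end GradientGibbs

/-!
Under the extension, the potentials on the edges touching a finite set `Λ` cancel against the
densities of the conductances. Given `κ` and the field outside `Λ`, the field in `Λ` is therefore
Gaussian: `η` is the sum of its `κ`-harmonic part in `Λ` and of the gradient of an independent
centred Gaussian field with zero boundary values. As `Λ` increases to `ℤ^d`, the Dirichlet Green
form of `div θ` increases to the squared norm of the projection of `θ / √κ` onto the closure in
`ℓ²` of the gradients `√κ ∇h`. The conditional characteristic functions thus converge to Gaussian
ones as soon as the harmonic part tends to zero in probability along suitable `Λ`.

By ergodicity and zero tilt, `E |φ_x|` is sublinear in `x`. A truncated Caccioppoli inequality,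
which only needs first moments, turns this into smallness of the harmonic part in a large box, on
average over the edges of a smaller concentric box. By translation invariance this is an average,
at fixed edges, over translates of the large box, and one of these translates serves as `Λ`.
-/

namespace GradientGibbs

open MeasureTheory ProbabilityTheory Filter Topology
open scoped ENNReal

variable {d : ℕ}

/-! ### Finitely supported flows and the field of a gradient configuration -/

theorem unitVec_apply (i j : Fin d) : unitVec i j = if j = i then 1 else 0 := by
  simp [unitVec, Pi.single_apply]

theorem lattice_induction {p : Lattice d → Prop} (zero : p 0)
    (add : ∀ x i, p x → p (x + unitVec i)) (sub : ∀ x i, p x → p (x - unitVec i)) (x : Lattice d) :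
    p x := by
  have along : ∀ (i : Fin d) (n : ℤ) (y : Lattice d), p y → p (y + n • unitVec i) := by
    intro i n y hy
    induction n with
    | zero => simpa using hy
    | succ n ih => rw [add_smul, one_smul, ← add_assoc]; exact add _ i ih
    | pred n ih => rw [sub_smul, one_smul, ← add_sub_assoc]; exact sub _ i ih
  have partialSum : ∀ s : Finset (Fin d), p (∑ i ∈ s, x i • unitVec i) := by
    intro s
    induction s using Finset.induction_on with
    | empty => simpa using zero
    | insert i s hi ih => rw [Finset.sum_insert hi, add_comm]; exact along i _ _ ih
  convert partialSum Finset.univ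
  ext j
  simp [unitVec_apply]

section Pairing

variable {ι : Type*}

/-- The pairing `∑_i θ_i η_i` of finitely supported coefficients with functions on `ι`, as a
continuous linear functional of `η` for the topology of pointwise convergence. -/
noncomputable def finPairing : (ι →₀ ℝ) →ₗ[ℝ] StrongDual ℝ (ι → ℝ) :=
  Finsupp.linearCombination ℝ fun i => ContinuousLinearMap.proj i

theorem finPairing_apply (θ : ι →₀ ℝ) (η : ι → ℝ) : finPairing θ η = θ.sum fun i a => a * η i := by
  simp [finPairing, Finsupp.linearCombination_apply, Finsupp.sum]

theorem finPairing_single (i : ι) (a : ℝ) (η : ι → ℝ) :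
    finPairing (Finsupp.single i a) η = a * η i := by
  simp [finPairing]

theorem finPairing_eq_sum {s : Finset ι} {θ : ι →₀ ℝ} (hθ : θ.support ⊆ s) (η : ι → ℝ) :
    finPairing θ η = ∑ i ∈ s, θ i * η i := by
  rw [finPairing_apply, Finsupp.sum_of_support_subset _ hθ _ (by simp)]

end Pairing

theorem pair_eq_finPairing (f : Lattice d →₀ ℝ) : pair f = finPairing f :=
  funext fun φ => (finPairing_apply f φ).symm

theorem grad_add (φ ψ : Lattice d → ℝ) : grad (φ + ψ) = grad φ + grad ψ := by
  ext b
  simp only [grad, Pi.add_apply]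
  ring

theorem grad_smul (r : ℝ) (φ : Lattice d → ℝ) : grad (r • φ) = r • grad φ := by
  ext b
  simp only [grad, Pi.smul_apply, smul_sub]

theorem grad_sub (φ ψ : Lattice d → ℝ) : grad (φ - ψ) = grad φ - grad ψ := by
  ext b
  simp only [grad, Pi.sub_apply]
  ring

theorem exists_flow_zero (x : Lattice d) :
    ∃ θ : Edge d →₀ ℝ, ∀ φ : Lattice d → ℝ, finPairing θ (grad φ) = φ x - φ 0 := by
  induction x using lattice_induction with
  | zero => exact ⟨0, fun φ => by simp⟩
  | add x i ih =>
    obtain ⟨θ, hθ⟩ := ih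
    refine ⟨θ + Finsupp.single (x, i) 1, fun φ => ?_⟩
    rw [map_add, add_apply, hθ, finPairing_single]
    simp [grad]
  | sub x i ih =>
    obtain ⟨θ, hθ⟩ := ih
    refine ⟨θ - Finsupp.single (x - unitVec i, i) 1, fun φ => ?_⟩
    rw [map_sub, sub_apply, hθ, finPairing_single]
    simp [grad]

/-- A finitely supported unit flow from `0` to `x`. -/
noncomputable def flowTo (x : Lattice d) : Edge d →₀ ℝ := (exists_flow_zero x).choose

theorem finPairing_flowTo (x : Lattice d) (φ : Lattice d → ℝ) :
    finPairing (flowTo x) (grad φ) = φ x - φ 0 := (exists_flow_zero x).choose_spec φ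

/-- A finitely supported flow that transports the charge `f` from the origin. -/
noncomputable def flow : (Lattice d →₀ ℝ) →ₗ[ℝ] (Edge d →₀ ℝ) :=
  Finsupp.linearCombination ℝ flowTo

theorem finPairing_flow (f : Lattice d →₀ ℝ) (φ : Lattice d → ℝ) :
    finPairing (flow f) (grad φ) = pair f φ - (f.sum fun _ a => a) * φ 0 := by
  simp only [flow, Finsupp.linearCombination_apply, Finsupp.sum, map_sum, map_smul,
    sum_apply, smul_apply, finPairing_flowTo, smul_eq_mul,
    mul_sub, Finset.sum_sub_distrib, Finset.sum_mul, pair]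

theorem finPairing_flow_of_zero {f : Lattice d →₀ ℝ} {φ : Lattice d → ℝ} (hφ : φ 0 = 0) :
    finPairing (flow f) (grad φ) = pair f φ := by
  rw [finPairing_flow, hφ, mul_zero, sub_zero]

theorem finPairing_flow_of_sum_eq_zero {f : Lattice d →₀ ℝ} (hf : (f.sum fun _ a => a) = 0)
    (φ : Lattice d → ℝ) : finPairing (flow f) (grad φ) = pair f φ := by
  rw [finPairing_flow, hf, zero_mul, sub_zero]

theorem field_eq_of_grad {η : Edge d → ℝ} {φ : Lattice d → ℝ} (h0 : φ 0 = 0) (h : grad φ = η) :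
    field η = φ := by
  have hex : ∃ φ : Lattice d → ℝ, φ 0 = 0 ∧ grad φ = η := ⟨φ, h0, h⟩
  have hval : ∀ {ψ : Lattice d → ℝ}, ψ 0 = 0 → grad ψ = η → ∀ x, ψ x = finPairing (flowTo x) η :=
    fun hψ0 hψ x => by rw [← hψ, finPairing_flowTo, hψ0, sub_zero]
  rw [field, dif_pos hex]
  ext x
  rw [hval hex.choose_spec.1 hex.choose_spec.2, hval h0 h]

theorem field_zero (η : Edge d → ℝ) : field η 0 = 0 := by
  unfold field
  split_ifs with h
  · exact h.choose_spec.1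
  · rfl

/-- The skew translation of `ℤ^d × ℝ` whose second component accumulates `η` along direction
`i`. -/
def skewShift (η : Edge d → ℝ) (i : Fin d) : Equiv.Perm (Lattice d × ℝ) where
  toFun p := (p.1 + unitVec i, p.2 + η (p.1, i))
  invFun p := (p.1 - unitVec i, p.2 - η (p.1 - unitVec i, i))
  left_inv p := by simp
  right_inv p := by simp

theorem commute_skewShift {η : Edge d → ℝ} (h : LoopCondition η) (i j : Fin d) :
    Commute (skewShift η i) (skewShift η j) := by
  ext p
  · simp [skewShift, add_right_comm]
  · have := h p.1 i j
    simp only [Equiv.Perm.mul_apply, skewShift, Equiv.coe_fn_mk]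
    linarith

theorem exists_skewAction {η : Edge d → ℝ} (h : LoopCondition η) :
    ∃ Φ : Lattice d → Equiv.Perm (Lattice d × ℝ),
      Φ 0 = 1 ∧ ∀ x i, Φ (x + unitVec i) = skewShift η i * Φ x := by
  let F : (Fin d → Multiplicative ℤ) →* Equiv.Perm (Lattice d × ℝ) :=
    MonoidHom.noncommPiCoprod (fun i => zpowersHom _ (skewShift η i)) fun i j _ x y => by
      simpa using (commute_skewShift h i j).zpow_zpow _ _
  have hF : ∀ i, F (Pi.mulSingle i (Multiplicative.ofAdd 1)) = skewShift η i := fun i =>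
    (MonoidHom.noncommPiCoprod_mulSingle _ i _).trans (by simp)
  refine ⟨fun x => F fun i => Multiplicative.ofAdd (x i), map_one F, fun x i => ?_⟩
  rw [← hF i, ← map_mul]
  congr 1
  ext j
  by_cases hj : j = i
  · subst hj; simp [unitVec_apply, add_comm]
  · simp [unitVec_apply, hj]

-- The loop condition makes the skew translations an action of `ℤ^d` on `ℤ^d × ℝ`, and the orbit of
-- `(0, 0)` is the graph of the field.
theorem exists_grad_of_loopCondition {η : Edge d → ℝ} (h : LoopCondition η) :
    ∃ φ : Lattice d → ℝ, φ 0 = 0 ∧ grad φ = η := by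
  obtain ⟨Φ, hzero, hstep⟩ := exists_skewAction h
  have hfst : ∀ x, (Φ x (0, 0)).1 = x := by
    intro x
    induction x using lattice_induction with
    | zero => simp [hzero]
    | add x i ih => simp [hstep, skewShift, ih]
    | sub x i ih =>
      rw [← sub_add_cancel x (unitVec i), hstep] at ih
      exact add_right_cancel (b := unitVec i) ih
  refine ⟨fun x => (Φ x (0, 0)).2, by simp [hzero], ?_⟩
  ext ⟨x, i⟩
  simp [grad, hstep, skewShift, hfst]

theorem grad_field {η : Edge d → ℝ} (h : LoopCondition η) : grad (field η) = η := by
  obtain ⟨φ, h0, hφ⟩ := exists_grad_of_loopCondition h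
  rw [field_eq_of_grad h0 hφ, hφ]

theorem loopCondition_grad (φ : Lattice d → ℝ) : LoopCondition (grad φ) := by
  intro x i j
  simp only [grad]
  rw [add_right_comm x (unitVec j) (unitVec i)]
  ring

theorem field_apply {η : Edge d → ℝ} (h : LoopCondition η) (x : Lattice d) :
    field η x = finPairing (flowTo x) η := by
  conv_rhs => rw [← grad_field h]
  rw [finPairing_flowTo, field_zero, sub_zero]

theorem field_of_not_loopCondition {η : Edge d → ℝ} (h : ¬ LoopCondition η) : field η = 0 := by
  rw [field, dif_neg]
  rintro ⟨φ, -, rfl⟩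
  exact h (loopCondition_grad φ)

theorem isClosed_loopCondition : IsClosed {η : Edge d → ℝ | LoopCondition η} := by
  simp only [LoopCondition, Set.ofPred_forall]
  exact isClosed_iInter fun x => isClosed_iInter fun i => isClosed_iInter fun j =>
    isClosed_eq (by fun_prop) continuous_const

theorem measurable_field : Measurable (field : (Edge d → ℝ) → Lattice d → ℝ) := by
  classical
  refine measurable_pi_lambda _ fun x => ?_
  have heq : (fun η : Edge d → ℝ => field η x) =
      fun η => if LoopCondition η then finPairing (flowTo x) η else 0 := by
    ext η
    split_ifs with h
    · exact field_apply h x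
    · simp [field_of_not_loopCondition h]
  rw [heq]
  exact Measurable.ite isClosed_loopCondition.measurableSet (finPairing _).continuous.measurable
    measurable_const

theorem outside_le (Λ : Finset (Lattice d)) :
    outside Λ ≤ (inferInstance : MeasurableSpace (Edge d → ℝ)) := by
  refine iSup_le fun x => iSup_le fun _ => iSup_le fun y => iSup_le fun _ => ?_
  rw [← BorelSpace.measurable_eq, ← measurable_iff_comap_le]
  exact ((measurable_pi_apply y).comp measurable_field).sub
    ((measurable_pi_apply x).comp measurable_field)

/-! ### The Dirichlet problem in a finite set -/

/-- The divergence `∑_i (w(x, i) - w(x - e_i, i))` of a flow. -/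
def diverg : (Edge d → ℝ) →ₗ[ℝ] (Lattice d → ℝ) where
  toFun w x := ∑ i : Fin d, (w (x, i) - w (x - unitVec i, i))
  map_add' w w' := by
    ext x
    simp only [Pi.add_apply, ← Finset.sum_add_distrib]
    exact Finset.sum_congr rfl fun i _ => by ring
  map_smul' r w := by
    ext x
    simp only [Pi.smul_apply, RingHom.id_apply, Finset.smul_sum, smul_sub]

theorem diverg_apply (w : Edge d → ℝ) (x : Lattice d) :
    diverg w x = ∑ i : Fin d, (w (x, i) - w (x - unitVec i, i)) := rfl

theorem generator_eq_diverg (κ : Edge d → ℝ) (g : Lattice d → ℝ) :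
    generator κ g = diverg (κ * grad g) := by
  ext x
  rw [generator, diverg_apply]
  refine Finset.sum_congr rfl fun i _ => ?_
  simp only [grad, Pi.mul_apply, sub_add_cancel]
  ring

theorem mem_touching {Λ : Finset (Lattice d)} {b : Edge d} :
    b ∈ touching Λ ↔ b.1 ∈ Λ ∨ b.1 + unitVec b.2 ∈ Λ := by
  obtain ⟨x, i⟩ := b
  simp only [touching, Finset.mem_union, Finset.mem_image, Finset.mem_product, Finset.mem_univ,
    and_true, Prod.mk.injEq, Prod.exists]
  refine or_congr Iff.rfl ⟨?_, fun h => ⟨_, i, h, by simp, rfl⟩⟩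
  rintro ⟨y, j, hy, rfl, rfl⟩
  simpa using hy

theorem diverg_congr {Λ : Finset (Lattice d)} {w w' : Edge d → ℝ}
    (h : ∀ b ∈ touching Λ, w b = w' b) {x : Lattice d} (hx : x ∈ Λ) : diverg w x = diverg w' x := by
  rw [diverg_apply, diverg_apply]
  refine Finset.sum_congr rfl fun i _ => ?_
  rw [h _ (mem_touching.2 (Or.inl hx)), h _ (mem_touching.2 (Or.inr (by simpa using hx)))]

theorem grad_eq_zero_of_notMem_touching {Λ : Finset (Lattice d)} {h : Lattice d → ℝ}
    (hh : ∀ x ∉ Λ, h x = 0) {b : Edge d} (hb : b ∉ touching Λ) : grad h b = 0 := by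
  rw [mem_touching, not_or] at hb
  simp [grad, hh _ hb.1, hh _ hb.2]

theorem sum_touching_mul_source {Λ : Finset (Lattice d)} (w : Edge d → ℝ) {h : Lattice d → ℝ}
    (hh : ∀ x ∉ Λ, h x = 0) :
    ∑ b ∈ touching Λ, w b * h b.1 = ∑ x ∈ Λ, ∑ i, w (x, i) * h x := by
  rw [← Finset.sum_product' Λ Finset.univ fun x i => w (x, i) * h x]
  refine (Finset.sum_subset (fun b hb => ?_) fun b _ hb => ?_).symm
  · exact mem_touching.2 (Or.inl (Finset.mem_product.1 hb).1)
  · simp only [Finset.mem_product, Finset.mem_univ, and_true] at hb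
    simp [hh _ hb]

theorem sum_touching_mul_target {Λ : Finset (Lattice d)} (w : Edge d → ℝ) {h : Lattice d → ℝ}
    (hh : ∀ x ∉ Λ, h x = 0) :
    ∑ b ∈ touching Λ, w b * h (b.1 + unitVec b.2) =
      ∑ x ∈ Λ, ∑ i, w (x - unitVec i, i) * h x := by
  rw [← Finset.sum_product' Λ Finset.univ fun x i => w (x - unitVec i, i) * h x]
  symm
  refine Finset.sum_of_injOn (fun b => (b.1 - unitVec b.2, b.2)) ?_ ?_ ?_ ?_
  · rintro ⟨x, i⟩ _ ⟨y, j⟩ _ hxy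
    simp only [Prod.mk.injEq] at hxy
    obtain ⟨hxy, rfl⟩ := hxy
    simpa using hxy
  · rintro ⟨x, i⟩ hx
    simp only [Finset.coe_product, Set.mem_prod, Finset.mem_coe] at hx
    exact mem_touching.2 (Or.inr (by simpa using hx.1))
  · rintro ⟨x, i⟩ _ hx
    rw [hh _ fun hmem => hx ⟨(x + unitVec i, i), by simpa using hmem, by simp⟩, mul_zero]
  · rintro ⟨x, i⟩ _
    simp

theorem sum_touching_mul_grad {Λ : Finset (Lattice d)} (w : Edge d → ℝ) {h : Lattice d → ℝ}
    (hh : ∀ x ∉ Λ, h x = 0) :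
    ∑ b ∈ touching Λ, w b * grad h b = -∑ x ∈ Λ, h x * diverg w x := by
  simp only [grad, mul_sub, Finset.sum_sub_distrib]
  rw [sum_touching_mul_source w hh, sum_touching_mul_target w hh, ← Finset.sum_sub_distrib,
    ← Finset.sum_neg_distrib]
  refine Finset.sum_congr rfl fun x _ => ?_
  rw [diverg_apply, Finset.mul_sum, ← Finset.sum_sub_distrib, ← Finset.sum_neg_distrib]
  exact Finset.sum_congr rfl fun i _ => by ring

/-- The energy `∑_b k_b η_b²` of a configuration `η` on the edges that touch `Λ`. -/
noncomputable def localEnergy (Λ : Finset (Lattice d)) (k η : Edge d → ℝ) : ℝ :=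
  ∑ b ∈ touching Λ, k b * η b ^ 2

theorem localEnergy_nonneg {Λ : Finset (Lattice d)} {k : Edge d → ℝ}
    (hk : ∀ b ∈ touching Λ, 0 < k b) (η : Edge d → ℝ) : 0 ≤ localEnergy Λ k η :=
  Finset.sum_nonneg fun b hb => mul_nonneg (hk b hb).le (sq_nonneg _)

theorem glue_of_notMem {Λ : Finset (Lattice d)} (φ : Lattice d → ℝ) (ψ : Λ → ℝ) {x : Lattice d}
    (hx : x ∉ Λ) : glue Λ φ ψ x = φ x := by simp [glue, hx]

theorem glue_zero_of_notMem {Λ : Finset (Lattice d)} (ψ : Λ → ℝ) {x : Lattice d} (hx : x ∉ Λ) :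
    glue Λ 0 ψ x = 0 := glue_of_notMem 0 ψ hx

theorem glue_coe {Λ : Finset (Lattice d)} (φ : Lattice d → ℝ) (ψ : Λ → ℝ) (x : Λ) :
    glue Λ φ ψ x = ψ x := by simp [glue]

theorem glue_add {Λ : Finset (Lattice d)} (φ φ' : Lattice d → ℝ) (ψ ψ' : Λ → ℝ) :
    glue Λ (φ + φ') (ψ + ψ') = glue Λ φ ψ + glue Λ φ' ψ' := by
  ext x
  by_cases hx : x ∈ Λ <;> simp [glue, hx]

theorem glue_smul {Λ : Finset (Lattice d)} (r : ℝ) (φ : Lattice d → ℝ) (ψ : Λ → ℝ) :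
    glue Λ (r • φ) (r • ψ) = r • glue Λ φ ψ := by
  ext x
  by_cases hx : x ∈ Λ <;> simp [glue, hx]

theorem glue_eq_add_glue_zero {Λ : Finset (Lattice d)} (φ : Lattice d → ℝ) (ψ : Λ → ℝ) :
    glue Λ φ ψ = glue Λ 0 ψ + glue Λ φ 0 := by
  rw [← glue_add, zero_add, add_zero]

theorem glue_zero_restrict {Λ : Finset (Lattice d)} {h : Lattice d → ℝ} (hh : ∀ x ∉ Λ, h x = 0) :
    glue Λ 0 (fun x => h x) = h := by
  ext x
  by_cases hx : x ∈ Λ <;> simp [glue, hx, hh]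

theorem injective_add_smul_unitVec (x : Lattice d) (i : Fin d) :
    Function.Injective fun n : ℕ => x + n • unitVec i := by
  intro n n' h
  simpa [unitVec_apply] using congrFun (add_left_cancel h) i

theorem exists_add_smul_notMem (Λ : Finset (Lattice d)) (x : Lattice d) (i : Fin d) :
    ∃ n : ℕ, x + n • unitVec i ∉ Λ := by
  obtain ⟨y, ⟨n, rfl⟩, hy⟩ :=
    (Set.infinite_range_of_injective (injective_add_smul_unitVec x i)).exists_notMem_finset Λ
  exact ⟨n, hy⟩

-- Telescope `h` along direction `i` from `x` to the first point outside `Λ`.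
theorem sq_le_mul_sum_touching {Λ : Finset (Lattice d)} {h : Lattice d → ℝ}
    (hh : ∀ x ∉ Λ, h x = 0) (x : Lattice d) (i : Fin d) (n : ℕ) (hn : x + n • unitVec i ∉ Λ) :
    h x ^ 2 ≤ n * ∑ b ∈ touching Λ, grad h b ^ 2 := by
  classical
  let e : ℕ → Edge d := fun j => (x + j • unitVec i, i)
  have htel : ∑ j ∈ Finset.range n, grad h (e j) = -h x := by
    have hsum := Finset.sum_range_sub (fun j => h (x + j • unitVec i)) n
    rw [hh _ hn] at hsum
    simpa [e, grad, add_smul, add_assoc] using hsum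
  have hinj : Set.InjOn e (Finset.range n) := fun j _ j' _ hj =>
    injective_add_smul_unitVec x i (congrArg Prod.fst hj)
  have hsupp : ∀ b ∈ (Finset.range n).image e, b ∉ touching Λ → grad h b ^ 2 = 0 :=
    fun b _ hb => by rw [grad_eq_zero_of_notMem_touching hh hb, sq, zero_mul]
  calc h x ^ 2 = (∑ j ∈ Finset.range n, grad h (e j)) ^ 2 := by rw [htel, neg_sq]
    _ ≤ n * ∑ j ∈ Finset.range n, grad h (e j) ^ 2 := by
      simpa using sq_sum_le_card_mul_sum_sq (s := Finset.range n) (f := fun j => grad h (e j))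
    _ = n * ∑ b ∈ (Finset.range n).image e, grad h b ^ 2 := by rw [Finset.sum_image hinj]
    _ ≤ n * ∑ b ∈ touching Λ, grad h b ^ 2 := by
      refine mul_le_mul_of_nonneg_left ?_ (Nat.cast_nonneg _)
      rw [← Finset.sum_inter_add_sum_sdiff _ (touching Λ),
        Finset.sum_eq_zero fun b hb => hsupp b (Finset.mem_sdiff.1 hb).1 (Finset.mem_sdiff.1 hb).2,
        add_zero]
      exact Finset.sum_le_sum_of_subset_of_nonneg Finset.inter_subset_right
        fun b _ _ => sq_nonneg _

theorem eq_zero_of_localEnergy_eq_zero [NeZero d] {Λ : Finset (Lattice d)} {k : Edge d → ℝ}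
    (hk : ∀ b ∈ touching Λ, 0 < k b) {h : Lattice d → ℝ} (hh : ∀ x ∉ Λ, h x = 0)
    (h0 : localEnergy Λ k (grad h) = 0) : h = 0 := by
  have hgrad : ∀ b ∈ touching Λ, grad h b ^ 2 = 0 := fun b hb =>
    (mul_eq_zero.1 ((Finset.sum_eq_zero_iff_of_nonneg fun b hb =>
      mul_nonneg (hk b hb).le (sq_nonneg _)).1 h0 b hb)).resolve_left (hk b hb).ne'
  ext x
  obtain ⟨n, hn⟩ := exists_add_smul_notMem Λ x 0
  have hx := sq_le_mul_sum_touching hh x _ n hn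
  rw [Finset.sum_eq_zero hgrad, mul_zero] at hx
  simpa using le_antisymm hx (sq_nonneg _)

/-- The operator `-L_k` on `Λ` with zero boundary values. -/
def dirichletOperator (Λ : Finset (Lattice d)) (k : Edge d → ℝ) : (Λ → ℝ) →ₗ[ℝ] (Λ → ℝ) where
  toFun ψ x := -diverg (k * grad (glue Λ 0 ψ)) x
  map_add' ψ ψ' := by
    ext x
    rw [← add_zero (0 : Lattice d → ℝ), glue_add, grad_add, mul_add, map_add, add_zero]
    simp only [Pi.add_apply, neg_add]
  map_smul' r ψ := by
    ext x
    rw [← smul_zero r, glue_smul, grad_smul, mul_smul_comm, map_smul, smul_zero]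
    simp only [Pi.smul_apply, RingHom.id_apply, smul_neg]

/-- The matrix of `-L_k` on `Λ` with zero boundary values. -/
noncomputable def dirichletMatrix (Λ : Finset (Lattice d)) (k : Edge d → ℝ) : Matrix Λ Λ ℝ :=
  LinearMap.toMatrix' (dirichletOperator Λ k)

theorem dirichletMatrix_mulVec (Λ : Finset (Lattice d)) (k : Edge d → ℝ) (ψ : Λ → ℝ) (x : Λ) :
    (dirichletMatrix Λ k).mulVec ψ x = -diverg (k * grad (glue Λ 0 ψ)) x := by
  rw [dirichletMatrix, LinearMap.toMatrix'_mulVec]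
  rfl

theorem dotProduct_dirichletMatrix_mulVec (Λ : Finset (Lattice d)) (k : Edge d → ℝ) (ψ : Λ → ℝ) :
    dotProduct ψ ((dirichletMatrix Λ k).mulVec ψ) = localEnergy Λ k (grad (glue Λ 0 ψ)) := by
  calc dotProduct ψ ((dirichletMatrix Λ k).mulVec ψ)
      = -∑ x ∈ Λ, glue Λ 0 ψ x * diverg (k * grad (glue Λ 0 ψ)) x := by
        rw [← Finset.sum_coe_sort Λ, ← Finset.sum_neg_distrib]
        simp only [dotProduct, dirichletMatrix_mulVec, glue_coe, mul_neg]
    _ = localEnergy Λ k (grad (glue Λ 0 ψ)) := by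
        rw [← sum_touching_mul_grad _ fun x hx => glue_zero_of_notMem ψ hx]
        exact Finset.sum_congr rfl fun b _ => by rw [Pi.mul_apply]; ring

theorem isUnit_dirichletMatrix [NeZero d] {Λ : Finset (Lattice d)} {k : Edge d → ℝ}
    (hk : ∀ b ∈ touching Λ, 0 < k b) : IsUnit (dirichletMatrix Λ k) := by
  rw [← Matrix.mulVec_injective_iff_isUnit, ← Matrix.coe_mulVecLin, injective_iff_map_eq_zero]
  intro ψ hψ
  have hE := dotProduct_dirichletMatrix_mulVec Λ k ψ
  rw [← Matrix.mulVecLin_apply, hψ, dotProduct_zero] at hE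
  have hglue : glue Λ 0 ψ = 0 :=
    eq_zero_of_localEnergy_eq_zero hk (fun x hx => glue_zero_of_notMem ψ hx) hE.symm
  ext x
  rw [← glue_coe 0 ψ x, hglue]
  rfl

/-- The solution of `-L_k h = F` on `Λ` with `h = 0` outside `Λ`. It is given by the nonsingular
inverse of the Dirichlet matrix, hence is meaningful for conductances that are positive on the edges
touching `Λ`. -/
noncomputable def dirichletSolve (Λ : Finset (Lattice d)) (k : Edge d → ℝ) (F : Lattice d → ℝ) :
    Lattice d → ℝ :=
  glue Λ 0 ((dirichletMatrix Λ k)⁻¹.mulVec fun x => F x)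

theorem dirichletSolve_of_notMem {Λ : Finset (Lattice d)} (k : Edge d → ℝ) (F : Lattice d → ℝ)
    (x : Lattice d) (hx : x ∉ Λ) : dirichletSolve Λ k F x = 0 :=
  glue_zero_of_notMem _ hx

theorem diverg_dirichletSolve [NeZero d] {Λ : Finset (Lattice d)} {k : Edge d → ℝ}
    (hk : ∀ b ∈ touching Λ, 0 < k b) (F : Lattice d → ℝ) {x : Lattice d} (hx : x ∈ Λ) :
    diverg (k * grad (dirichletSolve Λ k F)) x = -F x := by
  have h := dirichletMatrix_mulVec Λ k ((dirichletMatrix Λ k)⁻¹.mulVec fun x => F x) ⟨x, hx⟩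
  rw [Matrix.mulVec_mulVec, Matrix.mul_nonsing_inv _
    ((Matrix.isUnit_iff_isUnit_det _).1 (isUnit_dirichletMatrix hk)), Matrix.one_mulVec] at h
  rw [h, neg_neg]
  rfl

theorem dirichletSolve_unique [NeZero d] {Λ : Finset (Lattice d)} {k : Edge d → ℝ}
    (hk : ∀ b ∈ touching Λ, 0 < k b) {F h : Lattice d → ℝ} (hh : ∀ x ∉ Λ, h x = 0)
    (hF : ∀ x ∈ Λ, diverg (k * grad h) x = -F x) : h = dirichletSolve Λ k F := by
  have hψ : (dirichletMatrix Λ k).mulVec (fun x => h x) = fun x : Λ => F x := by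
    ext x
    rw [dirichletMatrix_mulVec, glue_zero_restrict hh, hF x x.2, neg_neg]
  rw [dirichletSolve, ← hψ, Matrix.mulVec_mulVec, Matrix.nonsing_inv_mul _
    ((Matrix.isUnit_iff_isUnit_det _).1 (isUnit_dirichletMatrix hk)), Matrix.one_mulVec,
    glue_zero_restrict hh]

theorem sum_touching_dirichletSolve [NeZero d] {Λ : Finset (Lattice d)} {k : Edge d → ℝ}
    (hk : ∀ b ∈ touching Λ, 0 < k b) (F : Lattice d → ℝ) {h : Lattice d → ℝ}
    (hh : ∀ x ∉ Λ, h x = 0) :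
    ∑ b ∈ touching Λ, k b * grad (dirichletSolve Λ k F) b * grad h b = ∑ x ∈ Λ, F x * h x := by
  refine (sum_touching_mul_grad (k * grad (dirichletSolve Λ k F)) hh).trans ?_
  rw [← Finset.sum_neg_distrib]
  refine Finset.sum_congr rfl fun x hx => ?_
  rw [diverg_dirichletSolve hk F hx]
  ring

/-- The quadratic form `(F, G_Λ F)` of the Green function in `Λ` with zero boundary values. -/
noncomputable def greenForm (Λ : Finset (Lattice d)) (k : Edge d → ℝ) (F : Lattice d → ℝ) : ℝ :=
  ∑ x ∈ Λ, F x * dirichletSolve Λ k F x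

theorem greenForm_eq_localEnergy [NeZero d] {Λ : Finset (Lattice d)} {k : Edge d → ℝ}
    (hk : ∀ b ∈ touching Λ, 0 < k b) (F : Lattice d → ℝ) :
    greenForm Λ k F = localEnergy Λ k (grad (dirichletSolve Λ k F)) := by
  rw [greenForm, ← sum_touching_dirichletSolve hk F (dirichletSolve_of_notMem k F)]
  exact Finset.sum_congr rfl fun b _ => by ring

theorem greenForm_nonneg [NeZero d] {Λ : Finset (Lattice d)} {k : Edge d → ℝ}
    (hk : ∀ b ∈ touching Λ, 0 < k b) (F : Lattice d → ℝ) : 0 ≤ greenForm Λ k F := by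
  rw [greenForm_eq_localEnergy hk]
  exact localEnergy_nonneg hk _

theorem greenForm_le_of_sq_le [NeZero d] {Λ : Finset (Lattice d)} {k : Edge d → ℝ}
    (hk : ∀ b ∈ touching Λ, 0 < k b) (F : Lattice d → ℝ) {C : ℝ} (hC : 0 ≤ C)
    (h : ∀ h : Lattice d → ℝ, (∀ x ∉ Λ, h x = 0) →
      (∑ x ∈ Λ, F x * h x) ^ 2 ≤ C * localEnergy Λ k (grad h)) :
    greenForm Λ k F ≤ C := by
  have hsq : greenForm Λ k F ^ 2 ≤ C * greenForm Λ k F := by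
    exact (h _ (dirichletSolve_of_notMem k F)).trans_eq (by rw [← greenForm_eq_localEnergy hk])
  rcases (greenForm_nonneg hk F).eq_or_lt with h0 | h0
  · exact h0 ▸ hC
  · rw [sq] at hsq
    exact le_of_mul_le_mul_right hsq h0

/-- The part of a gradient configuration that is resampled in `Λ`: the field `ζ` supported in `Λ`
for which `η - ∇ζ` is divergence free in `Λ` with respect to the conductances `k`. -/
noncomputable def dirichletPart (Λ : Finset (Lattice d)) (k η : Edge d → ℝ) : Lattice d → ℝ :=
  dirichletSolve Λ k (-diverg (k * η))

/-- The `k`-harmonic part `η - ∇ζ` in `Λ`. -/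
noncomputable def harmonicPart (Λ : Finset (Lattice d)) (k η : Edge d → ℝ) : Edge d → ℝ :=
  η - grad (dirichletPart Λ k η)

theorem dirichletPart_of_notMem {Λ : Finset (Lattice d)} (k η : Edge d → ℝ) (x : Lattice d)
    (hx : x ∉ Λ) : dirichletPart Λ k η x = 0 :=
  dirichletSolve_of_notMem _ _ x hx

theorem diverg_harmonicPart [NeZero d] {Λ : Finset (Lattice d)} {k : Edge d → ℝ}
    (hk : ∀ b ∈ touching Λ, 0 < k b) (η : Edge d → ℝ) {x : Lattice d} (hx : x ∈ Λ) :
    diverg (k * harmonicPart Λ k η) x = 0 := by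
  rw [harmonicPart, mul_sub, map_sub, Pi.sub_apply, dirichletPart, diverg_dirichletSolve hk _ hx,
    Pi.neg_apply, neg_neg, sub_self]

theorem dirichletPart_unique [NeZero d] {Λ : Finset (Lattice d)} {k : Edge d → ℝ}
    (hk : ∀ b ∈ touching Λ, 0 < k b) {η : Edge d → ℝ} {h : Lattice d → ℝ} (hh : ∀ x ∉ Λ, h x = 0)
    (hF : ∀ x ∈ Λ, diverg (k * (η - grad h)) x = 0) : h = dirichletPart Λ k η := by
  refine dirichletSolve_unique hk hh fun x hx => ?_
  have hx' := hF x hx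
  rw [mul_sub, map_sub, Pi.sub_apply, sub_eq_zero] at hx'
  rw [← hx', Pi.neg_apply, neg_neg]

theorem dirichletPart_glue [NeZero d] {Λ : Finset (Lattice d)} {k : Edge d → ℝ}
    (hk : ∀ b ∈ touching Λ, 0 < k b) (φ : Lattice d → ℝ) (ψ : Λ → ℝ) :
    dirichletPart Λ k (grad (glue Λ φ ψ)) =
      glue Λ 0 ψ + dirichletPart Λ k (grad (glue Λ φ 0)) := by
  refine (dirichletPart_unique hk (fun x hx => ?_) fun x hx => ?_).symm
  · rw [Pi.add_apply, glue_zero_of_notMem ψ hx, dirichletPart_of_notMem _ _ x hx, add_zero]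
  · rw [glue_eq_add_glue_zero φ ψ, grad_add, grad_add, add_sub_add_left_eq_sub]
    exact diverg_harmonicPart hk (grad (glue Λ φ 0)) hx

theorem harmonicPart_glue [NeZero d] {Λ : Finset (Lattice d)} {k : Edge d → ℝ}
    (hk : ∀ b ∈ touching Λ, 0 < k b) (φ : Lattice d → ℝ) (ψ : Λ → ℝ) :
    harmonicPart Λ k (grad (glue Λ φ ψ)) = harmonicPart Λ k (grad (glue Λ φ 0)) := by
  rw [harmonicPart, dirichletPart_glue hk, glue_eq_add_glue_zero φ ψ, grad_add, grad_add,
    add_sub_add_left_eq_sub, harmonicPart]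

-- Pythagoras: the harmonic and the resampled part are orthogonal for the energy.
theorem localEnergy_eq_add [NeZero d] {Λ : Finset (Lattice d)} {k : Edge d → ℝ}
    (hk : ∀ b ∈ touching Λ, 0 < k b) (η : Edge d → ℝ) :
    localEnergy Λ k η =
      localEnergy Λ k (harmonicPart Λ k η) + localEnergy Λ k (grad (dirichletPart Λ k η)) := by
  have horth : ∑ b ∈ touching Λ, (k * harmonicPart Λ k η) b * grad (dirichletPart Λ k η) b = 0 := by
    rw [sum_touching_mul_grad _ (dirichletPart_of_notMem k η), neg_eq_zero]
    exact Finset.sum_eq_zero fun x hx => by rw [diverg_harmonicPart hk η hx, mul_zero]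
  rw [← add_zero (localEnergy Λ k (harmonicPart Λ k η) + _), ← mul_zero 2, ← horth]
  simp only [localEnergy, Finset.mul_sum, ← Finset.sum_add_distrib]
  refine Finset.sum_congr rfl fun b _ => ?_
  simp only [harmonicPart, Pi.sub_apply, Pi.mul_apply]
  ring

theorem grad_comp_add_right (x : Lattice d) (φ : Lattice d → ℝ) :
    grad (fun y => φ (y + x)) = translate x (grad φ) := by
  ext b
  simp only [grad, translate, add_right_comm _ x]

theorem diverg_translate (x : Lattice d) (w : Edge d → ℝ) :
    diverg (translate x w) = fun y => diverg w (y + x) := by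
  ext y
  simp only [diverg_apply, translate, sub_add_eq_add_sub]

theorem dirichletSolve_translate [NeZero d] {Λ Λ' : Finset (Lattice d)} {k : Edge d → ℝ}
    (x : Lattice d) (hΛ : ∀ y, y + x ∈ Λ' ↔ y ∈ Λ) (hk : ∀ b, 0 < k b) (F : Lattice d → ℝ) :
    (fun y => dirichletSolve Λ' k F (y + x)) =
      dirichletSolve Λ (translate x k) fun y => F (y + x) := by
  refine dirichletSolve_unique (fun b _ => hk _) (fun y hy => ?_) fun y hy => ?_
  · exact dirichletSolve_of_notMem _ _ _ (by rwa [hΛ])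
  · rw [← diverg_dirichletSolve (fun b _ => hk b) F ((hΛ y).2 hy), grad_comp_add_right]
    exact congrFun (diverg_translate x (k * grad (dirichletSolve Λ' k F))) y

theorem harmonicPart_translate [NeZero d] {Λ Λ' : Finset (Lattice d)} {k : Edge d → ℝ}
    (x : Lattice d) (hΛ : ∀ y, y + x ∈ Λ' ↔ y ∈ Λ) (hk : ∀ b, 0 < k b) (η : Edge d → ℝ) :
    translate x (harmonicPart Λ' k η) = harmonicPart Λ (translate x k) (translate x η) := by
  have hdiv : -diverg (translate x k * translate x η) = fun y => (-diverg (k * η)) (y + x) :=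
    congrArg Neg.neg (diverg_translate x (k * η))
  rw [harmonicPart, harmonicPart, dirichletPart, dirichletPart, hdiv,
    ← dirichletSolve_translate x hΛ hk, grad_comp_add_right]
  rfl

/-- The truncation of `s` to the interval `[-K, K]`. -/
noncomputable def clamp (K s : ℝ) : ℝ := max (-K) (min K s)

theorem abs_clamp_le {K : ℝ} (hK : 0 ≤ K) (s : ℝ) : |clamp K s| ≤ K :=
  abs_le.2 ⟨le_max_left _ _, max_le (by linarith) (min_le_left _ _)⟩

theorem clamp_of_abs_le {K s : ℝ} (h : |s| ≤ K) : clamp K s = s := by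
  rw [clamp, min_eq_right (abs_le.1 h).2, max_eq_right (abs_le.1 h).1]

theorem monotone_clamp (K : ℝ) : Monotone (clamp K) :=
  monotone_const.max (monotone_const.min monotone_id)

theorem abs_clamp_sub_clamp_le (K s t : ℝ) : |clamp K s - clamp K t| ≤ |s - t| := by
  rw [clamp, clamp, max_comm (-K), max_comm (-K)]
  refine (abs_max_sub_max_le_abs _ _ _).trans ((abs_min_sub_min_le_max K s K t).trans_eq ?_)
  rw [sub_self, abs_zero, max_eq_right (abs_nonneg _)]

theorem sq_clamp_sub_clamp_le (K s t : ℝ) :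
    (clamp K s - clamp K t) ^ 2 ≤ (s - t) * (clamp K s - clamp K t) := by
  have hsign : 0 ≤ (s - t) * (clamp K s - clamp K t) := by
    rcases le_total s t with h | h
    · exact mul_nonneg_of_nonpos_of_nonpos (sub_nonpos.2 h) (sub_nonpos.2 (monotone_clamp K h))
    · exact mul_nonneg (sub_nonneg.2 h) (sub_nonneg.2 (monotone_clamp K h))
  rw [← abs_of_nonneg hsign, abs_mul, ← sq_abs, sq]
  exact mul_le_mul_of_nonneg_right (abs_clamp_sub_clamp_le K s t) (abs_nonneg _)

-- Caccioppoli's inequality for the truncation: test harmonicity of `u` with `χ · clamp K u`.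
theorem sum_cutoff_mul_sq_grad_clamp_le {Λ : Finset (Lattice d)} {k : Edge d → ℝ}
    {u χ : Lattice d → ℝ} {a c K : ℝ} (ha : 0 ≤ a) (hk : ∀ b ∈ touching Λ, k b ∈ Set.Icc a c)
    (hK : 0 ≤ K) (hu : ∀ x ∈ Λ, diverg (k * grad u) x = 0)
    (hχ : ∀ x, 0 ≤ χ x) (hχΛ : ∀ x ∉ Λ, χ x = 0) (hχ1 : ∀ b, |grad χ b| ≤ 1) :
    a * ∑ b ∈ touching Λ, χ b.1 * grad (fun x => clamp K (u x)) b ^ 2 ≤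
      c * K * ∑ b ∈ touching Λ, |grad u b| := by
  set T : Lattice d → ℝ := fun x => clamp K (u x)
  have htest : ∑ b ∈ touching Λ, (k * grad u) b * grad (χ * T) b = 0 := by
    rw [sum_touching_mul_grad _ fun x hx => by rw [Pi.mul_apply, hχΛ x hx, zero_mul], neg_eq_zero]
    exact Finset.sum_eq_zero fun x hx => by rw [hu x hx, mul_zero]
  rw [← zero_add (c * K * _), ← htest, Finset.mul_sum, Finset.mul_sum, ← Finset.sum_add_distrib]
  refine Finset.sum_le_sum fun b hb => ?_
  obtain ⟨hka, hkc⟩ := hk b hb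
  have hleibniz : grad (χ * T) b = χ b.1 * grad T b + T (b.1 + unitVec b.2) * grad χ b := by
    simp only [grad, Pi.mul_apply]
    ring
  have hmain : a * (χ b.1 * grad T b ^ 2) ≤ k b * χ b.1 * (grad u b * grad T b) := by
    rw [← mul_assoc]
    exact mul_le_mul (mul_le_mul_of_nonneg_right hka (hχ _)) (sq_clamp_sub_clamp_le K _ _)
      (sq_nonneg _) (mul_nonneg (ha.trans hka) (hχ _))
  have herror : |k b * grad u b * (T (b.1 + unitVec b.2) * grad χ b)| ≤ c * K * |grad u b| := by
    have hc : 0 ≤ c := (ha.trans hka).trans hkc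
    rw [abs_mul, abs_mul, abs_mul, abs_of_nonneg (ha.trans hka)]
    calc k b * |grad u b| * (|T (b.1 + unitVec b.2)| * |grad χ b|)
        ≤ c * |grad u b| * (K * 1) := by
          gcongr
          exacts [abs_clamp_le hK _, hχ1 b]
      _ = c * K * |grad u b| := by ring
  rw [hleibniz, Pi.mul_apply]
  linarith [neg_abs_le (k b * grad u b * (T (b.1 + unitVec b.2) * grad χ b))]

/-! ### The Green function in infinite volume -/

theorem finPairing_grad_eq_sum (θ : Edge d →₀ ℝ) {Λ : Finset (Lattice d)} {h : Lattice d → ℝ}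
    (hh : ∀ x ∉ Λ, h x = 0) : finPairing θ (grad h) = ∑ x ∈ Λ, -diverg θ x * h x := by
  classical
  rw [finPairing_eq_sum (s := θ.support ∪ touching Λ) Finset.subset_union_left,
    ← Finset.sum_subset Finset.subset_union_right fun b _ hb => by
      rw [grad_eq_zero_of_notMem_touching hh hb, mul_zero],
    sum_touching_mul_grad θ hh, ← Finset.sum_neg_distrib]
  exact Finset.sum_congr rfl fun x _ => by ring

theorem coe_eq_zero_of_support_subset {h : Lattice d →₀ ℝ} {Λ : Finset (Lattice d)}
    (hh : h.support ⊆ Λ) (x : Lattice d) (hx : x ∉ Λ) : h x = 0 :=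
  Finsupp.notMem_support_iff.1 fun hx' => hx (hh hx')

theorem memℓp_of_forall_notMem_eq_zero {ι : Type*} {v : ι → ℝ} {s : Finset ι}
    (hv : ∀ i ∉ s, v i = 0) : Memℓp v 2 :=
  (memℓp_zero (s.finite_toSet.subset fun i hi => not_imp_comm.1 (hv i) hi)).of_exponent_ge zero_le

theorem memℓp_sqrtGrad (κ : Edge d → ℝ) (h : Lattice d →₀ ℝ) :
    Memℓp (fun b => √(κ b) * grad h b) 2 :=
  memℓp_of_forall_notMem_eq_zero (s := touching h.support) fun b hb => by
    rw [grad_eq_zero_of_notMem_touching (coe_eq_zero_of_support_subset subset_rfl) hb, mul_zero]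

/-- The map `h ↦ (√κ_b (∇h)_b)_b` from finitely supported functions to `ℓ²`, which turns the
Dirichlet energy into the squared norm. -/
noncomputable def sqrtGrad (κ : Edge d → ℝ) :
    (Lattice d →₀ ℝ) →ₗ[ℝ] lp (fun _ : Edge d => ℝ) 2 where
  toFun h := ⟨_, memℓp_sqrtGrad κ h⟩
  map_add' h h' := by
    ext b
    simp only [Finsupp.coe_add, grad_add, Pi.add_apply, mul_add, lp.coeFn_add]
  map_smul' r h := by
    ext b
    simp only [Finsupp.coe_smul, grad_smul, Pi.smul_apply, smul_eq_mul, RingHom.id_apply,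
      lp.coeFn_smul, mul_left_comm]

theorem sqrtGrad_apply (κ : Edge d → ℝ) (h : Lattice d →₀ ℝ) (b : Edge d) :
    sqrtGrad κ h b = √(κ b) * grad h b := rfl

theorem inner_sqrtGrad {κ : Edge d → ℝ} (hκ : ∀ b, 0 ≤ κ b) {η : Edge d → ℝ}
    {w : lp (fun _ : Edge d => ℝ) 2} (hw : ∀ b, w b = √(κ b) * η b) {Λ : Finset (Lattice d)}
    {h : Lattice d →₀ ℝ} (hh : h.support ⊆ Λ) :
    inner ℝ w (sqrtGrad κ h) = ∑ x ∈ Λ, -diverg (κ * η) x * h x := by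
  have hzero := coe_eq_zero_of_support_subset hh
  rw [lp.inner_eq_tsum, tsum_eq_sum (s := touching Λ) fun b hb => by
    rw [sqrtGrad_apply, grad_eq_zero_of_notMem_touching hzero hb, mul_zero, inner_zero_right]]
  calc ∑ b ∈ touching Λ, inner ℝ (w b) (sqrtGrad κ h b)
      = ∑ b ∈ touching Λ, (κ * η) b * grad h b := by
        refine Finset.sum_congr rfl fun b _ => ?_
        rw [hw, sqrtGrad_apply, RCLike.inner_apply, conj_trivial, mul_mul_mul_comm,
          Real.mul_self_sqrt (hκ b), Pi.mul_apply]
        ring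
    _ = ∑ x ∈ Λ, -diverg (κ * η) x * h x := by
        rw [sum_touching_mul_grad _ hzero, ← Finset.sum_neg_distrib]
        exact Finset.sum_congr rfl fun x _ => by ring

theorem energy_eq_ofReal_norm_sq {κ : Edge d → ℝ} (hκ : ∀ b, 0 ≤ κ b) {g : Lattice d → ℝ}
    {w : lp (fun _ : Edge d => ℝ) 2} (hw : ∀ b, w b = √(κ b) * grad g b) :
    energy κ g = ENNReal.ofReal (‖w‖ ^ 2) := by
  have hsum := lp.hasSum_inner (𝕜 := ℝ) w w
  simp only [real_inner_self_eq_norm_sq, Real.norm_eq_abs, sq_abs, hw, mul_pow,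
    Real.sq_sqrt (hκ _)] at hsum
  rw [energy, ← hsum.tsum_eq,
    ENNReal.ofReal_tsum_of_nonneg (fun b => mul_nonneg (hκ b) (sq_nonneg _)) hsum.summable]

theorem memℓp_of_energy_ne_top {κ : Edge d → ℝ} (hκ : ∀ b, 0 ≤ κ b) {g : Lattice d → ℝ}
    (hg : energy κ g ≠ ∞) : Memℓp (fun b => √(κ b) * grad g b) 2 := by
  refine memℓp_gen ?_
  have hsum := ENNReal.summable_toReal hg
  simpa [mul_pow, Real.sq_sqrt (hκ _), hκ, mul_nonneg, sq_nonneg] using hsum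

/-- The closure in `ℓ²` of the vectors `√κ ∇h` with finitely supported `h`. -/
noncomputable def gradSpace (κ : Edge d → ℝ) : Submodule ℝ (lp (fun _ : Edge d => ℝ) 2) :=
  (LinearMap.range (sqrtGrad κ)).topologicalClosure

instance completeSpace_gradSpace (κ : Edge d → ℝ) : CompleteSpace (gradSpace κ) :=
  (Submodule.isClosed_topologicalClosure _).completeSpace_coe

open Classical in
/-- The vector `θ / √κ` of `ℓ²`, whose scalar product with `√κ η` is the pairing of `θ` with `η`. -/
noncomputable def scaledFlow (κ : Edge d → ℝ) :
    (Edge d →₀ ℝ) →ₗ[ℝ] lp (fun _ : Edge d => ℝ) 2 :=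
  Finsupp.linearCombination ℝ fun b => lp.single 2 b (√(κ b))⁻¹

theorem inner_scaledFlow {κ : Edge d → ℝ} (hκ : ∀ b, 0 < κ b) {η : Edge d → ℝ}
    {w : lp (fun _ : Edge d => ℝ) 2} (hw : ∀ b, w b = √(κ b) * η b) (θ : Edge d →₀ ℝ) :
    inner ℝ (scaledFlow κ θ) w = finPairing θ η := by
  classical
  rw [scaledFlow, Finsupp.linearCombination_apply, Finsupp.sum, sum_inner, finPairing_apply,
    Finsupp.sum]
  refine Finset.sum_congr rfl fun b _ => ?_
  have hb : √(κ b) ≠ 0 := (Real.sqrt_pos.2 (hκ b)).ne'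
  rw [real_inner_smul_left, lp.inner_single_left, hw, RCLike.inner_apply, conj_trivial]
  field_simp

/-- The orthogonal projection of `θ / √κ` onto the closure of the gradients. It is `√κ ∇g` for the
solution `g` of `L_κ g = div θ`, and its scalar products define the Green function. -/
noncomputable def gradPart (κ : Edge d → ℝ) : (Edge d →₀ ℝ) →ₗ[ℝ] lp (fun _ : Edge d => ℝ) 2 :=
  (gradSpace κ).starProjection.toLinearMap ∘ₗ scaledFlow κ

theorem inner_gradPart_left (κ : Edge d → ℝ) (θ : Edge d →₀ ℝ) {w : lp (fun _ : Edge d => ℝ) 2}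
    (hw : w ∈ gradSpace κ) : inner ℝ (gradPart κ θ) w = inner ℝ (scaledFlow κ θ) w := by
  have h := (gradSpace κ).starProjection_inner_eq_zero (scaledFlow κ θ) w hw
  rw [inner_sub_left, sub_eq_zero] at h
  exact h.symm

theorem gradPart_mem (κ : Edge d → ℝ) (θ : Edge d →₀ ℝ) : gradPart κ θ ∈ gradSpace κ :=
  (gradSpace κ).starProjection_apply_mem _

theorem sqrtGrad_mem_gradSpace (κ : Edge d → ℝ) (h : Lattice d →₀ ℝ) :
    sqrtGrad κ h ∈ gradSpace κ :=
  Submodule.le_topologicalClosure _ (LinearMap.mem_range_self _ h)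

theorem gradPart_eq_of_mem {κ : Edge d → ℝ} {θ : Edge d →₀ ℝ} {w : lp (fun _ : Edge d => ℝ) 2}
    (hw : w ∈ gradSpace κ)
    (h : ∀ h, inner ℝ (scaledFlow κ θ) (sqrtGrad κ h) = inner ℝ w (sqrtGrad κ h)) :
    gradPart κ θ = w := by
  refine Submodule.eq_starProjection_of_mem_orthogonal hw ?_
  rw [gradSpace, Submodule.orthogonal_closure, Submodule.mem_orthogonal']
  rintro _ ⟨h', rfl⟩
  rw [inner_sub_left, h, sub_self]

theorem mem_gradSpace_iff {κ : Edge d → ℝ} {w : lp (fun _ : Edge d => ℝ) 2} :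
    w ∈ gradSpace κ ↔
      ∃ h : ℕ → Lattice d →₀ ℝ, Tendsto (fun n => sqrtGrad κ (h n)) atTop (𝓝 w) := by
  rw [gradSpace, ← SetLike.mem_coe, Submodule.topologicalClosure_coe, mem_closure_iff_seq_limit]
  constructor
  · rintro ⟨s, hs, hlim⟩
    choose h hh using hs
    exact ⟨h, by simpa only [hh] using hlim⟩
  · rintro ⟨h, hlim⟩
    exact ⟨_, fun n => LinearMap.mem_range_self _ (h n), hlim⟩

theorem exists_eq_sqrt_mul_grad {κ : Edge d → ℝ} (hκ : ∀ b, 0 < κ b)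
    {w : lp (fun _ : Edge d => ℝ) 2} (hw : w ∈ gradSpace κ) :
    ∃ g : Lattice d → ℝ, ∀ b, w b = √(κ b) * grad g b := by
  have hs : ∀ b, √(κ b) ≠ 0 := fun b => (Real.sqrt_pos.2 (hκ b)).ne'
  obtain ⟨h, hlim⟩ := mem_gradSpace_iff.1 hw
  have hcoord : Tendsto (fun n => grad (h n)) atTop (𝓝 fun b => w b / √(κ b)) := by
    refine tendsto_pi_nhds.2 fun b => ?_
    have hb : Tendsto (fun n => sqrtGrad κ (h n) b) atTop (𝓝 (w b)) :=
      ((lp.evalCLM ℝ _ 2 b).continuous.tendsto w).comp hlim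
    exact (hb.div_const _).congr fun n => mul_div_cancel_left₀ _ (hs b)
  have hloop : LoopCondition _ := isClosed_loopCondition.mem_of_tendsto hcoord
    (Eventually.of_forall fun n => loopCondition_grad _)
  exact ⟨field _, fun b => by rw [grad_field hloop, mul_div_cancel₀ _ (hs b)]⟩

theorem tendsto_energy_sub_iff {κ : Edge d → ℝ} (hκ : ∀ b, 0 ≤ κ b) {g : Lattice d → ℝ}
    {w : lp (fun _ : Edge d => ℝ) 2} (hw : ∀ b, w b = √(κ b) * grad g b)
    (h : ℕ → Lattice d →₀ ℝ) :
    Tendsto (fun n => energy κ fun x => g x - h n x) atTop (𝓝 0) ↔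
      Tendsto (fun n => sqrtGrad κ (h n)) atTop (𝓝 w) := by
  have henergy : ∀ n, energy κ (fun x => g x - h n x) =
      ENNReal.ofReal (‖sqrtGrad κ (h n) - w‖ ^ 2) := fun n => by
    rw [norm_sub_rev]
    refine energy_eq_ofReal_norm_sq hκ fun b => ?_
    rw [lp.coeFn_sub, Pi.sub_apply, hw, sqrtGrad_apply, ← mul_sub]
    exact congrArg _ (congrFun (grad_sub g (h n)) b).symm
  rw [tendsto_iff_norm_sub_tendsto_zero]
  simp only [henergy]
  constructor <;> intro hlim
  · have hsq := (ENNReal.tendsto_toReal ENNReal.zero_ne_top).comp hlim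
    have habs := (hsq.congr fun n => ENNReal.toReal_ofReal (sq_nonneg _)).sqrt
    simpa using habs
  · simpa using ENNReal.tendsto_ofReal (hlim.pow 2)

theorem inner_scaledFlow_sqrtGrad {κ : Edge d → ℝ} (hκ : ∀ b, 0 < κ b) (θ : Edge d →₀ ℝ)
    {Λ : Finset (Lattice d)} {h : Lattice d →₀ ℝ} (hh : h.support ⊆ Λ) :
    inner ℝ (scaledFlow κ θ) (sqrtGrad κ h) = ∑ x ∈ Λ, -diverg θ x * h x := by
  rw [inner_scaledFlow hκ (sqrtGrad_apply κ h),
    finPairing_grad_eq_sum θ (coe_eq_zero_of_support_subset hh)]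

theorem memℓp_of_tendsto_energy_sub {κ : Edge d → ℝ} (hκ : ∀ b, 0 ≤ κ b) {g : Lattice d → ℝ}
    {h : ℕ → Lattice d →₀ ℝ} (hlim : Tendsto (fun n => energy κ fun x => g x - h n x) atTop (𝓝 0)) :
    Memℓp (fun b => √(κ b) * grad g b) 2 := by
  obtain ⟨n, hn⟩ := (hlim.eventually (gt_mem_nhds ENNReal.zero_lt_top)).exists
  convert (memℓp_of_energy_ne_top hκ hn.ne).add (memℓp_sqrtGrad κ (h n)) using 1
  ext b
  simp only [Pi.add_apply, grad]
  ring

theorem gradPart_apply_eq_iff {κ : Edge d → ℝ} (hκ : ∀ b, 0 < κ b) {θ : Edge d →₀ ℝ}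
    {g : Lattice d → ℝ} :
    (∀ b, gradPart κ θ b = √(κ b) * grad g b) ↔
      (∀ x, diverg (κ * grad g) x = diverg θ x) ∧
        ∃ h : ℕ → Lattice d →₀ ℝ, Tendsto (fun n => energy κ fun x => g x - h n x) atTop (𝓝 0) := by
  have hκ0 := fun b => (hκ b).le
  constructor
  · intro hg
    obtain ⟨h, hlim⟩ := mem_gradSpace_iff.1 (gradPart_mem κ θ)
    refine ⟨fun x => ?_, h, (tendsto_energy_sub_iff hκ0 hg h).2 hlim⟩
    have hx := inner_gradPart_left κ θ (sqrtGrad_mem_gradSpace κ (Finsupp.single x 1))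
    rw [inner_sqrtGrad hκ0 hg Finsupp.support_single_subset,
      inner_scaledFlow_sqrtGrad hκ θ Finsupp.support_single_subset] at hx
    simpa using hx
  · rintro ⟨hg, h, hlim⟩ b
    let w : lp (fun _ : Edge d => ℝ) 2 := ⟨_, memℓp_of_tendsto_energy_sub hκ0 hlim⟩
    have hw : w ∈ gradSpace κ :=
      mem_gradSpace_iff.2 ⟨h, (tendsto_energy_sub_iff hκ0 (fun b => rfl) h).1 hlim⟩
    have heq : gradPart κ θ = w := gradPart_eq_of_mem hw fun h' => by
      rw [inner_scaledFlow_sqrtGrad hκ θ subset_rfl,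
        inner_sqrtGrad hκ0 (w := w) (fun b => rfl) subset_rfl]
      simp only [hg]
    rw [heq]

theorem neg_diverg_flow {f : Lattice d →₀ ℝ} (hf : (f.sum fun _ a => a) = 0) (x : Lattice d) :
    -diverg (flow f) x = f x := by
  have hx := finPairing_grad_eq_sum (flow f) (Λ := {x}) (h := Finsupp.single x 1)
    (coe_eq_zero_of_support_subset Finsupp.support_single_subset)
  rw [finPairing_flow_of_sum_eq_zero hf, Finset.sum_singleton, Finsupp.single_eq_same, mul_one,
    pair_eq_finPairing] at hx
  rw [← hx, finPairing_eq_sum (s := insert x f.support) (Finset.subset_insert _ _),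
    Finset.sum_eq_single_of_mem x (Finset.mem_insert_self _ _) fun y _ hy => by
      rw [Finsupp.single_eq_of_ne hy, mul_zero], Finsupp.single_eq_same, mul_one]

theorem isInverseImage_iff {κ : Edge d → ℝ} (hκ : ∀ b, 0 < κ b) {f : Lattice d →₀ ℝ}
    (hf : (f.sum fun _ a => a) = 0) {g : Lattice d → ℝ} :
    IsInverseImage κ f g ↔ ∀ b, gradPart κ (flow f) b = √(κ b) * grad g b := by
  simp only [gradPart_apply_eq_iff hκ, IsInverseImage, generator_eq_diverg, ← neg_diverg_flow hf,
    neg_inj]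

theorem exists_isInverseImage {κ : Edge d → ℝ} (hκ : ∀ b, 0 < κ b) {f : Lattice d →₀ ℝ}
    (hf : (f.sum fun _ a => a) = 0) : ∃ g, IsInverseImage κ f g := by
  obtain ⟨g, hg⟩ := exists_eq_sqrt_mul_grad hκ (gradPart_mem κ (flow f))
  exact ⟨g, (isInverseImage_iff hκ hf).2 hg⟩

theorem inner_gradPart_flow {κ : Edge d → ℝ} (hκ : ∀ b, 0 < κ b) {f f' : Lattice d →₀ ℝ}
    (hf : (f.sum fun _ a => a) = 0) (hf' : (f'.sum fun _ a => a) = 0) {g : Lattice d → ℝ}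
    (hg : IsInverseImage κ f g) :
    inner ℝ (gradPart κ (flow f')) (gradPart κ (flow f)) = pair f' g := by
  rw [inner_gradPart_left κ _ (gradPart_mem κ _),
    inner_scaledFlow hκ ((isInverseImage_iff hκ hf).1 hg), finPairing_flow_of_sum_eq_zero hf']

/-- The vectors `√κ ∇h` with `h` supported in `Λ`. -/
noncomputable def dirichletSpace (κ : Edge d → ℝ) (Λ : Finset (Lattice d)) :
    Submodule ℝ (lp (fun _ : Edge d => ℝ) 2) :=
  (Finsupp.supported ℝ ℝ (Λ : Set (Lattice d))).map (sqrtGrad κ)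

instance finiteDimensional_dirichletSpace (κ : Edge d → ℝ) (Λ : Finset (Lattice d)) :
    FiniteDimensional ℝ (dirichletSpace κ Λ) := by
  have := Module.Finite.equiv
    (Finsupp.supportedEquivFinsupp (M := ℝ) (R := ℝ) (Λ : Set (Lattice d))).symm
  exact Module.Finite.map (Finsupp.supported ℝ ℝ (Λ : Set (Lattice d))) (sqrtGrad κ)

theorem monotone_dirichletSpace (κ : Edge d → ℝ) : Monotone (dirichletSpace κ) :=
  fun _ _ h => Submodule.map_mono (Finsupp.supported_mono (Finset.coe_subset.2 h))

theorem iSup_dirichletSpace (κ : Edge d → ℝ) :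
    ⨆ Λ, dirichletSpace κ Λ = LinearMap.range (sqrtGrad κ) := by
  refine le_antisymm (iSup_le fun Λ => LinearMap.map_le_range) ?_
  rintro _ ⟨h, rfl⟩
  exact Submodule.mem_iSup_of_mem h.support
    (Submodule.mem_map_of_mem ((Finsupp.mem_supported ℝ h).2 subset_rfl))

theorem greenForm_eq_norm_sq [NeZero d] {κ : Edge d → ℝ} (hκ : ∀ b, 0 < κ b)
    (Λ : Finset (Lattice d)) (θ : Edge d →₀ ℝ) :
    greenForm Λ κ (-diverg θ) =
      ‖(dirichletSpace κ Λ).starProjection (scaledFlow κ θ)‖ ^ 2 := by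
  have hzero := dirichletSolve_of_notMem (Λ := Λ) κ (-diverg θ)
  let h : Lattice d →₀ ℝ := Finsupp.onFinset Λ (dirichletSolve Λ κ (-diverg θ))
    fun x => not_imp_comm.1 (hzero x)
  have hcoe : ⇑h = dirichletSolve Λ κ (-diverg θ) := rfl
  have hsupp : h.support ⊆ Λ := Finsupp.support_onFinset_subset
  have hproj : (dirichletSpace κ Λ).starProjection (scaledFlow κ θ) = sqrtGrad κ h := by
    refine Submodule.eq_starProjection_of_mem_of_inner_eq_zero
      (Submodule.mem_map_of_mem (Finset.coe_subset.2 hsupp)) ?_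
    rintro _ ⟨h', hh', rfl⟩
    have hh' : h'.support ⊆ Λ := Finset.coe_subset.1 hh'
    rw [inner_sub_left, inner_scaledFlow_sqrtGrad hκ θ hh',
      inner_sqrtGrad (fun b => (hκ b).le) (sqrtGrad_apply κ h) hh', sub_eq_zero]
    refine Finset.sum_congr rfl fun x hx => ?_
    rw [hcoe, diverg_dirichletSolve (fun b _ => hκ b) _ hx, neg_neg, Pi.neg_apply]
  rw [hproj, ← real_inner_self_eq_norm_sq,
    inner_sqrtGrad (fun b => (hκ b).le) (sqrtGrad_apply κ h) hsupp]
  refine Finset.sum_congr rfl fun x hx => ?_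
  rw [hcoe, diverg_dirichletSolve (fun b _ => hκ b) _ hx, neg_neg]

theorem tendsto_greenForm [NeZero d] {κ : Edge d → ℝ} (hκ : ∀ b, 0 < κ b) (θ : Edge d →₀ ℝ) :
    Tendsto (fun Λ => greenForm Λ κ (-diverg θ)) atTop (𝓝 (‖gradPart κ θ‖ ^ 2)) := by
  simp only [greenForm_eq_norm_sq hκ]
  have hclosure : (⨆ Λ, dirichletSpace κ Λ).topologicalClosure = gradSpace κ := by
    rw [iSup_dirichletSpace, gradSpace]
  have : (⨆ Λ, dirichletSpace κ Λ).topologicalClosure.HasOrthogonalProjection := by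
    rw [hclosure]
    infer_instance
  have hlim := Submodule.starProjection_tendsto_closure_iSup _ (monotone_dirichletSpace κ)
    (scaledFlow κ θ)
  simp only [hclosure] at hlim
  exact hlim.norm.pow 2

/-! ### Gaussian weights in finite volume -/

section Gaussian

variable {Λ : Finset (Lattice d)} {k : Edge d → ℝ}

theorem eq_of_mgf_eq {ν ν' : Measure ℝ} [IsFiniteMeasure ν] [IsFiniteMeasure ν']
    (h : mgf id ν = mgf id ν') (hset : integrableExpSet id ν' = Set.univ) : ν = ν' := by
  have hzero : ν = 0 ↔ ν' = 0 := by
    have h0 := congrFun h 0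
    simp only [mgf_zero'] at h0
    rw [← Measure.measure_univ_eq_zero, ← measureReal_eq_zero_iff, h0, measureReal_eq_zero_iff,
      Measure.measure_univ_eq_zero]
  refine Measure.ext_of_complexMGF_id_eq (funext fun z => eqOn_complexMGF_of_mgf' h hzero ?_)
  simp [integrableExpSet_eq_of_mgf' h hzero, hset]

theorem map_eq_smul_gaussianReal_of_mgf {Ω : Type*} [MeasurableSpace Ω] {ν : Measure Ω}
    [IsFiniteMeasure ν] {X : Ω → ℝ} (hX : Measurable X) {v : ℝ} (hv : 0 ≤ v)
    (h : ∀ t, mgf X ν t = Real.exp (v * t ^ 2 / 2) * ν.real Set.univ) :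
    ν.map X = ν Set.univ • (gaussianReal 0 1).map (√v * ·) := by
  have hgauss : (gaussianReal 0 1).map (√v * ·) = gaussianReal 0 v.toNNReal := by
    rw [gaussianReal_map_const_mul]
    congr 1
    · exact mul_zero _
    · ext
      simp [Real.sq_sqrt hv, hv]
  have : IsFiniteMeasure (ν Set.univ • gaussianReal 0 v.toNNReal) :=
    Measure.smul_finite _ (measure_ne_top _ _)
  rw [hgauss]
  refine eq_of_mgf_eq (funext fun t => ?_) (Set.eq_univ_of_forall fun t => ?_)
  · rw [mgf_id_map hX.aemeasurable, h, mgf_smul_measure, mgf_id_gaussianReal]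
    simp only [zero_mul, zero_add, Real.coe_toNNReal _ hv, Measure.real, mul_comm (Real.exp _)]
  · exact (integrable_exp_mul_gaussianReal t).smul_measure (measure_ne_top _ _)

theorem continuous_glue (Λ : Finset (Lattice d)) :
    Continuous fun p : (Lattice d → ℝ) × (Λ → ℝ) => glue Λ p.1 p.2 := by
  refine continuous_pi fun x => ?_
  unfold glue
  split_ifs with h <;> fun_prop

theorem continuous_grad : Continuous (grad : (Lattice d → ℝ) → Edge d → ℝ) := by
  unfold grad
  fun_prop

theorem continuous_grad_glue (Λ : Finset (Lattice d)) (φ : Lattice d → ℝ) :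
    Continuous fun ψ : Λ → ℝ => grad (glue Λ φ ψ) :=
  continuous_grad.comp ((continuous_glue Λ).comp (by fun_prop : Continuous fun ψ => (φ, ψ)))

theorem continuous_localEnergy (Λ : Finset (Lattice d)) (k : Edge d → ℝ) :
    Continuous (localEnergy Λ k) := by
  unfold localEnergy
  fun_prop

theorem sum_touching_sq_le (hk : ∀ b ∈ touching Λ, 0 < k b) (η : Edge d → ℝ) :
    ∑ b ∈ touching Λ, η b ^ 2 ≤ (∑ b ∈ touching Λ, (k b)⁻¹) * localEnergy Λ k η := by
  rw [Finset.sum_mul]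
  refine Finset.sum_le_sum fun b hb => ?_
  rw [← div_eq_inv_mul, le_div_iff₀ (hk b hb), mul_comm]
  exact Finset.single_le_sum (f := fun b => k b * η b ^ 2)
    (fun b hb => mul_nonneg (hk b hb).le (sq_nonneg _)) hb

theorem exists_sum_sq_le_localEnergy [NeZero d] (hk : ∀ b ∈ touching Λ, 0 < k b) :
    ∃ c > 0, ∀ ψ : Λ → ℝ, c * ∑ x, ψ x ^ 2 ≤ localEnergy Λ k (grad (glue Λ 0 ψ)) := by
  choose N hN using fun x => exists_add_smul_notMem Λ x (0 : Fin d)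
  set C := ∑ b ∈ touching Λ, (k b)⁻¹
  have hC0 : 0 ≤ C := Finset.sum_nonneg fun b hb => (inv_pos.2 (hk b hb)).le
  refine ⟨((∑ x : Λ, (N x : ℝ)) * C + 1)⁻¹, by positivity, fun ψ => ?_⟩
  have hE0 := localEnergy_nonneg hk (grad (glue Λ 0 ψ))
  have hsum : ∑ x, ψ x ^ 2 ≤ (∑ x : Λ, (N x : ℝ)) * (C * localEnergy Λ k (grad (glue Λ 0 ψ))) := by
    rw [Finset.sum_mul]
    refine Finset.sum_le_sum fun x _ => ?_
    rw [← glue_coe 0 ψ x]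
    exact (sq_le_mul_sum_touching (fun _ => glue_zero_of_notMem ψ) x _ _ (hN x)).trans
      (mul_le_mul_of_nonneg_left (sum_touching_sq_le hk _) (Nat.cast_nonneg _))
  rw [inv_mul_le_iff₀ (by positivity)]
  linarith

/-- The Gaussian weight `exp (-½ ∑ k_b η_b²)`, the sum being over all edges that touch `Λ`. -/
noncomputable def gaussianWeight (Λ : Finset (Lattice d)) (k η : Edge d → ℝ) : ℝ≥0∞ :=
  ENNReal.ofReal (Real.exp (-(1 / 2) * localEnergy Λ k η))

theorem measurable_gaussianWeight (Λ : Finset (Lattice d)) (k : Edge d → ℝ) :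
    Measurable (gaussianWeight Λ k) := by
  have := (continuous_localEnergy Λ k).measurable
  unfold gaussianWeight
  fun_prop

/-- The Gaussian measure, without normalization, on the fields in `Λ` with zero boundary values. -/
noncomputable def gaussianMeasure (Λ : Finset (Lattice d)) (k : Edge d → ℝ) : Measure (Λ → ℝ) :=
  volume.withDensity fun ψ => gaussianWeight Λ k (grad (glue Λ 0 ψ))

theorem measurable_gaussianWeight_grad_glue (Λ : Finset (Lattice d)) (k : Edge d → ℝ) :
    Measurable fun ψ : Λ → ℝ => gaussianWeight Λ k (grad (glue Λ 0 ψ)) :=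
  (measurable_gaussianWeight Λ k).comp (continuous_grad_glue Λ 0).measurable

theorem isFiniteMeasure_gaussianMeasure [NeZero d] (hk : ∀ b ∈ touching Λ, 0 < k b) :
    IsFiniteMeasure (gaussianMeasure Λ k) := by
  obtain ⟨c, hc, hle⟩ := exists_sum_sq_le_localEnergy hk
  have hintegrable : Integrable (fun ψ : Λ → ℝ => ∏ x, Real.exp (-(c / 2) * ψ x ^ 2)) :=
    Integrable.fintype_prod (f := fun (_ : Λ) (t : ℝ) => Real.exp (-(c / 2) * t ^ 2))
      fun _ => integrable_exp_neg_mul_sq (half_pos hc)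
  refine isFiniteMeasure_withDensity (ne_top_of_le_ne_top hintegrable.lintegral_lt_top.ne
    (lintegral_mono fun ψ => ENNReal.ofReal_le_ofReal ?_))
  rw [← Real.exp_sum, ← Finset.mul_sum]
  exact Real.exp_le_exp.2 (by linarith [hle ψ])

theorem localEnergy_grad_add_smul_dirichletSolve [NeZero d] (hk : ∀ b ∈ touching Λ, 0 < k b)
    (F : Lattice d → ℝ) {h : Lattice d → ℝ} (hh : ∀ x ∉ Λ, h x = 0) (t : ℝ) :
    localEnergy Λ k (grad (h + t • dirichletSolve Λ k F)) =
      localEnergy Λ k (grad h) + 2 * t * ∑ x ∈ Λ, F x * h x + t ^ 2 * greenForm Λ k F := by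
  rw [← sum_touching_dirichletSolve hk F hh, greenForm_eq_localEnergy hk, grad_add, grad_smul]
  simp only [localEnergy, Finset.mul_sum, ← Finset.sum_add_distrib, Pi.add_apply, Pi.smul_apply,
    smul_eq_mul]
  exact Finset.sum_congr rfl fun b _ => by ring

theorem mgf_gaussianMeasure [NeZero d] (hk : ∀ b ∈ touching Λ, 0 < k b) (F : Lattice d → ℝ)
    (t : ℝ) : mgf (fun ψ : Λ → ℝ => ∑ x : Λ, F x * ψ x) (gaussianMeasure Λ k) t =
      Real.exp (greenForm Λ k F * t ^ 2 / 2) * (gaussianMeasure Λ k).real Set.univ := by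
  have hdensity (X : (Λ → ℝ) → ℝ) : ∫ ψ, X ψ ∂gaussianMeasure Λ k =
      ∫ ψ, Real.exp (-(1 / 2) * localEnergy Λ k (grad (glue Λ 0 ψ))) * X ψ := by
    rw [gaussianMeasure, integral_withDensity_eq_integral_toReal_smul
      (measurable_gaussianWeight_grad_glue Λ k) (ae_of_all _ fun _ => ENNReal.ofReal_lt_top)]
    simp only [gaussianWeight, ENNReal.toReal_ofReal (Real.exp_pos _).le, smul_eq_mul]
  let s : Λ → ℝ := fun x => dirichletSolve Λ k F x
  have hglue (ψ : Λ → ℝ) : glue Λ 0 (ψ + t • s) = glue Λ 0 ψ + t • dirichletSolve Λ k F := by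
    conv_lhs => rw [← add_zero (0 : Lattice d → ℝ), glue_add, ← smul_zero t, glue_smul,
      glue_zero_restrict (dirichletSolve_of_notMem k F), smul_zero]
  have hpair (ψ : Λ → ℝ) :
      ∑ x : Λ, F x * (ψ + t • s) x = ∑ x : Λ, F x * ψ x + t * greenForm Λ k F := by
    simp only [greenForm, ← Finset.sum_coe_sort Λ, Finset.mul_sum, ← Finset.sum_add_distrib,
      Pi.add_apply, Pi.smul_apply, smul_eq_mul, s]
    exact Finset.sum_congr rfl fun x _ => by ring
  have hmass : (gaussianMeasure Λ k).real Set.univ = ∫ _, 1 ∂gaussianMeasure Λ k := by simp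
  simp only [mgf]
  rw [hmass, hdensity, hdensity, ← integral_add_right_eq_self _ (t • s), ← integral_const_mul]
  refine integral_congr_ae (ae_of_all _ fun ψ => ?_)
  have hsum := Finset.sum_coe_sort Λ fun x => F x * glue Λ 0 ψ x
  simp only [glue_coe] at hsum
  simp only [hglue, hpair, localEnergy_grad_add_smul_dirichletSolve hk F
    (fun _ => glue_zero_of_notMem ψ), ← hsum, mul_one, ← Real.exp_add]
  ring_nf

theorem map_gaussianMeasure [NeZero d] (hk : ∀ b ∈ touching Λ, 0 < k b) (F : Lattice d → ℝ) :
    (gaussianMeasure Λ k).map (fun ψ : Λ → ℝ => ∑ x : Λ, F x * ψ x) =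
      gaussianMeasure Λ k Set.univ • (gaussianReal 0 1).map (√(greenForm Λ k F) * ·) :=
  have := isFiniteMeasure_gaussianMeasure hk
  map_eq_smul_gaussianReal_of_mgf (by fun_prop) (greenForm_nonneg hk F) (mgf_gaussianMeasure hk F)

theorem lintegral_gaussianMeasure [NeZero d] (hk : ∀ b ∈ touching Λ, 0 < k b) (F : Lattice d → ℝ)
    {Ψ : ℝ → ℝ≥0∞} (hΨ : Measurable Ψ) :
    ∫⁻ ψ : Λ → ℝ, Ψ (∑ x : Λ, F x * ψ x) ∂gaussianMeasure Λ k =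
      ∫⁻ _, (∫⁻ t, Ψ (√(greenForm Λ k F) * t) ∂gaussianReal 0 1) ∂gaussianMeasure Λ k := by
  rw [← lintegral_map hΨ (by fun_prop), map_gaussianMeasure hk, lintegral_smul_measure,
    lintegral_map hΨ (by fun_prop), lintegral_const, smul_eq_mul, mul_comm]

end Gaussian

/-! ### The specification and the extension as integral identities -/

section Specification

variable (ϱ : Measure ℝ) [IsFiniteMeasure ϱ] (Λ : Finset (Lattice d))

theorem measurable_potential : Measurable (potential ϱ) := by
  have h : StronglyMeasurable fun s : ℝ => ∫ k, Real.exp (-(1 / 2 * k * s ^ 2)) ∂ϱ :=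
    StronglyMeasurable.integral_prod_right (f := fun s k : ℝ => Real.exp (-(1 / 2 * k * s ^ 2)))
      (Continuous.stronglyMeasurable (by fun_prop))
  exact (Real.measurable_log.comp h.measurable).neg

theorem measurable_weight : Measurable (weight ϱ Λ) := by
  have := measurable_potential ϱ
  unfold weight
  fun_prop

theorem measurable_grad_glue_field :
    Measurable fun p : (Edge d → ℝ) × (Λ → ℝ) => grad (glue Λ (field p.1) p.2) :=
  (continuous_grad.comp (continuous_glue Λ)).measurable.comp
    ((measurable_field.comp measurable_fst).prodMk measurable_snd)

theorem lintegral_specification (η : Edge d → ℝ) {Φ : (Edge d → ℝ) → ℝ≥0∞} (hΦ : Measurable Φ) :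
    ∫⁻ ξ, Φ ξ ∂specification ϱ Λ η =
      (∫⁻ ψ : Λ → ℝ, weight ϱ Λ (grad (glue Λ (field η) ψ)))⁻¹ *
        ∫⁻ ψ : Λ → ℝ, weight ϱ Λ (grad (glue Λ (field η) ψ)) * Φ (grad (glue Λ (field η) ψ)) := by
  have hg := (continuous_grad_glue Λ (field η)).measurable
  have hw : Measurable fun ψ : Λ → ℝ => weight ϱ Λ (grad (glue Λ (field η) ψ)) :=
    (measurable_weight ϱ Λ).comp hg
  rw [specification, lintegral_smul_measure, lintegral_map hΦ hg,
    lintegral_withDensity_eq_lintegral_mul _ hw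
      (g := fun ψ => Φ (grad (glue Λ (field η) ψ))) (hΦ.comp hg)]
  rfl

theorem measurable_specification : Measurable (specification ϱ Λ) := by
  refine Measure.measurable_of_measurable_coe _ fun A hA => ?_
  have hg := measurable_grad_glue_field Λ
  have hw := (measurable_weight ϱ Λ).comp hg
  have hnum := hw.mul ((measurable_one.indicator hA).comp hg)
  simp only [← lintegral_indicator_one hA, lintegral_specification ϱ Λ _
    (measurable_one.indicator hA)]
  exact hw.lintegral_prod_right'.inv.mul hnum.lintegral_prod_right'

theorem specification_apply_le_one (η : Edge d → ℝ) (A : Set (Edge d → ℝ)) :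
    specification ϱ Λ η A ≤ 1 := by
  have h := lintegral_specification ϱ Λ η (measurable_const (a := 1))
  simp only [lintegral_one, mul_one] at h
  exact (measure_mono (Set.subset_univ A)).trans (h ▸ ENNReal.inv_mul_le_one _)

variable {ϱ} {μ : Measure (Edge d → ℝ)} [IsFiniteMeasure μ]

theorem bind_specification (hG : IsGradientGibbs ϱ μ) : μ.bind (specification ϱ Λ) = μ := by
  ext A hA
  have hm := measurable_specification ϱ Λ
  have hle := specification_apply_le_one ϱ Λ
  have hcond := integral_condExp (μ := μ) (f := A.indicator fun _ => (1 : ℝ)) (outside_le Λ)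
  rw [integral_congr_ae (hG.2 Λ A hA), integral_toReal (f := fun η => specification ϱ Λ η A)
    ((Measure.measurable_coe hA).comp hm).aemeasurable
    (ae_of_all _ fun η => (hle η A).trans_lt ENNReal.one_lt_top),
    integral_indicator_const _ hA, smul_eq_mul, mul_one, Measure.real] at hcond
  have hfinite : ∫⁻ η, specification ϱ Λ η A ∂μ ≠ ∞ :=
    ne_top_of_le_ne_top (measure_ne_top μ Set.univ)
      ((lintegral_mono fun η => hle η A).trans_eq lintegral_one)
  rw [Measure.bind_apply hA hm.aemeasurable]
  exact (ENNReal.toReal_eq_toReal_iff' hfinite (measure_ne_top _ _)).1 hcond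

theorem lintegral_eq_lintegral_glue (hG : IsGradientGibbs ϱ μ) {Φ : (Edge d → ℝ) → ℝ≥0∞}
    (hΦ : Measurable Φ) :
    ∫⁻ η, Φ η ∂μ = ∫⁻ η, ((∫⁻ ψ : Λ → ℝ, weight ϱ Λ (grad (glue Λ (field η) ψ)))⁻¹ *
      ∫⁻ ψ : Λ → ℝ, weight ϱ Λ (grad (glue Λ (field η) ψ)) *
        Φ (grad (glue Λ (field η) ψ))) ∂μ := by
  conv_lhs => rw [← bind_specification Λ hG]
  rw [Measure.lintegral_bind (measurable_specification ϱ Λ).aemeasurable hΦ.aemeasurable]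
  simp only [lintegral_specification ϱ Λ _ hΦ]

end Specification

theorem ext_of_map_restrict {ι Y : Type*} {X : ι → Type*} [MeasurableSpace Y]
    [∀ i, MeasurableSpace (X i)] {ν ν' : Measure (Y × ∀ i, X i)} [IsFiniteMeasure ν]
    [IsFiniteMeasure ν']
    (h : ∀ S : Finset ι, ν.map (Prod.map id S.restrict) = ν'.map (Prod.map id S.restrict)) :
    ν = ν' := by
  refine Measure.ext_prod fun {A B} hA hB => ?_
  have hrestrict (m : Measure (Y × ∀ i, X i)) (S : Finset ι) :
      ((m.restrict (A ×ˢ Set.univ)).map Prod.snd).map S.restrict =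
        ((m.map (Prod.map id S.restrict)).restrict (A ×ˢ Set.univ)).map Prod.snd := by
    have hm : Measurable (Prod.map (id : Y → Y) (S.restrict (π := X))) :=
      measurable_id.prodMap (Finset.measurable_restrict S)
    rw [Measure.restrict_map hm (hA.prod .univ), Measure.map_map measurable_snd hm,
      Measure.map_map (Finset.measurable_restrict S) measurable_snd]
    rfl
  have hlaw : (ν.restrict (A ×ˢ Set.univ)).map Prod.snd =
      (ν'.restrict (A ×ˢ Set.univ)).map Prod.snd :=
    IsProjectiveLimit.unique
      (P := fun S => ((ν'.restrict (A ×ˢ Set.univ)).map Prod.snd).map S.restrict)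
      (fun S => by simp only [hrestrict, h]) fun _ => rfl
  have happly (m : Measure (Y × ∀ i, X i)) :
      (m.restrict (A ×ˢ Set.univ)).map Prod.snd B = m (A ×ˢ B) := by
    rw [Measure.map_apply measurable_snd hB, Measure.restrict_apply (measurable_snd hB),
      Set.inter_comm, Set.prod_univ, ← Set.prod_eq]
  rw [← happly, ← happly, hlaw]

section Extension

theorem map_fst_extension {ϱ : Measure ℝ} {μ : Measure (Edge d → ℝ)}
    {μt : Measure ((Edge d → ℝ) × (Edge d → ℝ))} (hext : IsExtension ϱ μ μt) :
    μt.map Prod.fst = μ := by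
  ext A hA
  rw [Measure.map_apply measurable_fst hA]
  simpa [Set.prod_univ] using hext ∅ A Set.univ hA .univ

theorem measurable_translate (x : Lattice d) : Measurable (translate x : (Edge d → ℝ) → _) := by
  unfold translate
  fun_prop

theorem map_withDensity_comp {α β : Type*} [MeasurableSpace α] [MeasurableSpace β] {ν : Measure α}
    {ν' : Measure β} {g : α → β} (hg : MeasurePreserving g ν ν') {f : β → ℝ≥0∞}
    (hf : Measurable f) : (ν.withDensity (f ∘ g)).map g = ν'.withDensity f := by
  ext A hA
  rw [Measure.map_apply hg.measurable hA, withDensity_apply _ (hg.measurable hA),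
    withDensity_apply _ hA, ← hg.setLIntegral_comp_preimage hA hf]
  rfl

/-- The density `∏_b exp (V(η_b) - ½ k_b η_b²)` of the conductances on a finite set of edges. -/
noncomputable def extDensity (ϱ : Measure ℝ) (S : Finset (Edge d)) (η : Edge d → ℝ) (k : S → ℝ) :
    ℝ≥0∞ :=
  ∏ b : S, ENNReal.ofReal (Real.exp (potential ϱ (η b) - 1 / 2 * k b * η b ^ 2))

variable {ϱ : Measure ℝ} [IsFiniteMeasure ϱ]

theorem measurable_extDensity (ϱ : Measure ℝ) [IsFiniteMeasure ϱ] (S : Finset (Edge d)) :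
    Measurable fun p : (Edge d → ℝ) × (S → ℝ) => extDensity ϱ S p.1 p.2 := by
  have := measurable_potential ϱ
  unfold extDensity
  fun_prop

variable {μ : Measure (Edge d → ℝ)} [SFinite μ] {μt : Measure ((Edge d → ℝ) × (Edge d → ℝ))}
  [IsFiniteMeasure μt]

theorem map_restrict_extension (hext : IsExtension ϱ μ μt) (S : Finset (Edge d)) :
    μt.map (Prod.map id S.restrict) =
      (μ.prod (Measure.pi fun _ : S => ϱ)).withDensity fun p => extDensity ϱ S p.1 p.2 := by
  refine Measure.ext_prod fun {A B} hA hB => ?_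
  rw [Measure.map_apply (measurable_id.prodMap (Finset.measurable_restrict S)) (hA.prod hB),
    withDensity_apply _ (hA.prod hB),
    setLIntegral_prod_symm _ (measurable_extDensity ϱ S).aemeasurable]
  exact hext S A B hA hB

theorem lintegral_extension (hext : IsExtension ϱ μ μt) (S : Finset (Edge d))
    {Φ : (Edge d → ℝ) × (S → ℝ) → ℝ≥0∞} (hΦ : Measurable Φ) :
    ∫⁻ p, Φ p ∂μt.map (Prod.map id S.restrict) =
      ∫⁻ k, ∫⁻ η, extDensity ϱ S η k * Φ (η, k) ∂μ ∂Measure.pi fun _ : S => ϱ := by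
  have hm := measurable_extDensity ϱ S
  rw [map_restrict_extension hext S, lintegral_withDensity_eq_lintegral_mul _ hm hΦ,
    lintegral_prod_symm _ (hm.mul hΦ).aemeasurable]
  rfl

theorem ae_mem_of_extension (hext : IsExtension ϱ μ μt) {I : Set ℝ} (hI : ∀ᵐ k ∂ϱ, k ∈ I) :
    ∀ᵐ ω ∂μt, ∀ b, ω.2 b ∈ I := by
  refine ae_all_iff.2 fun b => ?_
  let b' : ({b} : Finset (Edge d)) := ⟨b, Finset.mem_singleton_self b⟩
  have hpi : ∀ᵐ k ∂Measure.pi fun _ : ({b} : Finset (Edge d)) => ϱ, k b' ∈ I :=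
    Measure.tendsto_eval_ae_ae.eventually hI
  have hprod : ∀ᵐ p ∂μt.map (Prod.map id (Finset.restrict {b})), p.2 b' ∈ I := by
    rw [map_restrict_extension hext]
    exact (withDensity_absolutelyContinuous _ _).ae_le
      (Measure.quasiMeasurePreserving_snd.ae hpi)
  exact ae_of_ae_map (measurable_id.prodMap (Finset.measurable_restrict _)).aemeasurable hprod

theorem map_translate_extension (hinv : IsTranslationInvariant μ) (hext : IsExtension ϱ μ μt)
    (x : Lattice d) : μt.map (Prod.map (translate x) (translate x)) = μt := by
  have hτ := measurable_translate (d := d) x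
  refine ext_of_map_restrict fun S => ?_
  let s : Edge d ≃ Edge d := (Equiv.addRight x).prodCongr (Equiv.refl (Fin d))
  let S' := S.map s.toEmbedding
  let e : S ≃ S' := s.subtypeEquiv fun b => by simp [S']
  let reindex : (S' → ℝ) ≃ᵐ (S → ℝ) := (MeasurableEquiv.piCongrLeft (fun _ : S' => ℝ) e).symm
  have hreindex : MeasurePreserving (Prod.map (translate x) reindex)
      (μ.prod (Measure.pi fun _ : S' => ϱ)) (μ.prod (Measure.pi fun _ : S => ϱ)) :=
    .prod ⟨hτ, hinv x⟩ (measurePreserving_piCongrLeft (fun _ : S' => ϱ) e).symm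
  have hdensity : (fun p : (Edge d → ℝ) × (S' → ℝ) => extDensity ϱ S' p.1 p.2) =
      (fun p => extDensity ϱ S p.1 p.2) ∘ Prod.map (translate x) reindex :=
    funext fun p => (e.prod_comp fun b : S' => ENNReal.ofReal
      (Real.exp (potential ϱ (p.1 b) - 1 / 2 * p.2 b * p.1 b ^ 2))).symm
  rw [map_restrict_extension hext, ← map_withDensity_comp hreindex (measurable_extDensity ϱ S),
    ← hdensity, ← map_restrict_extension hext,
    Measure.map_map (measurable_id.prodMap (Finset.measurable_restrict S)) (hτ.prodMap hτ),
    Measure.map_map hreindex.measurable (measurable_id.prodMap (Finset.measurable_restrict S'))]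
  rfl

end Extension

/-! ### Resampling the field in a finite set given the conductances -/

section Congr

variable {Λ : Finset (Lattice d)} {k k' : Edge d → ℝ}

theorem dirichletSolve_congr (h : ∀ b ∈ touching Λ, k b = k' b) {F F' : Lattice d → ℝ}
    (hF : ∀ x ∈ Λ, F x = F' x) : dirichletSolve Λ k F = dirichletSolve Λ k' F' := by
  have hmatrix : dirichletMatrix Λ k = dirichletMatrix Λ k' := by
    refine Matrix.mulVec_injective (funext fun ψ => funext fun x => ?_)
    rw [dirichletMatrix_mulVec, dirichletMatrix_mulVec]
    exact congrArg Neg.neg <| diverg_congr (w := k * grad (glue Λ 0 ψ))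
      (w' := k' * grad (glue Λ 0 ψ)) (fun b hb => congrArg (· * grad (glue Λ 0 ψ) b) (h b hb)) x.2
  rw [dirichletSolve, dirichletSolve, hmatrix, funext fun x : Λ => hF x x.2]

theorem dirichletPart_congr (h : ∀ b ∈ touching Λ, k b = k' b) (η : Edge d → ℝ) :
    dirichletPart Λ k η = dirichletPart Λ k' η :=
  dirichletSolve_congr h fun _ hx =>
    congrArg Neg.neg (diverg_congr (fun b hb => congrArg (· * η b) (h b hb)) hx)

theorem harmonicPart_congr (h : ∀ b ∈ touching Λ, k b = k' b) (η : Edge d → ℝ) :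
    harmonicPart Λ k η = harmonicPart Λ k' η := by
  rw [harmonicPart, harmonicPart, dirichletPart_congr h]

theorem greenForm_congr (h : ∀ b ∈ touching Λ, k b = k' b) (F : Lattice d → ℝ) :
    greenForm Λ k F = greenForm Λ k' F := by
  rw [greenForm, greenForm, dirichletSolve_congr h fun _ _ => rfl]

end Congr

section Measurability

variable (Λ : Finset (Lattice d)) (θ : Edge d →₀ ℝ)

theorem continuous_diverg : Continuous (diverg : (Edge d → ℝ) → Lattice d → ℝ) := by
  refine continuous_pi fun x => ?_
  simp only [diverg_apply]
  fun_prop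

theorem measurable_inv_dirichletMatrix (x y : Λ) :
    Measurable fun k : Edge d → ℝ => (dirichletMatrix Λ k)⁻¹ x y := by
  have hcont : Continuous (dirichletMatrix Λ) := by
    refine continuous_matrix fun x y => ?_
    simp only [dirichletMatrix, LinearMap.toMatrix'_apply]
    exact ((continuous_apply _).comp
      (continuous_diverg.comp (continuous_id.mul continuous_const))).neg
  simp only [Matrix.inv_def, Matrix.smul_apply, Ring.inverse_eq_inv', smul_eq_mul]
  exact hcont.matrix_det.measurable.inv.mul (hcont.matrix_adjugate.matrix_elem x y).measurable

theorem measurable_dirichletSolve :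
    Measurable fun p : (Edge d → ℝ) × (Lattice d → ℝ) => dirichletSolve Λ p.1 p.2 := by
  refine measurable_pi_lambda _ fun x => ?_
  by_cases hx : x ∈ Λ
  · simp only [dirichletSolve, glue, hx, dif_pos, Matrix.mulVec, dotProduct]
    exact Finset.measurable_sum _ fun y _ =>
      ((measurable_inv_dirichletMatrix Λ _ y).comp measurable_fst).mul
        ((measurable_pi_apply _).comp measurable_snd)
  · simp only [dirichletSolve_of_notMem _ _ x hx, measurable_const]

theorem measurable_dirichletPart :
    Measurable fun ω : (Edge d → ℝ) × (Edge d → ℝ) => dirichletPart Λ ω.2 ω.1 := by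
  have hsolve := measurable_dirichletSolve Λ
  have hdiverg := continuous_diverg (d := d).measurable
  unfold dirichletPart
  fun_prop

theorem measurable_finPairing_dirichletPart :
    Measurable fun ω : (Edge d → ℝ) × (Edge d → ℝ) =>
      finPairing θ (grad (dirichletPart Λ ω.2 ω.1)) :=
  ((finPairing θ).continuous.comp continuous_grad).measurable.comp (measurable_dirichletPart Λ)

theorem measurable_harmonicPart :
    Measurable fun ω : (Edge d → ℝ) × (Edge d → ℝ) => harmonicPart Λ ω.2 ω.1 :=
  measurable_fst.sub (continuous_grad.measurable.comp (measurable_dirichletPart Λ))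

theorem measurable_greenForm (F : Lattice d → ℝ) :
    Measurable fun k : Edge d → ℝ => greenForm Λ k F := by
  have hsolve : Measurable fun k => dirichletSolve Λ k F := by
    have := measurable_dirichletSolve Λ
    fun_prop
  unfold greenForm
  fun_prop

theorem measurable_resampled :
    Measurable fun p : ((Edge d → ℝ) × (Edge d → ℝ)) × ℝ =>
      (harmonicPart Λ p.1.2 p.1.1, √(greenForm Λ p.1.2 (-diverg θ)) * p.2) :=
  ((measurable_harmonicPart Λ).comp measurable_fst).prodMk
    (((measurable_greenForm Λ _).comp (measurable_snd.comp measurable_fst)).sqrt.mul measurable_snd)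

end Measurability

section Resampling

variable {ϱ : Measure ℝ} {Λ : Finset (Lattice d)} {T : Finset (Edge d)} {κ : Edge d → ℝ}

-- The potential cancels on the edges touching `Λ`: given `κ`, the field in `Λ` is Gaussian.
theorem weight_mul_extDensity (ϱ : Measure ℝ) (hT : touching Λ ⊆ T) (κ η : Edge d → ℝ) :
    weight ϱ Λ η * extDensity ϱ T η (T.restrict κ) = gaussianWeight Λ κ η *
      ∏ b ∈ T \ touching Λ,
        ENNReal.ofReal (Real.exp (potential ϱ (η b) - 1 / 2 * κ b * η b ^ 2)) := by
  have hsum : -∑ b ∈ touching Λ, potential ϱ (η b) +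
      ∑ b ∈ touching Λ, (potential ϱ (η b) - 1 / 2 * κ b * η b ^ 2) =
        -(1 / 2) * localEnergy Λ κ η := by
    rw [localEnergy, Finset.sum_sub_distrib, Finset.mul_sum, neg_add_eq_sub, sub_sub_cancel_left,
      ← Finset.sum_neg_distrib]
    exact Finset.sum_congr rfl fun b _ => by ring
  simp only [extDensity, Finset.restrict]
  rw [Finset.prod_coe_sort T fun b =>
      ENNReal.ofReal (Real.exp (potential ϱ (η b) - 1 / 2 * κ b * η b ^ 2)),
    ← Finset.prod_sdiff hT, mul_comm (∏ b ∈ T \ touching Λ, _), ← mul_assoc,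
    ← ENNReal.ofReal_prod_of_nonneg fun b _ => (Real.exp_pos _).le, ← Real.exp_sum, weight,
    ← ENNReal.ofReal_mul (Real.exp_pos _).le, ← Real.exp_add, hsum, gaussianWeight]

theorem gaussianWeight_eq_mul [NeZero d] (hκ : ∀ b ∈ touching Λ, 0 < κ b) (η : Edge d → ℝ) :
    gaussianWeight Λ κ η =
      gaussianWeight Λ κ (harmonicPart Λ κ η) *
        gaussianWeight Λ κ (grad (dirichletPart Λ κ η)) := by
  rw [gaussianWeight, localEnergy_eq_add hκ, mul_add, Real.exp_add,
    ENNReal.ofReal_mul (Real.exp_pos _).le, gaussianWeight, gaussianWeight]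

theorem lintegral_weight_mul_extDensity [NeZero d] (ϱ : Measure ℝ) (hT : touching Λ ⊆ T)
    (hκ : ∀ b ∈ touching Λ, 0 < κ b) (φ : Lattice d → ℝ) :
    ∃ C : ℝ≥0∞, ∀ f : (Λ → ℝ) → ℝ≥0∞, Measurable f →
      ∫⁻ ψ : Λ → ℝ, weight ϱ Λ (grad (glue Λ φ ψ)) * (extDensity ϱ T (grad (glue Λ φ ψ))
        (T.restrict κ) * f (Λ.restrict (dirichletPart Λ κ (grad (glue Λ φ ψ))))) =
      C * ∫⁻ ψ, f ψ ∂gaussianMeasure Λ κ := by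
  set η := grad (glue Λ φ 0)
  set z := Λ.restrict (dirichletPart Λ κ η)
  have hdirichlet (ψ : Λ → ℝ) : dirichletPart Λ κ (grad (glue Λ φ ψ)) = glue Λ 0 (ψ + z) := by
    rw [dirichletPart_glue hκ, ← add_zero (0 : Lattice d → ℝ), glue_add, add_zero]
    exact congrArg _ (glue_zero_restrict (dirichletPart_of_notMem κ η)).symm
  have hrestrict (ψ : Λ → ℝ) : Λ.restrict (glue Λ 0 ψ) = ψ := funext fun x => glue_coe 0 ψ x
  have hout (ψ : Λ → ℝ) (b : Edge d) (hb : b ∈ T \ touching Λ) : grad (glue Λ φ ψ) b = η b := by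
    rw [glue_eq_add_glue_zero, grad_add, Pi.add_apply, grad_eq_zero_of_notMem_touching
      (fun _ => glue_zero_of_notMem ψ) (Finset.mem_sdiff.1 hb).2, zero_add]
  refine ⟨gaussianWeight Λ κ (harmonicPart Λ κ η) * ∏ b ∈ T \ touching Λ,
    ENNReal.ofReal (Real.exp (potential ϱ (η b) - 1 / 2 * κ b * η b ^ 2)), fun f hf => ?_⟩
  have hw := measurable_gaussianWeight_grad_glue Λ κ
  rw [gaussianMeasure, lintegral_withDensity_eq_lintegral_mul _ hw hf,
    ← lintegral_const_mul _ (hw.mul hf)]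
  refine .trans (lintegral_congr fun ψ => ?_) (lintegral_add_right_eq_self _ z)
  have hprod : ∏ b ∈ T \ touching Λ, ENNReal.ofReal (Real.exp
      (potential ϱ (grad (glue Λ φ ψ) b) - 1 / 2 * κ b * grad (glue Λ φ ψ) b ^ 2)) =
      ∏ b ∈ T \ touching Λ,
        ENNReal.ofReal (Real.exp (potential ϱ (η b) - 1 / 2 * κ b * η b ^ 2)) :=
    Finset.prod_congr rfl fun b hb => by rw [hout ψ b hb]
  rw [← mul_assoc, weight_mul_extDensity ϱ hT, gaussianWeight_eq_mul hκ, harmonicPart_glue hκ,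
    hdirichlet, hrestrict, hprod, Pi.mul_apply]
  ring

theorem lintegral_extDensity_resample [NeZero d] [IsFiniteMeasure ϱ] {μ : Measure (Edge d → ℝ)}
    [IsFiniteMeasure μ] (hG : IsGradientGibbs ϱ μ) (hT : touching Λ ⊆ T)
    (hκ : ∀ b ∈ touching Λ, 0 < κ b) (θ : Edge d →₀ ℝ) {Ψ : (Edge d → ℝ) × ℝ → ℝ≥0∞}
    (hΨ : Measurable Ψ) :
    ∫⁻ η, extDensity ϱ T η (T.restrict κ) *
        Ψ (harmonicPart Λ κ η, finPairing θ (grad (dirichletPart Λ κ η))) ∂μ =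
      ∫⁻ η, extDensity ϱ T η (T.restrict κ) * ∫⁻ t, Ψ (harmonicPart Λ κ η,
        √(greenForm Λ κ (-diverg θ)) * t) ∂gaussianReal 0 1 ∂μ := by
  have hpair : Measurable fun η : Edge d → ℝ => (η, κ) := by fun_prop
  have hdensity := (measurable_extDensity ϱ T).comp (by fun_prop :
    Measurable fun η : Edge d → ℝ => (η, T.restrict κ))
  have hharm := (measurable_harmonicPart Λ).comp hpair
  have hdir := (measurable_finPairing_dirichletPart Λ θ).comp hpair
  have hresample : Measurable fun η => Ψ (harmonicPart Λ κ η,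
      finPairing θ (grad (dirichletPart Λ κ η))) := hΨ.comp (hharm.prodMk hdir)
  have hΨt : Measurable fun p : (Edge d → ℝ) × ℝ =>
      Ψ (harmonicPart Λ κ p.1, √(greenForm Λ κ (-diverg θ)) * p.2) :=
    hΨ.comp ((hharm.comp measurable_fst).prodMk (measurable_snd.const_mul _))
  refine (lintegral_eq_lintegral_glue Λ hG (hdensity.mul hresample)).trans <| .trans ?_
    (lintegral_eq_lintegral_glue Λ hG (hdensity.mul hΨt.lintegral_prod_right')).symm
  refine lintegral_congr fun η => congrArg _ ?_
  obtain ⟨C, hC⟩ := lintegral_weight_mul_extDensity ϱ hT hκ (field η)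
  have hΨη : Measurable fun s => Ψ (harmonicPart Λ κ (grad (glue Λ (field η) 0)), s) :=
    hΨ.comp (by fun_prop)
  have hsum (ξ : Edge d → ℝ) : finPairing θ (grad (dirichletPart Λ κ ξ)) =
      ∑ x : Λ, (-diverg θ) x * Λ.restrict (dirichletPart Λ κ ξ) x :=
    (finPairing_grad_eq_sum θ (dirichletPart_of_notMem κ ξ)).trans (Finset.sum_coe_sort Λ _).symm
  simp only [Function.comp_apply, Pi.mul_apply, harmonicPart_glue hκ, hsum]
  refine (hC _ (hΨη.comp (f := fun ψ : Λ → ℝ =>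
    ∑ x : Λ, (-diverg θ) x * ψ x) (by fun_prop))).trans ?_
  exact (congrArg _ (lintegral_gaussianMeasure hκ _ hΨη)).trans (hC _ measurable_const).symm

variable {μ : Measure (Edge d → ℝ)} {μt : Measure ((Edge d → ℝ) × (Edge d → ℝ))}
  [IsFiniteMeasure ϱ]

theorem lintegral_extension_of_dependsOn [SFinite μ] [IsFiniteMeasure μt]
    (hext : IsExtension ϱ μ μt) {Φ : (Edge d → ℝ) × (Edge d → ℝ) → ℝ≥0∞} (hΦ : Measurable Φ)
    (hT : ∀ η, DependsOn (fun κ => Φ (η, κ)) (T : Set (Edge d))) :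
    ∫⁻ ω, Φ ω ∂μt = ∫⁻ k, ∫⁻ η, extDensity ϱ T η k * Φ (η, Function.updateFinset 0 T k) ∂μ
      ∂Measure.pi fun _ : T => ϱ := by
  have hupdate : Measurable fun p : (Edge d → ℝ) × (T → ℝ) =>
      Φ (p.1, Function.updateFinset 0 T p.2) :=
    hΦ.comp (measurable_fst.prodMk (measurable_updateFinset.comp measurable_snd))
  rw [← lintegral_extension hext T hupdate,
    lintegral_map hupdate (measurable_id.prodMap (Finset.measurable_restrict T))]
  refine lintegral_congr fun ω => hT ω.1 fun b hb => ?_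
  simp only [Prod.map_snd, Function.updateFinset, dif_pos (Finset.mem_coe.1 hb), Finset.restrict]

variable [IsFiniteMeasure μ] [IsFiniteMeasure μt]

theorem lintegral_resample [NeZero d] (hpos : ∀ᵐ k ∂ϱ, 0 < k) (hG : IsGradientGibbs ϱ μ)
    (hext : IsExtension ϱ μ μt) (Λ : Finset (Lattice d)) (θ : Edge d →₀ ℝ) (S : Finset (Edge d))
    {Φ : ((Edge d → ℝ) × ℝ) × (S → ℝ) → ℝ≥0∞} (hΦ : Measurable Φ) :
    ∫⁻ ω, Φ ((harmonicPart Λ ω.2 ω.1, finPairing θ (grad (dirichletPart Λ ω.2 ω.1))),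
        S.restrict ω.2) ∂μt =
      ∫⁻ ω, ∫⁻ t, Φ ((harmonicPart Λ ω.2 ω.1, √(greenForm Λ ω.2 (-diverg θ)) * t), S.restrict ω.2)
        ∂gaussianReal 0 1 ∂μt := by
  have hharm := measurable_harmonicPart Λ
  have hdir := measurable_finPairing_dirichletPart Λ θ
  have hS := Finset.measurable_restrict (X := fun _ : Edge d => ℝ) S
  have hl : Measurable fun ω : (Edge d → ℝ) × (Edge d → ℝ) => Φ ((harmonicPart Λ ω.2 ω.1,
      finPairing θ (grad (dirichletPart Λ ω.2 ω.1))), S.restrict ω.2) :=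
    hΦ.comp ((hharm.prodMk hdir).prodMk (hS.comp measurable_snd))
  have hr : Measurable fun p : ((Edge d → ℝ) × (Edge d → ℝ)) × ℝ => Φ ((harmonicPart Λ p.1.2 p.1.1,
      √(greenForm Λ p.1.2 (-diverg θ)) * p.2), S.restrict p.1.2) :=
    hΦ.comp ((measurable_resampled Λ θ).prodMk
      (hS.comp (measurable_snd.comp measurable_fst)))
  let T := S ∪ touching Λ
  have htouching {k k' : Edge d → ℝ} (h : ∀ b ∈ (T : Set (Edge d)), k b = k' b) :
      ∀ b ∈ touching Λ, k b = k' b := fun b hb => h b (Finset.mem_union_right S hb)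
  have hrestrict {k k' : Edge d → ℝ} (h : ∀ b ∈ (T : Set (Edge d)), k b = k' b) :
      S.restrict k = S.restrict k' := funext fun b => h b (Finset.mem_union_left _ b.2)
  rw [lintegral_extension_of_dependsOn (T := T) hext hl fun η k k' h => by
      simp only [dirichletPart_congr (htouching h), harmonicPart_congr (htouching h), hrestrict h],
    lintegral_extension_of_dependsOn (T := T) hext hr.lintegral_prod_right' fun η k k' h => by
      simp only [greenForm_congr (htouching h), harmonicPart_congr (htouching h), hrestrict h]]
  have hpi : ∀ᵐ k ∂Measure.pi fun _ : T => ϱ, ∀ b, 0 < k b :=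
    ae_all_iff.2 fun b => Measure.tendsto_eval_ae_ae.eventually hpos
  refine lintegral_congr_ae (hpi.mono fun k hk => ?_)
  have hκ (b : Edge d) (hb : b ∈ touching Λ) :
      0 < Function.updateFinset (0 : Edge d → ℝ) T k b := by
    rw [Function.updateFinset, dif_pos (Finset.mem_union_right S hb)]
    exact hk _
  have hT := Finset.subset_union_right (s₁ := S) (s₂ := touching Λ)
  have h := lintegral_extDensity_resample hG hT hκ θ
    (Ψ := fun q => Φ (q, S.restrict (Function.updateFinset (0 : Edge d → ℝ) T k)))
    (hΦ.comp measurable_prodMk_right)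
  rwa [Function.restrict_updateFinset] at h

theorem map_resample [NeZero d] (hpos : ∀ᵐ k ∂ϱ, 0 < k) (hG : IsGradientGibbs ϱ μ)
    (hext : IsExtension ϱ μ μt) (Λ : Finset (Lattice d)) (θ : Edge d →₀ ℝ) :
    μt.map (fun ω => ((harmonicPart Λ ω.2 ω.1, finPairing θ (grad (dirichletPart Λ ω.2 ω.1))),
        ω.2)) =
      (μt.prod (gaussianReal 0 1)).map fun p =>
        ((harmonicPart Λ p.1.2 p.1.1, √(greenForm Λ p.1.2 (-diverg θ)) * p.2), p.1.2) := by
  have hharm := measurable_harmonicPart Λ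
  have hdir := measurable_finPairing_dirichletPart Λ θ
  have hr : Measurable fun p : ((Edge d → ℝ) × (Edge d → ℝ)) × ℝ =>
      ((harmonicPart Λ p.1.2 p.1.1, √(greenForm Λ p.1.2 (-diverg θ)) * p.2), p.1.2) :=
    (measurable_resampled Λ θ).prodMk (measurable_snd.comp measurable_fst)
  refine ext_of_map_restrict fun S => Measure.ext_of_lintegral _ fun Φ hΦ => ?_
  have hS : Measurable (Prod.map (id : (Edge d → ℝ) × ℝ → _) (S.restrict (π := fun _ => ℝ))) :=
    measurable_id.prodMap (Finset.measurable_restrict S)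
  have hΦS : Measurable fun q : ((Edge d → ℝ) × ℝ) × (Edge d → ℝ) =>
      Φ (Prod.map id S.restrict q) := hΦ.comp hS
  rw [lintegral_map hΦ hS, lintegral_map hΦS ((hharm.prodMk hdir).prodMk measurable_snd),
    lintegral_map hΦ hS, lintegral_map hΦS hr]
  exact (lintegral_resample hpos hG hext Λ θ S hΦ).trans
    (lintegral_prod _ (hΦS.comp hr).aemeasurable).symm

end Resampling

/-! ### Sublinear growth of the field -/

section MeanErgodic

theorem isClosed_setOf_cauchySeq {X E : Type*} [TopologicalSpace X] [PseudoMetricSpace E]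
    {A : ℕ → X → E} (hA : Equicontinuous A) : IsClosed {x | CauchySeq (A · x)} := by
  refine isClosed_iff_frequently.2 fun x hx => Metric.cauchySeq_iff'.2 fun ε hε => ?_
  have hnear := Metric.equicontinuousAt_iff_right.1 (hA x) (ε / 3) (by positivity)
  obtain ⟨y, hy, hxy⟩ := (hx.and_eventually hnear).exists
  obtain ⟨N, hN⟩ := Metric.cauchySeq_iff'.1 hy (ε / 3) (by positivity)
  refine ⟨N, fun n hn => ?_⟩
  calc dist (A n x) (A N x)
      ≤ dist (A n x) (A n y) + dist (A n y) (A N y) + dist (A N y) (A N x) := dist_triangle4 ..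
    _ < ε / 3 + ε / 3 + ε / 3 := by
        rw [dist_comm (A N y)]
        gcongr
        exacts [hxy n, hN n hn, hxy N]
    _ = ε := by ring

variable {Ω : Type*} [MeasurableSpace Ω] {μ : Measure Ω} {T : Ω → Ω} {f : Ω → ℝ}

theorem memLp_birkhoffAverage {p : ℝ≥0∞} (hT : MeasurePreserving T μ μ) (hf : MemLp f p μ)
    (n : ℕ) : MemLp (birkhoffAverage ℝ T f n) p μ :=
  (memLp_finsetSum (Finset.range n) fun j _ =>
    hf.comp_measurePreserving (hT.iterate j)).const_smul (n : ℝ)⁻¹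

theorem birkhoffAverage_toLp {p : ℝ≥0∞} (hT : MeasurePreserving T μ μ) (hf : MemLp f p μ)
    (n : ℕ) :
    birkhoffAverage ℝ (Lp.compMeasurePreserving T hT) id n (hf.toLp f) =
      (memLp_birkhoffAverage hT hf n).toLp (birkhoffAverage ℝ T f n) := by
  have hiter : ∀ j, (Lp.compMeasurePreserving T hT)^[j] (hf.toLp f) =
      (hf.comp_measurePreserving (hT.iterate j)).toLp (f ∘ T^[j]) := fun j => by
    rw [Lp.compMeasurePreserving_iterate, Lp.toLp_compMeasurePreserving]
  have hsum : ∀ s : Finset ℕ, ∑ j ∈ s, (hf.comp_measurePreserving (hT.iterate j)).toLp (f ∘ T^[j]) =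
      (memLp_finsetSum s fun j _ => hf.comp_measurePreserving (hT.iterate j)).toLp _ := by
    intro s
    induction s using Finset.cons_induction with
    | empty => exact (MemLp.toLp_zero _).symm
    | cons a s ha ih => simp only [Finset.sum_cons, ih, ← MemLp.toLp_add]; rfl
  simp only [birkhoffAverage, birkhoffSum, id, hiter, hsum, ← MemLp.toLp_const_smul]
  rfl

theorem cauchySeq_birkhoffAverage_two (hT : MeasurePreserving T μ μ) (hf : MemLp f 2 μ) :
    CauchySeq fun n => (memLp_birkhoffAverage hT hf n).toLp (birkhoffAverage ℝ T f n) := by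
  let U := (Lp.compMeasurePreservingₗᵢ ℝ T hT : Lp ℝ 2 μ →ₗᵢ[ℝ] Lp ℝ 2 μ)
  have hconv := U.toContinuousLinearMap.tendsto_birkhoffAverage_orthogonalProjection
    U.norm_toContinuousLinearMap_le (hf.toLp f)
  exact (hconv.congr fun n => birkhoffAverage_toLp hT hf n).cauchySeq

theorem cauchySeq_birkhoffAverage_one_of_memLp_two [IsProbabilityMeasure μ]
    (hT : MeasurePreserving T μ μ) (hf : MemLp f 2 μ) (hf1 : MemLp f 1 μ) :
    CauchySeq fun n => (memLp_birkhoffAverage hT hf1 n).toLp (birkhoffAverage ℝ T f n) := by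
  refine Metric.cauchySeq_iff.2 fun ε hε => ?_
  obtain ⟨N, hN⟩ := Metric.cauchySeq_iff.1 (cauchySeq_birkhoffAverage_two hT hf) ε hε
  refine ⟨N, fun m hm n hn => lt_of_le_of_lt ?_ (hN m hm n hn)⟩
  have hmn := (memLp_birkhoffAverage hT hf m).sub (memLp_birkhoffAverage hT hf n)
  rw [dist_eq_norm, dist_eq_norm, ← MemLp.toLp_sub, ← MemLp.toLp_sub, Lp.norm_toLp, Lp.norm_toLp]
  exact ENNReal.toReal_mono hmn.2.ne
    (eLpNorm_le_eLpNorm_of_exponent_le one_le_two hmn.1)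

theorem cauchySeq_birkhoffAverage_compMeasurePreserving [IsProbabilityMeasure μ]
    (hT : MeasurePreserving T μ μ) (F : Lp ℝ 1 μ) :
    CauchySeq (birkhoffAverage ℝ (Lp.compMeasurePreserving T hT) id · F) := by
  have hequi := (uniformEquicontinuous_birkhoffAverage ℝ
    (Lp.isometry_compMeasurePreserving (E := ℝ) (p := 1) hT).lipschitz
    uniformContinuous_id).equicontinuous
  refine closure_minimal (fun G hG => ?_) (isClosed_setOf_cauchySeq hequi)
    (Lp.simpleFunc.dense ENNReal.one_ne_top F)
  lift G to Lp.simpleFunc ℝ 1 μ using hG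
  have hG := SimpleFunc.memLp_of_isFiniteMeasure (Lp.simpleFunc.toSimpleFunc G) (μ := μ)
  rw [← Lp.simpleFunc.toLp_toSimpleFunc G]
  change CauchySeq fun n => birkhoffAverage ℝ _ id n ((hG 1).toLp _)
  simpa only [birkhoffAverage_toLp] using
    cauchySeq_birkhoffAverage_one_of_memLp_two hT (hG 2) (hG 1)

theorem exists_tendsto_integral_abs_birkhoffAverage_sub [IsProbabilityMeasure μ]
    (hT : MeasurePreserving T μ μ) (hf : Integrable f μ) :
    ∃ Z : Ω → ℝ, Measurable Z ∧ Integrable Z μ ∧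
      Tendsto (fun n => ∫ ω, |birkhoffAverage ℝ T f n ω - Z ω| ∂μ) atTop (𝓝 0) := by
  have hf1 := memLp_one_iff_integrable.2 hf
  obtain ⟨Z, hZ⟩ := cauchySeq_tendsto_of_complete
    (cauchySeq_birkhoffAverage_compMeasurePreserving hT (hf1.toLp f))
  have hZi : Integrable Z μ := memLp_one_iff_integrable.1 (Lp.memLp Z)
  refine ⟨hZi.1.mk Z, hZi.1.stronglyMeasurable_mk.measurable, hZi.congr hZi.1.ae_eq_mk, ?_⟩
  refine (tendsto_iff_norm_sub_tendsto_zero.1 hZ).congr fun n => ?_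
  rw [birkhoffAverage_toLp, L1.norm_eq_integral_norm]
  refine integral_congr_ae ?_
  filter_upwards [Lp.coeFn_sub ((memLp_birkhoffAverage hT hf1 n).toLp _) Z,
    (memLp_birkhoffAverage hT hf1 n).coeFn_toLp, hZi.1.ae_eq_mk] with ω hsub hA hmk
  rw [hsub, Pi.sub_apply, hA, ← hmk, Real.norm_eq_abs]

theorem integral_abs_comp_sub_le (hT : MeasurePreserving T μ μ) {A Z : Ω → ℝ}
    (hA : Integrable A μ) (hZ : Integrable Z μ) :
    ∫ ω, |Z (T ω) - Z ω| ∂μ ≤ 2 * ∫ ω, |A ω - Z ω| ∂μ + ∫ ω, |A (T ω) - A ω| ∂μ := by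
  have hAZ : Integrable (fun ω => |A ω - Z ω|) μ := (hA.sub hZ).abs
  have hAZT : Integrable (fun ω => |A (T ω) - Z (T ω)|) μ := hT.integrable_comp_of_integrable hAZ
  have hAA : Integrable (fun ω => |A (T ω) - A ω|) μ :=
    ((hT.integrable_comp_of_integrable hA).sub hA).abs
  have hsum : Integrable (fun ω => |A (T ω) - Z (T ω)| + |A ω - Z ω|) μ := hAZT.add hAZ
  have hdiff : ∫ ω, |A (T ω) - Z (T ω)| ∂μ = ∫ ω, |A ω - Z ω| ∂μ := by
    conv_rhs => rw [← hT.map_eq]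
    rw [integral_map hT.aemeasurable (by rw [hT.map_eq]; exact hAZ.1)]
  calc ∫ ω, |Z (T ω) - Z ω| ∂μ
      ≤ ∫ ω, (|A (T ω) - Z (T ω)| + |A ω - Z ω| + |A (T ω) - A ω|) ∂μ := by
        refine integral_mono ((hT.integrable_comp_of_integrable hZ).sub hZ).abs
          (hsum.add hAA) fun ω => ?_
        have hsplit : Z (T ω) - Z ω =
          -(A (T ω) - Z (T ω)) + (A ω - Z ω) + (A (T ω) - A ω) := by ring
        have htri := abs_add_three (-(A (T ω) - Z (T ω))) (A ω - Z ω) (A (T ω) - A ω)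
        rwa [abs_neg, ← hsplit] at htri
    _ = _ := by
        rw [integral_add hsum hAA, integral_add hAZT hAZ, hdiff, two_mul]

theorem comp_ae_eq_of_tendsto_integral_abs_sub (hT : MeasurePreserving T μ μ)
    {A : ℕ → Ω → ℝ} {Z : Ω → ℝ} (hA : ∀ n, Integrable (A n) μ) (hZ : Integrable Z μ)
    (hlim : Tendsto (fun n => ∫ ω, |A n ω - Z ω| ∂μ) atTop (𝓝 0))
    (hinv : Tendsto (fun n => ∫ ω, |A n (T ω) - A n ω| ∂μ) atTop (𝓝 0)) :
    ∀ᵐ ω ∂μ, Z (T ω) = Z ω := by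
  have hle : ∫ ω, |Z (T ω) - Z ω| ∂μ ≤ 0 :=
    ge_of_tendsto' (by simpa using (hlim.const_mul 2).add hinv)
      fun n => integral_abs_comp_sub_le hT (hA n) hZ
  have hzero := (integral_eq_zero_iff_of_nonneg (fun _ => abs_nonneg _)
    ((hT.integrable_comp_of_integrable hZ).sub hZ).abs).1
    (hle.antisymm (integral_nonneg fun _ => abs_nonneg _))
  filter_upwards [hzero] with ω hω using sub_eq_zero.1 (abs_eq_zero.1 hω)

end MeanErgodic

theorem translate_add (x y : Lattice d) (η : Edge d → ℝ) :
    translate x (translate y η) = translate (x + y) η := by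
  ext b; simp [translate, add_assoc]

theorem translate_iterate (x : Lattice d) (n : ℕ) :
    (translate x : (Edge d → ℝ) → _)^[n] = translate (n • x) := by
  induction n with
  | zero => ext η b; simp [translate]
  | succ n ih =>
    ext η : 1
    rw [Function.iterate_succ', ih, Function.comp_apply, translate_add, succ_nsmul']

theorem field_translate {η : Edge d → ℝ} (h : LoopCondition η) (x y : Lattice d) :
    field (translate x η) y = field η (y + x) - field η x := by
  suffices field (translate x η) = fun y => field η (y + x) - field η x by rw [this]
  refine field_eq_of_grad (by simp) (funext fun b => ?_)
  rw [translate, ← congrFun (grad_field h) (b.1 + x, b.2)]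
  simp [grad, add_right_comm]

theorem birkhoffSum_translate_field {η : Edge d → ℝ} (h : LoopCondition η) (x : Lattice d)
    (n : ℕ) : birkhoffSum (translate x) (fun η => field η x) n η = field η (n • x) := by
  induction n with
  | zero => simp [field_zero]
  | succ n ih =>
    rw [birkhoffSum_succ, ih, translate_iterate, field_translate h, succ_nsmul, add_comm (n • x),
      add_sub_cancel]

section Sublinear

variable {μ : Measure (Edge d → ℝ)}

theorem ae_eq_const_of_forall_translate [IsProbabilityMeasure μ]
    (herg : IsErgodic μ) {Z : (Edge d → ℝ) → ℝ} (hZ : Measurable Z)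
    (h : ∀ x, ∀ᵐ η ∂μ, Z (translate x η) = Z η) : ∃ c : ℝ, Z =ᵐ[μ] fun _ => c := by
  refine exists_eventuallyEq_const_of_forall_separating MeasurableSet fun U hU => ?_
  let A : Set (Edge d → ℝ) := ⋂ x, (fun η => Z (translate x η)) ⁻¹' U
  have hA : ∀ η, η ∈ A ↔ ∀ x, Z (translate x η) ∈ U := fun η => Set.mem_iInter
  have hAm : MeasurableSet A :=
    MeasurableSet.iInter fun x => (hZ.comp (measurable_translate x)) hU
  have hAinv : ∀ x, translate x ⁻¹' A = A := fun x => by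
    ext η
    simp only [Set.mem_preimage, hA, translate_add]
    exact ⟨fun hη y => by simpa using hη (y - x), fun hη y => hη _⟩
  have hae : ∀ᵐ η ∂μ, (η ∈ A ↔ Z η ∈ U) := by
    filter_upwards [ae_all_iff.2 h] with η hη
    simp [hA, hη]
  rcases herg A hAm hAinv with h0 | h1
  · right
    filter_upwards [measure_eq_zero_iff_ae_notMem.1 h0, hae] with η hη hiff using mt hiff.2 hη
  · left
    filter_upwards [(mem_ae_iff_prob_eq_one hAm).2 h1, hae] with η hη hiff using hiff.1 hη

theorem measurePreserving_translate (hinv : IsTranslationInvariant μ) (x : Lattice d) :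
    MeasurePreserving (translate x) μ μ := ⟨measurable_translate x, hinv x⟩

theorem integrable_finPairing {ι : Type*} {μ : Measure (ι → ℝ)}
    (h : ∀ i, Integrable (fun η => η i) μ) (θ : ι →₀ ℝ) : Integrable (finPairing θ) μ := by
  refine (integrable_finsetSum θ.support fun i _ => (h i).const_mul (θ i)).congr
    (.of_forall fun η => ?_)
  rw [finPairing_apply, Finsupp.sum]

theorem integrable_field (hloop : ∀ᵐ η ∂μ, LoopCondition η) (htilt : HasZeroTilt μ)
    (x : Lattice d) : Integrable (fun η => field η x) μ := by
  refine (integrable_finPairing (fun b => (htilt b).1) (flowTo x)).congr ?_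
  filter_upwards [hloop] with η hη using (field_apply hη x).symm

theorem integral_field_eq_zero (hloop : ∀ᵐ η ∂μ, LoopCondition η) (htilt : HasZeroTilt μ)
    (x : Lattice d) : ∫ η, field η x ∂μ = 0 := by
  have hflow : ∀ᵐ η ∂μ, field η x = ∑ b ∈ (flowTo x).support, flowTo x b * η b := by
    filter_upwards [hloop] with η hη
    rw [field_apply hη, finPairing_apply, Finsupp.sum]
  rw [integral_congr_ae hflow, integral_finsetSum _ fun b _ => (htilt b).1.const_mul _]
  exact Finset.sum_eq_zero fun b _ => by rw [integral_const_mul, (htilt b).2, mul_zero]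

theorem integral_abs_field_add_sub (hloop : ∀ᵐ η ∂μ, LoopCondition η)
    (hinv : IsTranslationInvariant μ) (x y : Lattice d) :
    ∫ η, |field η (y + x) - field η x| ∂μ = ∫ η, |field η y| ∂μ := by
  have hm : Measurable fun η : Edge d → ℝ => |field η y| :=
    ((measurable_pi_apply y).comp measurable_field).abs
  conv_rhs => rw [← hinv x]
  rw [integral_map (measurable_translate x).aemeasurable hm.aestronglyMeasurable]
  refine integral_congr_ae ?_
  filter_upwards [hloop] with η hη
  rw [field_translate hη]

/-- The mean modulus `E_μ |φ_x|` of the field, as a seminorm in `x`. -/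
noncomputable def meanAbs (hloop : ∀ᵐ η ∂μ, LoopCondition η) (hinv : IsTranslationInvariant μ)
    (htilt : HasZeroTilt μ) : AddGroupSeminorm (Lattice d) where
  toFun x := ∫ η, |field η x| ∂μ
  map_zero' := by simp [field_zero]
  neg' x := by
    rw [← integral_abs_field_add_sub hloop hinv x (-x)]
    simp [field_zero]
  add_le' x y := by
    have hi := integrable_field hloop htilt
    have hdiff : Integrable (fun η => |field η (x + y) - field η y|) μ := ((hi _).sub (hi _)).abs
    rw [← integral_abs_field_add_sub hloop hinv y x, ← integral_add hdiff (hi y).abs]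
    refine integral_mono (hi _).abs (hdiff.add (hi y).abs) fun η => ?_
    simpa using abs_add_le (field η (x + y) - field η y) (field η y)

theorem integral_abs_field_translate_sub_le (hloop : ∀ᵐ η ∂μ, LoopCondition η)
    (hinv : IsTranslationInvariant μ) (htilt : HasZeroTilt μ) (x y : Lattice d) :
    ∫ η, |field (translate x η) y - field η y| ∂μ ≤ 2 * ∫ η, |field η x| ∂μ := by
  have hi := integrable_field hloop htilt
  have hdiff : Integrable (fun η => |field η (x + y) - field η y|) μ := ((hi _).sub (hi _)).abs
  calc ∫ η, |field (translate x η) y - field η y| ∂μ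
      ≤ ∫ η, (|field η (x + y) - field η y| + |field η x|) ∂μ := by
        refine integral_mono_ae
          (((measurePreserving_translate hinv x).integrable_comp_of_integrable (hi y)).sub
            (hi y)).abs (hdiff.add (hi x).abs) ?_
        filter_upwards [hloop] with η hη
        rw [field_translate hη, add_comm y, sub_right_comm]
        exact abs_sub _ _
    _ = 2 * ∫ η, |field η x| ∂μ := by
        rw [integral_add hdiff (hi x).abs, integral_abs_field_add_sub hloop hinv, two_mul]

variable [IsProbabilityMeasure μ] (hloop : ∀ᵐ η ∂μ, LoopCondition η)
  (hinv : IsTranslationInvariant μ) (htilt : HasZeroTilt μ)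

include hloop hinv htilt in
theorem exists_tendsto_integral_abs_field_nsmul_sub (x : Lattice d) :
    ∃ Z : (Edge d → ℝ) → ℝ, Measurable Z ∧ Integrable Z μ ∧
      Tendsto (fun n : ℕ => ∫ η, |(n : ℝ)⁻¹ * field η (n • x) - Z η| ∂μ) atTop (𝓝 0) := by
  obtain ⟨Z, hZm, hZi, hZ⟩ := exists_tendsto_integral_abs_birkhoffAverage_sub
    (measurePreserving_translate hinv x) (integrable_field hloop htilt x)
  refine ⟨Z, hZm, hZi, hZ.congr fun n => integral_congr_ae ?_⟩
  filter_upwards [hloop] with η hη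
  rw [birkhoffAverage, birkhoffSum_translate_field hη, smul_eq_mul]

include hloop hinv htilt in
theorem tendsto_integral_abs_field_nsmul (herg : IsErgodic μ) (x : Lattice d) :
    Tendsto (fun n : ℕ => (∫ η, |field η (n • x)| ∂μ) / n) atTop (𝓝 0) := by
  obtain ⟨Z, hZm, hZi, hZ⟩ := exists_tendsto_integral_abs_field_nsmul_sub hloop hinv htilt x
  have hi : ∀ n : ℕ, Integrable (fun η => (n : ℝ)⁻¹ * field η (n • x)) μ :=
    fun n => (integrable_field hloop htilt _).const_mul _
  have hZinv : ∀ y, ∀ᵐ η ∂μ, Z (translate y η) = Z η := fun y => by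
    have hlim : Tendsto (fun n : ℕ => (n : ℝ)⁻¹ * (2 * ∫ η, |field η y| ∂μ)) atTop (𝓝 0) := by
      simpa only [zero_mul] using (tendsto_inv_atTop_nhds_zero_nat (𝕜 := ℝ)).mul_const _
    refine comp_ae_eq_of_tendsto_integral_abs_sub (measurePreserving_translate hinv y) hi hZi hZ
      (squeeze_zero (fun n => integral_nonneg fun _ => abs_nonneg _) (fun n => ?_) hlim)
    simp only [← mul_sub, abs_mul, abs_inv, Nat.abs_cast, integral_const_mul]
    gcongr
    exact integral_abs_field_translate_sub_le hloop hinv htilt y _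
  obtain ⟨c, hc⟩ := ae_eq_const_of_forall_translate herg hZm hZinv
  have hc0 : c = 0 := by
    refine abs_nonpos_iff.1 (ge_of_tendsto' hZ fun n => ?_)
    calc |c| = |∫ η, ((n : ℝ)⁻¹ * field η (n • x) - Z η) ∂μ| := by
          rw [integral_sub (hi n) hZi, integral_const_mul, integral_field_eq_zero hloop htilt,
            integral_congr_ae hc]
          simp
      _ ≤ _ := abs_integral_le_integral_abs
  refine hZ.congr fun n => ?_
  rw [div_eq_inv_mul, ← integral_const_mul]
  refine integral_congr_ae ?_
  filter_upwards [hc] with η hη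
  rw [hη, hc0, sub_zero, abs_mul, abs_inv, Nat.abs_cast]

end Sublinear

theorem eventually_forall_le_mul_of_tendsto_div {u : ℕ → ℝ}
    (hu : Tendsto (fun n => u n / n) atTop (𝓝 0)) {ε : ℝ} (hε : 0 < ε) :
    ∀ᶠ n : ℕ in atTop, ∀ k ≤ n, u k ≤ ε * n := by
  obtain ⟨m, hm⟩ := eventually_atTop.1 (hu.eventually (gt_mem_nhds hε))
  obtain ⟨C, hC⟩ := ((Finset.range (m + 1)).image u).exists_le
  filter_upwards [(tendsto_natCast_atTop_atTop.const_mul_atTop hε).eventually_ge_atTop C]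
    with n hn k hk
  rcases Nat.lt_or_ge k (m + 1) with hkm | hkm
  · exact (hC _ (Finset.mem_image_of_mem u (Finset.mem_range.2 hkm))).trans hn
  · have hk0 : (0 : ℝ) < k := by exact_mod_cast (Nat.succ_pos m).trans_le hkm
    have huk := (div_lt_iff₀ hk0).1 (hm k (Nat.le_of_succ_le hkm))
    exact huk.le.trans (by gcongr)

theorem eventually_seminorm_le (p : AddGroupSeminorm (Lattice d))
    (hp : ∀ i, Tendsto (fun n : ℕ => p (n • unitVec i) / n) atTop (𝓝 0)) {ε : ℝ} (hε : 0 < ε) :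
    ∀ᶠ n : ℕ in atTop, ∀ x : Lattice d, ‖x‖ ≤ n → p x ≤ ε * n := by
  have haxis := eventually_all.2 fun i => eventually_forall_le_mul_of_tendsto_div (hp i)
    (by positivity : 0 < ε / (d + 1))
  filter_upwards [haxis] with n hn x hx
  have hterm : ∀ i, p (x i • unitVec i) ≤ ε / (d + 1) * n := fun i => by
    have hnorm : ((x i).natAbs : ℝ) = ‖x i‖ := by
      rw [Nat.cast_natAbs, Int.norm_eq_abs, Int.cast_abs]
    have hi := hn i (x i).natAbs
      (Nat.cast_le.1 (hnorm.le.trans ((norm_le_pi_norm x i).trans hx)))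
    rcases Int.natAbs_eq (x i) with h | h
    · rw [h, natCast_zsmul]
      simpa using hi
    · rw [h, neg_smul, natCast_zsmul, map_neg_eq_map]
      simpa using hi
  calc p x = p (∑ i, x i • unitVec i) := by
        congr 1
        ext j
        simp [Finset.sum_apply, unitVec_apply]
    _ ≤ ∑ i, p (x i • unitVec i) :=
        Finset.le_sum_of_subadditive p (map_zero p).le (map_add_le_add p) _ _
    _ ≤ ∑ _i : Fin d, ε / (d + 1) * n := Finset.sum_le_sum fun i _ => hterm i
    _ = ε * n * (d / (d + 1)) := by
        rw [Finset.sum_const, Finset.card_univ, Fintype.card_fin, nsmul_eq_mul]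
        ring
    _ ≤ ε * n * 1 := by
        gcongr
        exact div_le_one_of_le₀ (by linarith) (by positivity)
    _ = ε * n := mul_one _

theorem eventually_integral_abs_field_le [IsProbabilityMeasure μ]
    (hloop : ∀ᵐ η ∂μ, LoopCondition η) (hinv : IsTranslationInvariant μ) (herg : IsErgodic μ)
    (htilt : HasZeroTilt μ) {ε : ℝ} (hε : 0 < ε) :
    ∀ᶠ n : ℕ in atTop, ∀ x : Lattice d, ‖x‖ ≤ n → ∫ η, |field η x| ∂μ ≤ ε * n :=
  eventually_seminorm_le (meanAbs hloop hinv htilt)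
    (fun i => tendsto_integral_abs_field_nsmul hloop hinv htilt herg (unitVec i)) hε

/-! ### First moments of the harmonic part -/

section FirstMoments

variable {ϱ : Measure ℝ} {μ : Measure (Edge d → ℝ)} {μt : Measure ((Edge d → ℝ) × (Edge d → ℝ))}

theorem integrable_comp_fst (hext : IsExtension ϱ μ μt) {f : (Edge d → ℝ) → ℝ}
    (hf : Integrable f μ) : Integrable (fun ω : (Edge d → ℝ) × (Edge d → ℝ) => f ω.1) μt := by
  rw [← map_fst_extension hext] at hf
  exact hf.comp_measurable measurable_fst

theorem integral_comp_fst (hext : IsExtension ϱ μ μt) {f : (Edge d → ℝ) → ℝ}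
    (hf : AEStronglyMeasurable f μ) : ∫ ω, f ω.1 ∂μt = ∫ η, f η ∂μ := by
  rw [← map_fst_extension hext] at hf
  conv_rhs => rw [← map_fst_extension hext]
  exact (integral_map measurable_fst.aemeasurable hf).symm

theorem ae_comp_fst (hext : IsExtension ϱ μ μt) {p : (Edge d → ℝ) → Prop}
    (hp : ∀ᵐ η ∂μ, p η) : ∀ᵐ ω ∂μt, p ω.1 := by
  rw [← map_fst_extension hext] at hp
  exact ae_of_ae_map measurable_fst.aemeasurable hp

theorem integral_abs_edge (hloop : ∀ᵐ η ∂μ, LoopCondition η) (hinv : IsTranslationInvariant μ)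
    (b : Edge d) : ∫ η, |η b| ∂μ = ∫ η, |field η (unitVec b.2)| ∂μ := by
  rw [← integral_abs_field_add_sub hloop hinv b.1 (unitVec b.2)]
  refine integral_congr_ae ?_
  filter_upwards [hloop] with η hη
  conv_lhs => rw [← grad_field hη]
  rw [grad, add_comm]

/-- The first absolute moment of the standard normal distribution. -/
noncomputable def normalAbs : ℝ := ∫ t, |t| ∂(gaussianReal 0 1)

theorem normalAbs_nonneg : 0 ≤ normalAbs := integral_nonneg fun _ => abs_nonneg _

theorem integrable_id_gaussianReal : Integrable (fun t : ℝ => t) (gaussianReal 0 1) :=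
  (memLp_id_gaussianReal 1).integrable le_rfl

/-- A bound, uniform in the volume and in the edge, on the mean modulus of the harmonic part when
the conductances are at least `a`. -/
noncomputable def edgeBound (μ : Measure (Edge d → ℝ)) (a : ℝ) : ℝ :=
  ∑ i, ∫ η, |field η (unitVec i)| ∂μ + √a⁻¹ * normalAbs

theorem edgeBound_nonneg (μ : Measure (Edge d → ℝ)) (a : ℝ) : 0 ≤ edgeBound μ a :=
  add_nonneg (Finset.sum_nonneg fun _ _ => integral_nonneg fun _ => abs_nonneg _)
    (mul_nonneg (Real.sqrt_nonneg _) normalAbs_nonneg)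

/-- The field of the harmonic part, normalised as the field of `η` is. -/
noncomputable def harmonicField (Λ : Finset (Lattice d)) (ω : (Edge d → ℝ) × (Edge d → ℝ)) :
    Lattice d → ℝ := field ω.1 - dirichletPart Λ ω.2 ω.1

theorem grad_harmonicField {Λ : Finset (Lattice d)} {ω : (Edge d → ℝ) × (Edge d → ℝ)}
    (h : LoopCondition ω.1) : grad (harmonicField Λ ω) = harmonicPart Λ ω.2 ω.1 := by
  rw [harmonicField, grad_sub, grad_field h, harmonicPart]

theorem sum_sq_le_localEnergy {a : ℝ} (ha : 0 < a) {κ : Edge d → ℝ} (hκ : ∀ b, a ≤ κ b)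
    (Λ : Finset (Lattice d)) (η : Edge d → ℝ) :
    ∑ b ∈ touching Λ, η b ^ 2 ≤ a⁻¹ * localEnergy Λ κ η := by
  rw [localEnergy, le_inv_mul_iff₀ ha, Finset.mul_sum]
  exact Finset.sum_le_sum fun b _ => mul_le_mul_of_nonneg_right (hκ b) (sq_nonneg _)

theorem greenForm_le_of_sq_finPairing_le [NeZero d] {a C : ℝ} (ha : 0 < a) (hC : 0 ≤ C)
    {κ : Edge d → ℝ} (hκ : ∀ b, a ≤ κ b) {Λ : Finset (Lattice d)} {θ : Edge d →₀ ℝ}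
    (hθ : ∀ h : Lattice d → ℝ, (∀ x ∉ Λ, h x = 0) →
      finPairing θ (grad h) ^ 2 ≤ C * ∑ b ∈ touching Λ, grad h b ^ 2) :
    greenForm Λ κ (-diverg θ) ≤ C * a⁻¹ := by
  refine greenForm_le_of_sq_le (fun b _ => ha.trans_le (hκ b)) _ (by positivity) fun h hh => ?_
  have hsum : ∑ x ∈ Λ, (-diverg θ) x * h x = finPairing θ (grad h) :=
    (finPairing_grad_eq_sum θ hh).symm
  rw [hsum, mul_assoc]
  exact (hθ h hh).trans (mul_le_mul_of_nonneg_left (sum_sq_le_localEnergy ha hκ Λ _) hC)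

variable [IsFiniteMeasure ϱ] [IsFiniteMeasure μ]

theorem identDistrib_finPairing_dirichletPart [NeZero d] [IsFiniteMeasure μt]
    (hpos : ∀ᵐ k ∂ϱ, 0 < k) (hG : IsGradientGibbs ϱ μ) (hext : IsExtension ϱ μ μt)
    (Λ : Finset (Lattice d)) (θ : Edge d →₀ ℝ) :
    IdentDistrib (fun ω => finPairing θ (grad (dirichletPart Λ ω.2 ω.1)))
      (fun p : ((Edge d → ℝ) × (Edge d → ℝ)) × ℝ =>
        √(greenForm Λ p.1.2 (-diverg θ)) * p.2) μt (μt.prod (gaussianReal 0 1)) := by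
  have hl := (measurable_harmonicPart Λ).prodMk (measurable_finPairing_dirichletPart Λ θ)
  have hr := measurable_resampled Λ θ
  have hident : IdentDistrib _ _ μt (μt.prod (gaussianReal 0 1)) :=
    ⟨(hl.prodMk measurable_snd).aemeasurable,
      (hr.prodMk (measurable_snd.comp measurable_fst)).aemeasurable,
      map_resample hpos hG hext Λ θ⟩
  exact hident.comp (measurable_snd.comp measurable_fst)

section Bounds

variable [NeZero d] [IsProbabilityMeasure μt] {a : ℝ} (ha : 0 < a) (hϱ : ∀ᵐ k ∂ϱ, a ≤ k)
  (hG : IsGradientGibbs ϱ μ) (hext : IsExtension ϱ μ μt)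
include ha hϱ hG hext

theorem integrable_and_integral_abs_finPairing_dirichletPart_le {C : ℝ} (hC : 0 ≤ C)
    {Λ : Finset (Lattice d)} {θ : Edge d →₀ ℝ}
    (hθ : ∀ h : Lattice d → ℝ, (∀ x ∉ Λ, h x = 0) →
      finPairing θ (grad h) ^ 2 ≤ C * ∑ b ∈ touching Λ, grad h b ^ 2) :
    Integrable (fun ω => finPairing θ (grad (dirichletPart Λ ω.2 ω.1))) μt ∧
      ∫ ω, |finPairing θ (grad (dirichletPart Λ ω.2 ω.1))| ∂μt ≤ √(C * a⁻¹) * normalAbs := by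
  have hident := identDistrib_finPairing_dirichletPart (hϱ.mono fun k hk => ha.trans_le hk) hG
    hext Λ θ
  have hle : ∀ᵐ p ∂μt.prod (gaussianReal 0 1),
      |√(greenForm Λ p.1.2 (-diverg θ)) * p.2| ≤ √(C * a⁻¹) * |p.2| := by
    filter_upwards [Measure.quasiMeasurePreserving_fst.ae (ae_mem_of_extension hext hϱ)] with p hp
    rw [abs_mul, abs_of_nonneg (Real.sqrt_nonneg _)]
    exact mul_le_mul_of_nonneg_right
      (Real.sqrt_le_sqrt (greenForm_le_of_sq_finPairing_le ha hC hp hθ)) (abs_nonneg _)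
  have hdom : Integrable (fun p : ((Edge d → ℝ) × (Edge d → ℝ)) × ℝ => √(C * a⁻¹) * |p.2|)
      (μt.prod (gaussianReal 0 1)) :=
    (integrable_id_gaussianReal.abs.comp_snd μt).const_mul _
  have hint : Integrable (fun p : ((Edge d → ℝ) × (Edge d → ℝ)) × ℝ =>
      √(greenForm Λ p.1.2 (-diverg θ)) * p.2) (μt.prod (gaussianReal 0 1)) :=
    hdom.mono' (measurable_resampled Λ θ).snd.aestronglyMeasurable hle
  refine ⟨hident.integrable_iff.2 hint, ?_⟩
  calc ∫ ω, |finPairing θ (grad (dirichletPart Λ ω.2 ω.1))| ∂μt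
      = ∫ p, |√(greenForm Λ p.1.2 (-diverg θ)) * p.2| ∂μt.prod (gaussianReal 0 1) :=
        (hident.comp measurable_norm).integral_eq
    _ ≤ ∫ p, √(C * a⁻¹) * |p.2| ∂μt.prod (gaussianReal 0 1) := integral_mono_ae hint.abs hdom hle
    _ = √(C * a⁻¹) * normalAbs := by
        rw [integral_const_mul, integral_fun_snd (fun t : ℝ => |t|), probReal_univ, one_smul,
          normalAbs]

theorem integrable_and_integral_abs_grad_dirichletPart_le (Λ : Finset (Lattice d)) (b : Edge d) :
    Integrable (fun ω => grad (dirichletPart Λ ω.2 ω.1) b) μt ∧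
      ∫ ω, |grad (dirichletPart Λ ω.2 ω.1) b| ∂μt ≤ √a⁻¹ * normalAbs := by
  have h := integrable_and_integral_abs_finPairing_dirichletPart_le ha hϱ hG hext zero_le_one
    (Λ := Λ) (θ := Finsupp.single b 1) fun h hh => by
      rw [finPairing_single, one_mul, one_mul]
      by_cases hb : b ∈ touching Λ
      · exact Finset.single_le_sum (f := fun b => grad h b ^ 2) (fun _ _ => sq_nonneg _) hb
      · rw [grad_eq_zero_of_notMem_touching hh hb, zero_pow two_ne_zero]
        exact Finset.sum_nonneg fun b _ => sq_nonneg _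
  simpa only [finPairing_single, one_mul] using h

theorem integrable_and_integral_abs_dirichletPart_le {Λ : Finset (Lattice d)} {x : Lattice d}
    {i : Fin d} {n : ℕ} (hn : x + n • unitVec i ∉ Λ) :
    Integrable (fun ω => dirichletPart Λ ω.2 ω.1 x) μt ∧
      ∫ ω, |dirichletPart Λ ω.2 ω.1 x| ∂μt ≤ √(n * a⁻¹) * normalAbs := by
  have hpair : ∀ h : Lattice d → ℝ, (∀ x ∉ Λ, h x = 0) →
      finPairing (flowTo x - flowTo (x + n • unitVec i)) (grad h) = h x := fun h hh => by
    rw [map_sub, sub_apply, finPairing_flowTo, finPairing_flowTo, hh _ hn]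
    ring
  have h := integrable_and_integral_abs_finPairing_dirichletPart_le ha hϱ hG hext n.cast_nonneg
    fun h hh => by
      rw [hpair h hh]
      exact sq_le_mul_sum_touching hh x i n hn
  simpa only [hpair _ (dirichletPart_of_notMem _ _)] using h

theorem integrable_harmonicPart (htilt : HasZeroTilt μ) (Λ : Finset (Lattice d)) (b : Edge d) :
    Integrable (fun ω => harmonicPart Λ ω.2 ω.1 b) μt :=
  (integrable_comp_fst hext (htilt b).1).sub
    (integrable_and_integral_abs_grad_dirichletPart_le ha hϱ hG hext Λ b).1

theorem integral_abs_harmonicPart_le (hinv : IsTranslationInvariant μ) (htilt : HasZeroTilt μ)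
    (Λ : Finset (Lattice d)) (b : Edge d) :
    ∫ ω, |harmonicPart Λ ω.2 ω.1 b| ∂μt ≤ edgeBound μ a := by
  obtain ⟨hi, hb⟩ := integrable_and_integral_abs_grad_dirichletPart_le ha hϱ hG hext Λ b
  have hi1 : Integrable (fun ω : (Edge d → ℝ) × (Edge d → ℝ) => |ω.1 b|) μt :=
    (integrable_comp_fst hext (htilt b).1).abs
  calc ∫ ω, |harmonicPart Λ ω.2 ω.1 b| ∂μt
      ≤ ∫ ω, (|ω.1 b| + |grad (dirichletPart Λ ω.2 ω.1) b|) ∂μt :=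
        integral_mono (integrable_harmonicPart ha hϱ hG hext htilt Λ b).abs (hi1.add hi.abs)
          fun ω => abs_sub _ _
    _ = ∫ η, |η b| ∂μ + ∫ ω, |grad (dirichletPart Λ ω.2 ω.1) b| ∂μt := by
        rw [integral_add hi1 hi.abs, integral_comp_fst hext (f := fun η => |η b|) (htilt b).1.abs.1]
    _ ≤ edgeBound μ a := by
        rw [integral_abs_edge hG.1 hinv]
        exact add_le_add (Finset.single_le_sum (f := fun i => ∫ η, |field η (unitVec i)| ∂μ)
          (fun _ _ => integral_nonneg fun _ => abs_nonneg _) (Finset.mem_univ b.2)) hb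

theorem integrable_and_integral_abs_harmonicField_le (htilt : HasZeroTilt μ)
    {Λ : Finset (Lattice d)} {x : Lattice d} {i : Fin d} {n : ℕ} (hn : x + n • unitVec i ∉ Λ) :
    Integrable (fun ω => harmonicField Λ ω x) μt ∧
      ∫ ω, |harmonicField Λ ω x| ∂μt ≤ ∫ η, |field η x| ∂μ + √(n * a⁻¹) * normalAbs := by
  obtain ⟨hi, hb⟩ := integrable_and_integral_abs_dirichletPart_le ha hϱ hG hext hn
  have hf := integrable_field hG.1 htilt x
  have hi1 : Integrable (fun ω : (Edge d → ℝ) × (Edge d → ℝ) => field ω.1 x) μt :=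
    integrable_comp_fst hext hf
  have hi2 : Integrable (fun ω => harmonicField Λ ω x) μt := hi1.sub hi
  refine ⟨hi2, ?_⟩
  calc ∫ ω, |harmonicField Λ ω x| ∂μt
      ≤ ∫ ω, (|field ω.1 x| + |dirichletPart Λ ω.2 ω.1 x|) ∂μt :=
        integral_mono hi2.abs (hi1.abs.add hi.abs) fun ω => abs_sub _ _
    _ = ∫ η, |field η x| ∂μ + ∫ ω, |dirichletPart Λ ω.2 ω.1 x| ∂μt := by
        rw [integral_add hi1.abs hi.abs,
          integral_comp_fst hext (f := fun η => |field η x|) hf.abs.1]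
    _ ≤ _ := by gcongr

end Bounds

end FirstMoments

/-! ### Smallness of the harmonic part -/

/-- The box `{-n, …, n}^d`. -/
noncomputable def box (d n : ℕ) : Finset (Lattice d) :=
  Fintype.piFinset fun _ => Finset.Icc (-(n : ℤ)) n

theorem mem_box {n : ℕ} {x : Lattice d} : x ∈ box d n ↔ ‖x‖ ≤ n := by
  rw [box, Fintype.mem_piFinset, pi_norm_le_iff_of_nonneg n.cast_nonneg]
  refine forall_congr' fun i => ?_
  rw [Finset.mem_Icc, ← abs_le, Int.norm_eq_abs]
  exact_mod_cast Iff.rfl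

theorem box_mono {m n : ℕ} (h : m ≤ n) : box d m ⊆ box d n := fun _ hx =>
  mem_box.2 ((mem_box.1 hx).trans (Nat.cast_le.2 h))

theorem card_box (n : ℕ) : (box d n).card = (2 * n + 1) ^ d := by
  simp only [box, Fintype.card_piFinset, Int.card_Icc, Finset.prod_const, Finset.card_univ,
    Fintype.card_fin]
  congr 1
  omega

theorem exists_subset_box (s : Finset (Lattice d)) : ∃ n, s ⊆ box d n := by
  obtain ⟨r, hr⟩ := (s.image norm).exists_le
  obtain ⟨n, hn⟩ := exists_nat_ge r
  exact ⟨n, fun x hx => mem_box.2 ((hr _ (Finset.mem_image_of_mem _ hx)).trans hn)⟩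

theorem norm_unitVec (i : Fin d) : ‖unitVec i‖ = 1 := by
  rw [unitVec, Pi.norm_single, norm_one]

theorem add_mem_box {m n : ℕ} {x y : Lattice d} (hx : x ∈ box d m) (hy : y ∈ box d n) :
    x + y ∈ box d (m + n) := by
  rw [mem_box] at *
  push_cast
  exact (norm_add_le x y).trans (add_le_add hx hy)

theorem unitVec_mem_box (i : Fin d) : unitVec i ∈ box d 1 := by
  rw [mem_box, norm_unitVec, Nat.cast_one]

theorem add_smul_unitVec_notMem_box {m n : ℕ} {x : Lattice d} (hx : x ∈ box d m) (i : Fin d) :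
    x + (n + m + 1) • unitVec i ∉ box d n := fun h => by
  simp only [box, Fintype.mem_piFinset, Finset.mem_Icc] at hx h
  have hxi := hx i
  have hi := h i
  rw [Pi.add_apply, Pi.smul_apply, unitVec_apply, if_pos rfl, nsmul_eq_mul, mul_one] at hi
  push_cast at hi
  omega

theorem card_touching_le (Λ : Finset (Lattice d)) : (touching Λ).card ≤ 2 * d * Λ.card := by
  unfold touching
  refine (Finset.card_union_le _ _).trans ?_
  have himage := Finset.card_image_le (s := Λ ×ˢ (Finset.univ : Finset (Fin d)))
    (f := fun b => ((b.1 - unitVec b.2, b.2) : Edge d))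
  rw [Finset.card_product, Finset.card_univ, Fintype.card_fin] at *
  linarith

/-- The edges of `ℤ^d` starting in the box `{-n, …, n}^d`. -/
noncomputable def edgeBox (d n : ℕ) : Finset (Edge d) := box d n ×ˢ Finset.univ

theorem mem_edgeBox {n : ℕ} {b : Edge d} : b ∈ edgeBox d n ↔ b.1 ∈ box d n := by
  simp only [edgeBox, Finset.mem_product, Finset.mem_univ, and_true]

theorem card_edgeBox (n : ℕ) : (edgeBox d n).card = d * (2 * n + 1) ^ d := by
  rw [edgeBox, Finset.card_product, card_box, Finset.card_univ, Fintype.card_fin, mul_comm]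

/-- The cutoff function `(r - ‖x‖)₊` of the truncated Caccioppoli inequality. -/
noncomputable def cutoff (r : ℝ) (x : Lattice d) : ℝ := max 0 (r - ‖x‖)

theorem abs_grad_cutoff_le (r : ℝ) (b : Edge d) : |grad (cutoff r) b| ≤ 1 := by
  rw [grad, cutoff, cutoff]
  calc |max 0 (r - ‖b.1 + unitVec b.2‖) - max 0 (r - ‖b.1‖)|
      ≤ |‖b.1‖ - ‖b.1 + unitVec b.2‖| := by
        simpa [max_comm (0 : ℝ)] using
          abs_max_sub_max_le_abs (r - ‖b.1 + unitVec b.2‖) (r - ‖b.1‖) 0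
    _ ≤ ‖b.1 - (b.1 + unitVec b.2)‖ := abs_norm_sub_norm_le _ _
    _ = 1 := by rw [sub_add_cancel_left, norm_neg, norm_unitVec]

theorem mul_sum_edgeBox_sq_grad_clamp_le {κ : Edge d → ℝ} {a c K : ℝ} (ha : 0 ≤ a) (hK : 0 ≤ K)
    {m : ℕ} (hκ : ∀ b, κ b ∈ Set.Icc a c) {u : Lattice d → ℝ}
    (hu : ∀ x ∈ box d (2 * m), diverg (κ * grad u) x = 0) :
    a * (m * ∑ b ∈ edgeBox d m, grad (fun x => clamp K (u x)) b ^ 2) ≤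
      c * K * ∑ b ∈ touching (box d (2 * m)), |grad u b| := by
  refine le_trans (mul_le_mul_of_nonneg_left ?_ ha) <|
    sum_cutoff_mul_sq_grad_clamp_le (χ := cutoff (2 * m)) ha (fun b _ => hκ b) hK hu
      (fun _ => le_max_left _ _) (fun x hx => ?_) (abs_grad_cutoff_le _)
  · rw [Finset.mul_sum]
    refine (Finset.sum_le_sum fun b hb => mul_le_mul_of_nonneg_right ?_ (sq_nonneg _)).trans
      (Finset.sum_le_sum_of_subset_of_nonneg (fun b hb => mem_touching.2 (Or.inl ?_))
        fun b _ _ => mul_nonneg (le_max_left _ _) (sq_nonneg _))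
    · have := mem_box.1 (mem_edgeBox.1 hb)
      exact le_max_of_le_right (by linarith)
    · exact box_mono (by omega) (mem_edgeBox.1 hb)
  · rw [mem_box, not_le] at hx
    push_cast at hx
    exact max_eq_left (by linarith)

theorem min_one_abs_sub_le {s K : ℝ} (hs : 0 < s) (hK : 0 < K) (x y : ℝ) :
    min 1 |x - y| ≤ s + (4 * s)⁻¹ * (clamp K x - clamp K y) ^ 2 + K⁻¹ * (|x| + |y|) := by
  have hsq : 0 ≤ (4 * s)⁻¹ * (clamp K x - clamp K y) ^ 2 := by positivity
  by_cases h : |x| ≤ K ∧ |y| ≤ K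
  · rw [clamp_of_abs_le h.1, clamp_of_abs_le h.2]
    have hamgm : |x - y| ≤ s + (4 * s)⁻¹ * (x - y) ^ 2 := by
      have : s + (4 * s)⁻¹ * (x - y) ^ 2 - |x - y| = (4 * s)⁻¹ * (2 * s - |x - y|) ^ 2 := by
        rw [← sq_abs (x - y)]
        field_simp
        ring
      linarith [show 0 ≤ (4 * s)⁻¹ * (2 * s - |x - y|) ^ 2 by positivity]
    have hnonneg : 0 ≤ K⁻¹ * (|x| + |y|) := by positivity
    exact (min_le_right _ _).trans (by linarith)
  · have hone : 1 ≤ K⁻¹ * (|x| + |y|) := by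
      rw [← div_eq_inv_mul, one_le_div hK]
      rcases not_and_or.1 h with h | h <;> linarith [abs_nonneg x, abs_nonneg y]
    exact (min_le_left _ _).trans (by linarith)

theorem sum_edgeBox_min_one_abs_grad_le {κ : Edge d → ℝ} {a c s K : ℝ} (ha : 0 < a) (hs : 0 < s)
    (hK : 0 < K) {m : ℕ} (hm : 0 < m) (hκ : ∀ b, κ b ∈ Set.Icc a c) {u : Lattice d → ℝ}
    (hu : ∀ x ∈ box d (2 * m), diverg (κ * grad u) x = 0) :
    ∑ b ∈ edgeBox d m, min 1 |grad u b| ≤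
      (edgeBox d m).card * s + K⁻¹ * ∑ b ∈ edgeBox d m, (|u (b.1 + unitVec b.2)| + |u b.1|) +
        (4 * s)⁻¹ * (c * K / (a * m)) * ∑ b ∈ touching (box d (2 * m)), |grad u b| := by
  have hcacc : ∑ b ∈ edgeBox d m, grad (fun x => clamp K (u x)) b ^ 2 ≤
      c * K / (a * m) * ∑ b ∈ touching (box d (2 * m)), |grad u b| := by
    rw [div_mul_eq_mul_div, le_div_iff₀ (by positivity), mul_comm, mul_assoc]
    exact mul_sum_edgeBox_sq_grad_clamp_le ha.le hK.le hκ hu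
  calc ∑ b ∈ edgeBox d m, min 1 |grad u b|
      ≤ ∑ b ∈ edgeBox d m, (s + (4 * s)⁻¹ * grad (fun x => clamp K (u x)) b ^ 2 +
          K⁻¹ * (|u (b.1 + unitVec b.2)| + |u b.1|)) :=
        Finset.sum_le_sum fun b _ => min_one_abs_sub_le hs hK _ _
    _ = (edgeBox d m).card * s + K⁻¹ * ∑ b ∈ edgeBox d m, (|u (b.1 + unitVec b.2)| + |u b.1|) +
          (4 * s)⁻¹ * ∑ b ∈ edgeBox d m, grad (fun x => clamp K (u x)) b ^ 2 := by
        rw [Finset.sum_add_distrib, Finset.sum_add_distrib, Finset.sum_const, nsmul_eq_mul,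
          Finset.mul_sum, Finset.mul_sum]
        ring
    _ ≤ _ := by
        rw [mul_assoc (4 * s)⁻¹]
        gcongr

theorem min_one_abs_sum_mul_le {ι : Type*} (s : Finset ι) (w h : ι → ℝ) :
    min 1 |∑ b ∈ s, w b * h b| ≤ ∑ b ∈ s, (1 + |w b|) * min 1 |h b| := by
  by_cases hsmall : ∀ b ∈ s, |h b| ≤ 1
  · refine (min_le_right _ _).trans ((Finset.abs_sum_le_sum_abs _ _).trans
      (Finset.sum_le_sum fun b hb => ?_))
    rw [min_eq_right (hsmall b hb), abs_mul]
    exact mul_le_mul_of_nonneg_right (by linarith) (abs_nonneg _)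
  · push Not at hsmall
    obtain ⟨b, hb, hb1⟩ := hsmall
    calc min 1 |∑ b ∈ s, w b * h b| ≤ 1 := min_le_left _ _
      _ ≤ (1 + |w b|) * min 1 |h b| := by
          rw [min_eq_left hb1.le]
          linarith [abs_nonneg (w b)]
      _ ≤ _ := Finset.single_le_sum (f := fun b => (1 + |w b|) * min 1 |h b|)
          (fun i _ => mul_nonneg (by positivity) (by positivity)) hb

theorem integrable_min_one_abs {Ω : Type*} [MeasurableSpace Ω] {ν : Measure Ω} [IsFiniteMeasure ν]
    {f : Ω → ℝ} (hf : Measurable f) : Integrable (fun ω => min 1 |f ω|) ν := by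
  refine Integrable.of_bound (C := 1) (by fun_prop) (Eventually.of_forall fun ω => ?_)
  rw [Real.norm_eq_abs, abs_of_nonneg (by positivity)]
  exact min_le_left _ _

theorem integral_finsetSum_le_card_mul {Ω ι : Type*} [MeasurableSpace Ω] {ν : Measure Ω}
    {s : Finset ι} {f : ι → Ω → ℝ} (hf : ∀ i ∈ s, Integrable (f i) ν) {C : ℝ}
    (hC : ∀ i ∈ s, ∫ ω, f i ω ∂ν ≤ C) : ∫ ω, ∑ i ∈ s, f i ω ∂ν ≤ s.card * C := by
  rw [integral_finsetSum _ hf, ← nsmul_eq_mul]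
  exact Finset.sum_le_card_nsmul _ _ _ hC

theorem exists_mem_box_sum_translate_le {J w : Edge d → ℝ} (hJ : ∀ b, 0 ≤ J b) (hw : ∀ b, 0 ≤ w b)
    {s : Finset (Edge d)} {R : ℕ} (hs : ∀ b ∈ s, b.1 ∈ box d R) (n : ℕ) :
    ∃ y ∈ box d n, (2 * n + 1 : ℝ) ^ d * ∑ b ∈ s, w b * J (b.1 + y, b.2) ≤
      (∑ b ∈ s, w b) * ∑ b ∈ edgeBox d (n + R), J b := by
  classical
  have hshift : ∀ b ∈ s, ∑ y ∈ box d n, J (b.1 + y, b.2) ≤ ∑ b ∈ edgeBox d (n + R), J b := by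
    intro b hb
    rw [← Finset.sum_image (f := J) (g := fun y => (b.1 + y, b.2))
      (fun y _ z _ h => add_left_cancel (Prod.ext_iff.1 h).1)]
    refine Finset.sum_le_sum_of_subset_of_nonneg (fun e he => ?_) fun b _ _ => hJ b
    obtain ⟨y, hy, rfl⟩ := Finset.mem_image.1 he
    rw [mem_edgeBox, add_comm n]
    exact add_mem_box (hs b hb) hy
  refine Finset.exists_le_of_sum_le ⟨0, mem_box.2 (norm_zero.trans_le n.cast_nonneg)⟩ ?_
  rw [← Finset.mul_sum, Finset.sum_const, card_box, nsmul_eq_mul, Finset.sum_comm]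
  push_cast
  refine mul_le_mul_of_nonneg_left ?_ (by positivity)
  rw [Finset.sum_mul]
  refine Finset.sum_le_sum fun b hb => ?_
  rw [← Finset.mul_sum]
  exact mul_le_mul_of_nonneg_left (hshift b hb) (hw b)

section Vanishing

variable {ϱ : Measure ℝ} [IsFiniteMeasure ϱ] {a c : ℝ} {μ : Measure (Edge d → ℝ)}
  {μt : Measure ((Edge d → ℝ) × (Edge d → ℝ))} [IsProbabilityMeasure μt] [NeZero d]

theorem integral_min_one_finPairing_harmonicPart_le [IsFiniteMeasure μ] (hpos : ∀ᵐ k ∂ϱ, 0 < k)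
    (hinv : IsTranslationInvariant μ) (hext : IsExtension ϱ μ μt) (θ : Edge d →₀ ℝ)
    {Λ Λ' : Finset (Lattice d)} (y : Lattice d) (hΛ : ∀ z, z + y ∈ Λ' ↔ z ∈ Λ) :
    ∫ ω, min 1 |finPairing θ (harmonicPart Λ ω.2 ω.1)| ∂μt ≤
      ∑ b ∈ θ.support, (1 + |θ b|) *
        ∫ ω, min 1 |harmonicPart Λ' ω.2 ω.1 (b.1 + y, b.2)| ∂μt := by
  have hτ : Measurable (Prod.map (translate y) (translate y) :
      (Edge d → ℝ) × (Edge d → ℝ) → _) := (measurable_translate y).prodMap (measurable_translate y)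
  have hf : Measurable fun ω : (Edge d → ℝ) × (Edge d → ℝ) =>
      finPairing θ (harmonicPart Λ ω.2 ω.1) :=
    (finPairing θ).continuous.measurable.comp (measurable_harmonicPart Λ)
  have hi : ∀ b ∈ θ.support, Integrable (fun ω => (1 + |θ b|) *
      min 1 |harmonicPart Λ' ω.2 ω.1 (b.1 + y, b.2)|) μt := fun b _ =>
    (integrable_min_one_abs
      ((measurable_pi_apply (b.1 + y, b.2)).comp (measurable_harmonicPart Λ'))).const_mul _
  calc ∫ ω, min 1 |finPairing θ (harmonicPart Λ ω.2 ω.1)| ∂μt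
      = ∫ ω, min 1 |finPairing θ (harmonicPart Λ (translate y ω.2) (translate y ω.1))| ∂μt := by
        conv_lhs => rw [← map_translate_extension hinv hext y]
        exact integral_map hτ.aemeasurable
          (measurable_const.min hf.abs).aestronglyMeasurable
    _ ≤ ∫ ω, ∑ b ∈ θ.support, (1 + |θ b|) *
          min 1 |harmonicPart Λ' ω.2 ω.1 (b.1 + y, b.2)| ∂μt := by
        refine integral_mono_ae (integrable_min_one_abs (hf.comp hτ))
          (integrable_finsetSum _ hi) ?_
        filter_upwards [ae_mem_of_extension hext hpos] with ω hω
        rw [← harmonicPart_translate y hΛ hω, finPairing_apply]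
        exact min_one_abs_sum_mul_le _ _ _
    _ = _ := by
        rw [integral_finsetSum _ hi]
        simp_rw [integral_const_mul]

variable [IsProbabilityMeasure μ] (ha : 0 < a) (hϱ : ∀ᵐ k ∂ϱ, k ∈ Set.Icc a c)
  (hG : IsGradientGibbs ϱ μ) (hinv : IsTranslationInvariant μ) (htilt : HasZeroTilt μ)
  (hext : IsExtension ϱ μ μt)

include ha hϱ hG hinv htilt hext in
theorem sum_edgeBox_integral_min_one_harmonicPart_le {m : ℕ} (hm : 0 < m) {s K D : ℝ}
    (hs : 0 < s) (hK : 0 < K) (hD : ∀ x ∈ box d (m + 1),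
      ∫ ω, |harmonicField (box d (2 * m)) ω x| ∂μt ≤ D) :
    ∑ b ∈ edgeBox d m, ∫ ω, min 1 |harmonicPart (box d (2 * m)) ω.2 ω.1 b| ∂μt ≤
      (edgeBox d m).card * s + K⁻¹ * ((edgeBox d m).card * (2 * D)) +
        (4 * s)⁻¹ * (c * K / (a * m)) * ((touching (box d (2 * m))).card * edgeBound μ a) := by
  set Λ := box d (2 * m)
  have hκ := ae_mem_of_extension hext hϱ
  have hϱa := hϱ.mono fun k hk => hk.1
  have hH := integrable_harmonicPart ha hϱa hG hext htilt Λ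
  have hu : ∀ x, Integrable (fun ω => |harmonicField Λ ω x|) μt := fun x => by
    obtain ⟨n, hn⟩ := exists_add_smul_notMem Λ x (0 : Fin d)
    exact (integrable_and_integral_abs_harmonicField_le ha hϱa hG hext htilt hn).1.abs
  have hmin : ∀ b, Integrable (fun ω => min 1 |harmonicPart Λ ω.2 ω.1 b|) μt := fun b =>
    integrable_min_one_abs ((measurable_pi_apply b).comp (measurable_harmonicPart Λ))
  have hc : 0 ≤ c := by
    obtain ⟨ω, hω⟩ := hκ.exists
    exact ha.le.trans ((hω (0, 0)).1.trans (hω (0, 0)).2)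
  have hv : ∀ b ∈ edgeBox d m, Integrable (fun ω =>
      |harmonicField Λ ω (b.1 + unitVec b.2)| + |harmonicField Λ ω b.1|) μt :=
    fun b _ => (hu _).add (hu _)
  have hvD : ∀ b ∈ edgeBox d m,
      ∫ ω, |harmonicField Λ ω (b.1 + unitVec b.2)| + |harmonicField Λ ω b.1| ∂μt ≤ 2 * D := by
    intro b hb
    have hb' := mem_edgeBox.1 hb
    rw [integral_add (hu _) (hu _), two_mul]
    exact add_le_add (hD _ (add_mem_box hb' (unitVec_mem_box _)))
      (hD _ (box_mono (Nat.le_succ m) hb'))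
  have hsumv := (integrable_const ((edgeBox d m).card * s)).add
    ((integrable_finsetSum _ hv).const_mul K⁻¹)
  have hsumH := (integrable_finsetSum (touching Λ) fun b _ => (hH b).abs).const_mul
    ((4 * s)⁻¹ * (c * K / (a * m)))
  rw [← integral_finsetSum _ fun b _ => hmin b]
  refine (integral_mono_ae (integrable_finsetSum _ fun b _ => hmin b) (hsumv.add hsumH) ?_).trans ?_
  · filter_upwards [ae_comp_fst hext hG.1, hκ] with ω hloop hω
    have h := sum_edgeBox_min_one_abs_grad_le (u := harmonicField Λ ω) ha hs hK hm hω
    rw [grad_harmonicField hloop] at h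
    exact h fun x hx => diverg_harmonicPart (fun b _ => ha.trans_le (hω b).1) ω.1 hx
  · rw [integral_add' hsumv hsumH, integral_const_mul, integral_add' (integrable_const _)
      ((integrable_finsetSum _ hv).const_mul _), integral_const_mul K⁻¹, integral_const,
      probReal_univ, one_smul]
    gcongr
    · exact integral_finsetSum_le_card_mul hv hvD
    · exact integral_finsetSum_le_card_mul (fun b _ => (hH b).abs) fun b _ =>
        integral_abs_harmonicPart_le ha hϱa hG hext hinv htilt Λ b

include ha hϱ hG hinv htilt hext in
theorem eventually_integral_abs_harmonicField_le (herg : IsErgodic μ) {ε : ℝ} (hε : 0 < ε) :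
    ∀ᶠ m : ℕ in atTop, ∀ x ∈ box d (m + 1),
      ∫ ω, |harmonicField (box d (2 * m)) ω x| ∂μt ≤ ε * m := by
  have hfield := (tendsto_add_atTop_nat 1).eventually
    (eventually_integral_abs_field_le hG.1 hinv herg htilt (by positivity : 0 < ε / 4))
  have hsqrt := (Real.tendsto_sqrt_atTop.comp tendsto_natCast_atTop_atTop).eventually_ge_atTop
    (2 / ε * (√(5 * a⁻¹) * normalAbs))
  filter_upwards [hfield, hsqrt, eventually_ge_atTop 1] with m hfieldm hsqrtm hm x hx
  have hm1 : (1 : ℝ) ≤ m := by exact_mod_cast hm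
  have hE : ∫ η, |field η x| ∂μ ≤ ε / 4 * (2 * m) := by
    refine (hfieldm x (mem_box.1 hx)).trans ?_
    gcongr
    push_cast
    linarith
  have hD : √((2 * m + (m + 1) + 1 : ℕ) * a⁻¹) * normalAbs ≤ ε / 2 * m :=
    calc √((2 * m + (m + 1) + 1 : ℕ) * a⁻¹) * normalAbs ≤ √(5 * a⁻¹ * m) * normalAbs := by
          refine mul_le_mul_of_nonneg_right (Real.sqrt_le_sqrt ?_) normalAbs_nonneg
          rw [mul_right_comm]
          gcongr
          push_cast
          linarith
      _ = ε / 2 * (2 / ε * (√(5 * a⁻¹) * normalAbs) * √m) := by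
          rw [Real.sqrt_mul (by positivity)]
          field_simp
      _ ≤ ε / 2 * (√m * √m) := by
          gcongr
          exact hsqrtm
      _ = ε / 2 * m := by rw [Real.mul_self_sqrt m.cast_nonneg]
  refine (integrable_and_integral_abs_harmonicField_le ha (hϱ.mono fun k hk => hk.1) hG hext htilt
    (add_smul_unitVec_notMem_box hx 0)).2.trans ?_
  linarith

include ha hϱ hG hinv htilt hext in
theorem eventually_sum_edgeBox_integral_min_one_harmonicPart_le (herg : IsErgodic μ) {δ : ℝ}
    (hδ : 0 < δ) :
    ∀ᶠ m : ℕ in atTop, ∑ b ∈ edgeBox d m,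
      ∫ ω, min 1 |harmonicPart (box d (2 * m)) ω.2 ω.1 b| ∂μt ≤ δ * m ^ d := by
  have hc : 0 < c := by
    obtain ⟨ω, hω⟩ := (ae_mem_of_extension hext hϱ).exists
    exact ha.trans_le ((hω (0, 0)).1.trans (hω (0, 0)).2)
  have hedge := edgeBound_nonneg μ a
  set C : ℝ := d * 3 ^ d * 3 + c / (4 * a) * (2 * d * 5 ^ d * edgeBound μ a) with hC
  have hC0 : 0 < C := by
    have := NeZero.pos d
    positivity
  set t := δ / C with ht
  have ht0 : 0 < t := by positivity
  -- The truncation level `t² m` lies between the size `t³ m` of the field and the scale `m`.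
  filter_upwards [eventually_integral_abs_harmonicField_le ha hϱ hG hinv htilt hext herg
    (pow_pos ht0 3), eventually_ge_atTop 1] with m hm hm1
  have hmpos : (1 : ℝ) ≤ m := by exact_mod_cast hm1
  have hcardE : ((edgeBox d m).card : ℝ) ≤ d * 3 ^ d * m ^ d := by
    rw [card_edgeBox, mul_assoc, ← mul_pow]
    push_cast
    gcongr
    linarith
  have hcardT : ((touching (box d (2 * m))).card : ℝ) ≤ 2 * d * 5 ^ d * m ^ d := by
    refine (Nat.cast_le.2 (card_touching_le _)).trans ?_
    rw [card_box, mul_assoc _ (5 ^ d : ℝ), ← mul_pow]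
    push_cast
    gcongr
    linarith
  calc _ ≤ (edgeBox d m).card * t + (t ^ 2 * m)⁻¹ * ((edgeBox d m).card * (2 * (t ^ 3 * m))) +
        (4 * t)⁻¹ * (c * (t ^ 2 * m) / (a * m)) *
          ((touching (box d (2 * m))).card * edgeBound μ a) :=
        sum_edgeBox_integral_min_one_harmonicPart_le ha hϱ hG hinv htilt hext hm1 ht0
          (by positivity) hm
    _ ≤ d * 3 ^ d * m ^ d * t + (t ^ 2 * m)⁻¹ * (d * 3 ^ d * m ^ d * (2 * (t ^ 3 * m))) +
        (4 * t)⁻¹ * (c * (t ^ 2 * m) / (a * m)) * (2 * d * 5 ^ d * m ^ d * edgeBound μ a) := by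
        gcongr
    _ = C * t * m ^ d := by
        rw [hC]
        field_simp
        ring
    _ = δ * m ^ d := by rw [ht, mul_div_cancel₀ _ hC0.ne']

include ha hϱ hG hinv htilt hext in
theorem frequently_integral_min_one_finPairing_harmonicPart_lt (herg : IsErgodic μ)
    (θ : Edge d →₀ ℝ) {ε : ℝ} (hε : 0 < ε) :
    ∃ᶠ Λ in atTop, ∫ ω, min 1 |finPairing θ (harmonicPart Λ ω.2 ω.1)| ∂μt < ε := by
  classical
  refine frequently_atTop.2 fun Λ₀ => ?_
  obtain ⟨n₀, hn₀⟩ := exists_subset_box Λ₀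
  obtain ⟨R, hR⟩ := exists_subset_box (θ.support.image Prod.fst)
  set W : ℝ := ∑ b ∈ θ.support, (1 + |θ b|)
  have hW : 0 ≤ W := Finset.sum_nonneg fun b _ => by positivity
  have hsum := (tendsto_add_atTop_nat R).eventually
    (eventually_sum_edgeBox_integral_min_one_harmonicPart_le ha hϱ hG hinv htilt hext herg
      (by positivity : 0 < ε / (W + 1)))
  obtain ⟨n, ⟨hn, hnR⟩, hnn₀⟩ :=
    ((hsum.and (eventually_ge_atTop R)).and (eventually_ge_atTop n₀)).exists
  obtain ⟨y, hy, hle⟩ := exists_mem_box_sum_translate_le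
    (J := fun b => ∫ ω, min 1 |harmonicPart (box d (2 * (n + R))) ω.2 ω.1 b| ∂μt)
    (w := fun b => 1 + |θ b|) (fun b => integral_nonneg fun ω => by positivity)
    (fun b => by positivity) (fun b hb => hR (Finset.mem_image_of_mem _ hb)) n
  have hmem : ∀ z, z + y ∈ box d (2 * (n + R)) ↔ z ∈ (box d (2 * (n + R))).image (· - y) :=
    fun z => by simp [sub_eq_iff_eq_add]
  refine ⟨(box d (2 * (n + R))).image (· - y), fun z hz => ?_, ?_⟩
  · exact (hmem z).1 (box_mono (by omega) (add_mem_box (box_mono hnn₀ (hn₀ hz)) hy))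
  refine (integral_min_one_finPairing_harmonicPart_le (hϱ.mono fun k hk => ha.trans_le hk.1) hinv
    hext θ y hmem).trans_lt (lt_of_mul_lt_mul_left (hle.trans_lt ?_)
      (by positivity : (0 : ℝ) ≤ (2 * n + 1) ^ d))
  calc _ ≤ W * (ε / (W + 1) * ((n + R : ℕ) : ℝ) ^ d) := mul_le_mul_of_nonneg_left hn hW
    _ ≤ W * (ε / (W + 1) * (2 * n + 1) ^ d) := by
        gcongr
        have : (R : ℝ) ≤ n := by exact_mod_cast hnR
        push_cast
        linarith
    _ = (2 * n + 1) ^ d * (W / (W + 1) * ε) := by ring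
    _ < (2 * n + 1) ^ d * ε := by
        have : W / (W + 1) < 1 := (div_lt_one (by positivity)).2 (lt_add_one W)
        gcongr
        exact mul_lt_of_lt_one_left hε this

include ha hϱ hG hinv htilt hext in
theorem exists_tendsto_integral_min_one_finPairing_harmonicPart (herg : IsErgodic μ)
    (θ : Edge d →₀ ℝ) :
    ∃ Λ : ℕ → Finset (Lattice d), Tendsto Λ atTop atTop ∧
      Tendsto (fun n => ∫ ω, min 1 |finPairing θ (harmonicPart (Λ n) ω.2 ω.1)| ∂μt)
        atTop (𝓝 0) := by
  set I : Finset (Lattice d) → ℝ :=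
    fun Λ => ∫ ω, min 1 |finPairing θ (harmonicPart Λ ω.2 ω.1)| ∂μt
  have hI : ∀ Λ, 0 ≤ I Λ := fun Λ => integral_nonneg fun ω => by positivity
  have : (comap I (𝓝 0) ⊓ atTop).NeBot := by
    refine inf_neBot_iff_frequently_left.2 fun {p} hp => ?_
    obtain ⟨ε, hε, hp⟩ := (Metric.nhds_basis_ball.comap I).eventually_iff.1 hp
    exact (frequently_integral_min_one_finPairing_harmonicPart_lt ha hϱ hG hinv htilt hext herg θ
      hε).mono fun Λ hΛ => hp (by simpa [abs_of_nonneg (hI Λ)] using hΛ)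
  obtain ⟨Λ, hΛ⟩ := exists_seq_tendsto (comap I (𝓝 0) ⊓ atTop)
  exact ⟨Λ, (tendsto_inf.1 hΛ).2, (tendsto_comap_iff (g := I)).1 (tendsto_inf.1 hΛ).1⟩

end Vanishing

/-! ### Conditional characteristic functions -/

theorem condDistrib_integral_ae_eq {α β Ω E : Type*} {mα : MeasurableSpace α}
    {mβ : MeasurableSpace β} [MeasurableSpace Ω] [StandardBorelSpace Ω] [Nonempty Ω]
    [NormedAddCommGroup E] [NormedSpace ℝ E] [CompleteSpace E] {ν : Measure α} [IsFiniteMeasure ν]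
    {X : α → β} {Y : α → Ω} (hX : Measurable X) (hY : Measurable Y) {f : Ω → E} {g : β → E}
    (hf : StronglyMeasurable f) (hfY : Integrable (fun a => f (Y a)) ν)
    (hg : Integrable g (ν.map X))
    (h : ∀ B, MeasurableSet B → ∫ a in X ⁻¹' B, f (Y a) ∂ν = ∫ a in X ⁻¹' B, g (X a) ∂ν) :
    (fun b => ∫ y, f y ∂condDistrib Y X ν b) =ᵐ[ν.map X] g := by
  have hf₂ : StronglyMeasurable fun p : β × Ω => f p.2 := hf.comp_measurable measurable_snd
  have hXY : Measurable fun a => (X a, Y a) := hX.prodMk hY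
  have hint : Integrable (fun p : β × Ω => f p.2) (ν.map fun a => (X a, Y a)) :=
    (integrable_map_measure hf₂.aestronglyMeasurable hXY.aemeasurable).2 hfY
  refine (hint.integral_condDistrib_map hY.aemeasurable).ae_eq_of_forall_setIntegral_eq _ _ hg
    fun B hB _ => ?_
  calc ∫ b in B, ∫ y, f y ∂condDistrib Y X ν b ∂ν.map X
      = ∫ p in B ×ˢ Set.univ, f p.2 ∂(ν.map X ⊗ₘ condDistrib Y X ν) := by
        rw [← compProd_map_condDistrib hY.aemeasurable] at hint
        simp only [Measure.setIntegral_compProd hB MeasurableSet.univ hint.integrableOn,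
          setIntegral_univ]
    _ = ∫ a in X ⁻¹' B, f (Y a) ∂ν := by
        rw [compProd_map_condDistrib hY.aemeasurable, setIntegral_map (hB.prod MeasurableSet.univ)
          hf₂.aestronglyMeasurable hXY.aemeasurable, Set.mk_preimage_prod, Set.preimage_univ,
          Set.inter_univ]
    _ = ∫ b in B, g b ∂ν.map X := by
        rw [h B hB, setIntegral_map hB hg.aestronglyMeasurable hX.aemeasurable]

theorem norm_cexp_ofReal_mul_I_sub_one_le (x : ℝ) :
    ‖Complex.exp (x * Complex.I) - 1‖ ≤ 2 * min 1 |x| := by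
  have hdist : ‖Complex.exp (x * Complex.I) - 1‖ ≤ |x| := by
    rw [mul_comm]
    exact Real.norm_exp_I_mul_ofReal_sub_one_le
  have htwo : ‖Complex.exp (x * Complex.I) - 1‖ ≤ 2 :=
    (norm_sub_le _ _).trans (by rw [Complex.norm_exp_ofReal_mul_I, norm_one]; norm_num)
  rcases min_cases 1 |x| with h | h <;> rw [h.1] <;> linarith [abs_nonneg x]

theorem integrable_cexp_ofReal_mul_I {Ω : Type*} [MeasurableSpace Ω] {ν : Measure Ω}
    [IsFiniteMeasure ν] {f : Ω → ℝ} (hf : Measurable f) :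
    Integrable (fun ω => Complex.exp (f ω * Complex.I)) ν :=
  Integrable.of_bound (C := 1) (by fun_prop) (Eventually.of_forall fun ω => by
    rw [Complex.norm_exp_ofReal_mul_I])

theorem integral_cexp_gaussianReal (r : ℝ) :
    ∫ t, Complex.exp ((r * t : ℝ) * Complex.I) ∂gaussianReal 0 1 =
      (Real.exp (-(r ^ 2 / 2)) : ℝ) := by
  have h := charFun_gaussianReal (μ := 0) (v := 1) r
  rw [charFun_apply_real] at h
  push_cast at h ⊢
  rw [h]
  congr 1
  simp

theorem norm_ofReal_exp_neg_half_le {G : ℝ} (hG : 0 ≤ G) :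
    ‖((Real.exp (-(G / 2)) : ℝ) : ℂ)‖ ≤ 1 := by
  rw [Complex.norm_real, Real.norm_eq_abs, Real.abs_exp, Real.exp_le_one_iff]
  linarith

theorem integrable_ofReal_exp_neg_half {Ω : Type*} [MeasurableSpace Ω] {ν : Measure Ω}
    [IsFiniteMeasure ν] {G : Ω → ℝ} (hG : AEMeasurable G ν) (hG₀ : ∀ᵐ ω ∂ν, 0 ≤ G ω) :
    Integrable (fun ω => ((Real.exp (-(G ω / 2)) : ℝ) : ℂ)) ν :=
  Integrable.of_bound (AEMeasurable.aestronglyMeasurable (by fun_prop)) 1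
    (hG₀.mono fun _ => norm_ofReal_exp_neg_half_le)

theorem aemeasurable_norm_sq_gradPart [NeZero d] {ν : Measure (Edge d → ℝ)}
    (hν : ∀ᵐ κ ∂ν, ∀ b, 0 < κ b) (θ : Edge d →₀ ℝ) :
    AEMeasurable (fun κ => ‖gradPart κ θ‖ ^ 2) ν :=
  aemeasurable_of_tendsto_metrizable_ae atTop
    (fun Λ => (measurable_greenForm Λ (-diverg θ)).aemeasurable)
    (hν.mono fun _ hκ => tendsto_greenForm hκ θ)

theorem ae_snd_pos {ϱ : Measure ℝ} [IsFiniteMeasure ϱ] {μ : Measure (Edge d → ℝ)} [SFinite μ]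
    {μt : Measure ((Edge d → ℝ) × (Edge d → ℝ))} [IsFiniteMeasure μt]
    (hpos : ∀ᵐ k ∂ϱ, 0 < k) (hext : IsExtension ϱ μ μt) :
    ∀ᵐ κ ∂μt.map Prod.snd, ∀ b, 0 < κ b :=
  (ae_map_iff measurable_snd.aemeasurable
    (by simp only [Set.ofPred_forall]; measurability)).2 (ae_mem_of_extension hext hpos)

section CharacteristicFunction

variable [NeZero d] {ϱ : Measure ℝ} [IsFiniteMeasure ϱ] {μ : Measure (Edge d → ℝ)}
  {μt : Measure ((Edge d → ℝ) × (Edge d → ℝ))} {B : Set (Edge d → ℝ)} (hB : MeasurableSet B)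

section FiniteVolume

variable [IsFiniteMeasure μ] [IsFiniteMeasure μt] (hpos : ∀ᵐ k ∂ϱ, 0 < k)
  (hG : IsGradientGibbs ϱ μ) (hext : IsExtension ϱ μ μt)

include hB hpos hG hext in
theorem setIntegral_resample {E : Type*} [NormedAddCommGroup E] [NormedSpace ℝ E]
    (Λ : Finset (Lattice d)) (θ : Edge d →₀ ℝ) {F : (Edge d → ℝ) × ℝ → E}
    (hF : StronglyMeasurable F)
    (hFi : Integrable (fun p => F (harmonicPart Λ p.1.2 p.1.1,
      √(greenForm Λ p.1.2 (-diverg θ)) * p.2)) (μt.prod (gaussianReal 0 1))) :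
    ∫ ω in Prod.snd ⁻¹' B, F (harmonicPart Λ ω.2 ω.1,
        finPairing θ (grad (dirichletPart Λ ω.2 ω.1))) ∂μt =
      ∫ ω in Prod.snd ⁻¹' B, ∫ t, F (harmonicPart Λ ω.2 ω.1,
        √(greenForm Λ ω.2 (-diverg θ)) * t) ∂gaussianReal 0 1 ∂μt := by
  have hF' : StronglyMeasurable fun q : ((Edge d → ℝ) × ℝ) × (Edge d → ℝ) => F q.1 :=
    hF.comp_measurable measurable_fst
  have hB' : MeasurableSet ((Prod.snd : ((Edge d → ℝ) × ℝ) × (Edge d → ℝ) → _) ⁻¹' B) :=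
    measurable_snd hB
  calc _ = ∫ q in Prod.snd ⁻¹' B, F q.1 ∂μt.map fun ω => ((harmonicPart Λ ω.2 ω.1,
          finPairing θ (grad (dirichletPart Λ ω.2 ω.1))), ω.2) :=
        (setIntegral_map hB' hF'.aestronglyMeasurable (((measurable_harmonicPart Λ).prodMk
          (measurable_finPairing_dirichletPart Λ θ)).prodMk measurable_snd).aemeasurable).symm
    _ = ∫ p in (Prod.snd ⁻¹' B) ×ˢ Set.univ, F (harmonicPart Λ p.1.2 p.1.1,
          √(greenForm Λ p.1.2 (-diverg θ)) * p.2) ∂μt.prod (gaussianReal 0 1) := by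
        rw [map_resample hpos hG hext, Set.prod_univ]
        exact setIntegral_map hB' hF'.aestronglyMeasurable ((measurable_resampled Λ θ).prodMk
          (measurable_snd.comp measurable_fst)).aemeasurable
    _ = _ := by
        rw [setIntegral_prod _ hFi.integrableOn]
        simp only [setIntegral_univ]

include hB hpos hG hext in
theorem setIntegral_cexp_finPairing (Λ : Finset (Lattice d)) (θ : Edge d →₀ ℝ) :
    ∫ ω in Prod.snd ⁻¹' B, Complex.exp (finPairing θ ω.1 * Complex.I) ∂μt =
      ∫ ω in Prod.snd ⁻¹' B, Complex.exp (finPairing θ (harmonicPart Λ ω.2 ω.1) * Complex.I) *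
        (Real.exp (-(greenForm Λ ω.2 (-diverg θ) / 2)) : ℝ) ∂μt := by
  have hsum : Measurable fun q : (Edge d → ℝ) × ℝ => finPairing θ q.1 + q.2 := by
    have := (finPairing θ).continuous.measurable
    fun_prop
  have hF := setIntegral_resample hB hpos hG hext Λ θ
    (F := fun q => Complex.exp ((finPairing θ q.1 + q.2 : ℝ) * Complex.I))
    (Measurable.stronglyMeasurable (by fun_prop))
    (integrable_cexp_ofReal_mul_I (hsum.comp (measurable_resampled Λ θ)))
  simp only [← map_add, harmonicPart, sub_add_cancel] at hF
  rw [hF]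
  refine integral_congr_ae (ae_restrict_of_ae ?_)
  filter_upwards [ae_mem_of_extension hext hpos] with ω hω
  simp only [Complex.ofReal_add, add_mul, Complex.exp_add]
  rw [integral_const_mul, integral_cexp_gaussianReal,
    Real.sq_sqrt (greenForm_nonneg (fun b _ => hω b) _), harmonicPart]

include hB hpos hG hext in
theorem norm_setIntegral_cexp_finPairing_sub_le (Λ : Finset (Lattice d)) (θ : Edge d →₀ ℝ) :
    ‖∫ ω in Prod.snd ⁻¹' B, Complex.exp (finPairing θ ω.1 * Complex.I) ∂μt -
        ∫ ω in Prod.snd ⁻¹' B, ((Real.exp (-(greenForm Λ ω.2 (-diverg θ) / 2)) : ℝ) : ℂ) ∂μt‖ ≤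
      2 * ∫ ω, min 1 |finPairing θ (harmonicPart Λ ω.2 ω.1)| ∂μt := by
  have hharm : Measurable fun ω : (Edge d → ℝ) × (Edge d → ℝ) =>
      finPairing θ (harmonicPart Λ ω.2 ω.1) :=
    (finPairing θ).continuous.measurable.comp (measurable_harmonicPart Λ)
  have hgreen : Measurable fun ω : (Edge d → ℝ) × (Edge d → ℝ) => greenForm Λ ω.2 (-diverg θ) :=
    (measurable_greenForm Λ _).comp measurable_snd
  have hgreen₀ : ∀ᵐ ω ∂μt, 0 ≤ greenForm Λ ω.2 (-diverg θ) :=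
    (ae_mem_of_extension hext hpos).mono fun ω hω => greenForm_nonneg (fun b _ => hω b) _
  have hexp := integrable_ofReal_exp_neg_half hgreen.aemeasurable hgreen₀
  have hmul := hexp.bdd_mul (c := 1)
    (integrable_cexp_ofReal_mul_I (ν := μt) hharm).aestronglyMeasurable
    (Eventually.of_forall fun ω => (Complex.norm_exp_ofReal_mul_I _).le)
  have hmin := (integrable_min_one_abs (ν := μt) hharm).const_mul 2
  rw [setIntegral_cexp_finPairing hB hpos hG hext Λ θ,
    ← integral_sub hmul.integrableOn hexp.integrableOn, ← integral_const_mul]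
  refine (norm_integral_le_of_norm_le hmin.integrableOn (ae_restrict_of_ae ?_)).trans
    (setIntegral_le_integral hmin (Eventually.of_forall fun ω => by positivity))
  filter_upwards [hgreen₀] with ω hω
  rw [← sub_one_mul, norm_mul]
  exact (mul_le_of_le_one_right (norm_nonneg _) (norm_ofReal_exp_neg_half_le hω)).trans
    (norm_cexp_ofReal_mul_I_sub_one_le _)

end FiniteVolume

variable [IsProbabilityMeasure μ] [IsProbabilityMeasure μt] {a c : ℝ}

include hB in
theorem setIntegral_cexp_finPairing_eq (ha : 0 < a) (hϱ : ∀ᵐ k ∂ϱ, k ∈ Set.Icc a c)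
    (hG : IsGradientGibbs ϱ μ) (hinv : IsTranslationInvariant μ) (htilt : HasZeroTilt μ)
    (hext : IsExtension ϱ μ μt) (herg : IsErgodic μ) (θ : Edge d →₀ ℝ) :
    ∫ ω in Prod.snd ⁻¹' B, Complex.exp (finPairing θ ω.1 * Complex.I) ∂μt =
      ∫ ω in Prod.snd ⁻¹' B, ((Real.exp (-(‖gradPart ω.2 θ‖ ^ 2 / 2)) : ℝ) : ℂ) ∂μt := by
  have hpos : ∀ᵐ k ∂ϱ, 0 < k := hϱ.mono fun k hk => ha.trans_le hk.1
  have hκ := ae_mem_of_extension hext hpos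
  obtain ⟨Λ, hΛ, hlim⟩ := exists_tendsto_integral_min_one_finPairing_harmonicPart ha hϱ hG hinv
    htilt hext herg θ
  have hdiff := squeeze_zero_norm (fun n => norm_setIntegral_cexp_finPairing_sub_le hB hpos hG hext
    (Λ n) θ) (by simpa using hlim.const_mul 2)
  have hgreen : Tendsto
      (fun n => ∫ ω in Prod.snd ⁻¹' B,
        ((Real.exp (-(greenForm (Λ n) ω.2 (-diverg θ) / 2)) : ℝ) : ℂ) ∂μt)
      atTop
      (𝓝 (∫ ω in Prod.snd ⁻¹' B, ((Real.exp (-(‖gradPart ω.2 θ‖ ^ 2 / 2)) : ℝ) : ℂ) ∂μt)) := by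
    refine tendsto_integral_of_dominated_convergence (fun _ => 1) (fun n => ?_)
      (integrable_const _) (fun n => ae_restrict_of_ae (hκ.mono fun ω hω =>
        norm_ofReal_exp_neg_half_le (greenForm_nonneg (fun b _ => hω b) _)))
      (ae_restrict_of_ae (hκ.mono fun ω hω => ?_))
    · have := measurable_greenForm (Λ n) (-diverg θ)
      exact Measurable.aestronglyMeasurable (by fun_prop)
    · have hexp : Continuous fun x : ℝ => ((Real.exp (-(x / 2)) : ℝ) : ℂ) := by fun_prop
      exact (hexp.tendsto _).comp ((tendsto_greenForm hω θ).comp hΛ)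
  simpa [sub_eq_zero] using tendsto_nhds_unique (hgreen.const_sub _) hdiff

theorem ae_integral_cexp_condLaw (ha : 0 < a) (hϱ : ∀ᵐ k ∂ϱ, k ∈ Set.Icc a c)
    (hG : IsGradientGibbs ϱ μ) (hinv : IsTranslationInvariant μ) (htilt : HasZeroTilt μ)
    (hext : IsExtension ϱ μ μt) (herg : IsErgodic μ) (θ : Edge d →₀ ℝ) :
    ∀ᵐ κ ∂μt.map Prod.snd, ∫ φ, Complex.exp (finPairing θ (grad φ) * Complex.I) ∂condLaw μt κ =
      (Real.exp (-(‖gradPart κ θ‖ ^ 2 / 2)) : ℝ) := by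
  have hfield : Measurable fun ω : (Edge d → ℝ) × (Edge d → ℝ) => field ω.1 :=
    measurable_field.comp measurable_fst
  have hgrad : Measurable fun φ : Lattice d → ℝ => finPairing θ (grad φ) :=
    ((finPairing θ).continuous.comp continuous_grad).measurable
  have hexp := integrable_ofReal_exp_neg_half (aemeasurable_norm_sq_gradPart
    (ae_snd_pos (hϱ.mono fun k hk => ha.trans_le hk.1) hext) θ)
    (Eventually.of_forall fun κ => sq_nonneg _)
  refine condDistrib_integral_ae_eq measurable_snd hfield
    (Measurable.stronglyMeasurable (by fun_prop))
    (integrable_cexp_ofReal_mul_I (hgrad.comp hfield)) hexp fun B hB => ?_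
  rw [← setIntegral_cexp_finPairing_eq hB ha hϱ hG hinv htilt hext herg θ]
  exact integral_congr_ae (ae_restrict_of_ae ((ae_comp_fst hext hG.1).mono fun ω hω => by
    simp only [grad_field hω]))

end CharacteristicFunction

/-! ### Gaussian laws on products -/

theorem finPairing_surjective {ι : Type*} :
    Function.Surjective (finPairing : (ι →₀ ℝ) → StrongDual ℝ (ι → ℝ)) := fun L => by
  have hL : L.toLinearMap ∈ Submodule.span ℝ (Set.range fun i : ι => LinearMap.proj i) :=
    (LinearMap.mem_span_iff_continuous _).2 L.continuous
  obtain ⟨θ, hθ⟩ := Finsupp.mem_span_range_iff_exists_finsupp.1 hL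
  refine ⟨θ, ContinuousLinearMap.ext fun η => ?_⟩
  simpa [finPairing_apply, Finsupp.sum] using LinearMap.congr_fun hθ η

theorem eq_of_forall_rat {ι Z : Type*} [TopologicalSpace Z] [T2Space Z] {F G : (ι →₀ ℝ) → Z}
    (hF : ∀ S : Finset ι, Continuous fun c : S → ℝ => F (∑ i : S, Finsupp.single (i : ι) (c i)))
    (hG : ∀ S : Finset ι, Continuous fun c : S → ℝ => G (∑ i : S, Finsupp.single (i : ι) (c i)))
    (h : ∀ (S : Finset ι) (q : S → ℚ),
      F (∑ i : S, Finsupp.single (i : ι) (q i : ℝ)) =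
        G (∑ i : S, Finsupp.single (i : ι) (q i : ℝ))) :
    F = G := funext fun θ => by
  have hdense : DenseRange (Pi.map fun _ : θ.support => ((↑) : ℚ → ℝ)) :=
    DenseRange.piMap fun _ => Rat.denseRange_cast
  have hθ : ∑ i : θ.support, Finsupp.single (i : ι) (θ i) = θ :=
    (Finset.sum_coe_sort θ.support fun i => Finsupp.single i (θ i)).trans θ.sum_single
  have heq := congrFun (hdense.equalizer (hF θ.support) (hG θ.support) (funext (h θ.support)))
    fun i => θ i
  rwa [hθ] at heq

section GaussianLaw

variable {ι H : Type*} [NormedAddCommGroup H] [InnerProductSpace ℝ H]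
  {A : (ι →₀ ℝ) →ₗ[ℝ] H} {P : Measure (ι → ℝ)}

theorem hasLaw_finPairing [Countable ι] [IsFiniteMeasure P]
    (h : ∀ θ, ∫ φ, Complex.exp (finPairing θ φ * Complex.I) ∂P =
      (Real.exp (-(‖A θ‖ ^ 2 / 2)) : ℝ)) (θ : ι →₀ ℝ) :
    HasLaw (finPairing θ) (gaussianReal 0 (‖A θ‖₊ ^ 2)) P where
  aemeasurable := (finPairing θ).continuous.measurable.aemeasurable
  map_eq := by
    refine Measure.ext_of_charFun (funext fun t => ?_)
    have ht := h (t • θ)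
    simp only [map_smul, smul_apply, smul_eq_mul, norm_smul] at ht
    rw [charFun_gaussianReal, charFun_apply_real, integral_map
      (finPairing θ).continuous.measurable.aemeasurable
      (Measurable.aestronglyMeasurable (by fun_prop))]
    simp only [Complex.ofReal_mul] at ht
    rw [ht, mul_pow, Real.norm_eq_abs, sq_abs]
    push_cast [coe_nnnorm]
    congr 1
    ring

variable (h : ∀ θ, HasLaw (finPairing θ) (gaussianReal 0 (‖A θ‖₊ ^ 2)) P)

include h

theorem isGaussian_of_hasLaw_finPairing [Countable ι] : IsGaussian P :=
  isGaussian_of_map_eq_gaussianReal fun L => by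
    obtain ⟨θ, rfl⟩ := finPairing_surjective L
    exact ⟨0, _, (h θ).map_eq⟩

theorem integral_finPairing_eq_zero (θ : ι →₀ ℝ) : ∫ φ, finPairing θ φ ∂P = 0 := by
  rw [(h θ).integral_eq, integral_id_gaussianReal]

theorem variance_finPairing (θ : ι →₀ ℝ) : variance (finPairing θ) P = ‖A θ‖ ^ 2 := by
  rw [(h θ).variance_eq, variance_id_gaussianReal]
  simp

theorem covariance_finPairing (θ θ' : ι →₀ ℝ) :
    covariance (finPairing θ) (finPairing θ') P = inner ℝ (A θ) (A θ') := by
  have hmem (θ : ι →₀ ℝ) : MemLp (finPairing θ) 2 P := by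
    refine (memLp_map_measure_iff aestronglyMeasurable_id (h θ).aemeasurable).1 ?_
    rw [(h θ).map_eq]
    exact memLp_id_gaussianReal 2
  have := (h 0).isProbabilityMeasure
  have hvar := variance_add (hmem θ) (hmem θ')
  rw [← FunLike.coe_add, ← map_add, variance_finPairing h, variance_finPairing h,
    variance_finPairing h, map_add, norm_add_sq_real] at hvar
  linarith

end GaussianLaw

instance isMarkovKernel_condLaw (μt : Measure ((Edge d → ℝ) × (Edge d → ℝ))) [IsFiniteMeasure μt] :
    IsMarkovKernel (condLaw μt) := by
  unfold condLaw
  infer_instance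

theorem ae_condLaw_zero (μt : Measure ((Edge d → ℝ) × (Edge d → ℝ))) [IsFiniteMeasure μt] :
    ∀ᵐ κ ∂μt.map Prod.snd, ∀ᵐ φ ∂condLaw μt κ, φ 0 = 0 := by
  have hfield : Measurable fun ω : (Edge d → ℝ) × (Edge d → ℝ) => field ω.1 :=
    measurable_field.comp measurable_fst
  have hzero : MeasurableSet {p : (Edge d → ℝ) × (Lattice d → ℝ) | p.2 0 = 0} :=
    measurableSet_eq_fun (by fun_prop) measurable_const
  refine (Measure.ae_compProd_iff hzero).1 ?_
  rw [condLaw, compProd_map_condDistrib hfield.aemeasurable,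
    ae_map_iff (measurable_snd.prodMk hfield).aemeasurable hzero]
  exact Eventually.of_forall fun ω => field_zero _

theorem continuous_integral_cexp_linear {V Ω : Type*} [NormedAddCommGroup V] [NormedSpace ℝ V]
    [FiniteDimensional ℝ V] [MeasurableSpace Ω] {P : Measure Ω} [IsFiniteMeasure P]
    {X : Ω → V →ₗ[ℝ] ℝ} (hX : ∀ v, Measurable fun ω => X ω v) :
    Continuous fun v => ∫ ω, Complex.exp (X ω v * Complex.I) ∂P := by
  refine continuous_of_dominated (bound := fun _ => 1)
    (fun v => ?_) (fun v => Eventually.of_forall fun ω => ?_) (integrable_const _)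
    (Eventually.of_forall fun ω => ?_)
  · have := hX v
    exact Measurable.aestronglyMeasurable (by fun_prop)
  · rw [Complex.norm_exp_ofReal_mul_I]
  · have := (X ω).continuous_of_finiteDimensional
    fun_prop

theorem integral_cexp_finPairing_grad_of_rat {P : Measure (Lattice d → ℝ)} [IsFiniteMeasure P]
    {κ : Edge d → ℝ}
    (h : ∀ (S : Finset (Edge d)) (q : S → ℚ),
      ∫ φ, Complex.exp (finPairing (∑ b : S, Finsupp.single (b : Edge d) (q b : ℝ)) (grad φ) *
        Complex.I) ∂P =
      (Real.exp (-(‖gradPart κ (∑ b : S, Finsupp.single (b : Edge d) (q b : ℝ))‖ ^ 2 / 2)) : ℝ))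
    (θ : Edge d →₀ ℝ) :
    ∫ φ, Complex.exp (finPairing θ (grad φ) * Complex.I) ∂P =
      (Real.exp (-(‖gradPart κ θ‖ ^ 2 / 2)) : ℝ) := by
  let T (S : Finset (Edge d)) : (S → ℝ) →ₗ[ℝ] Edge d →₀ ℝ :=
    ∑ b : S, Finsupp.lsingle (b : Edge d) ∘ₗ LinearMap.proj b
  have hT (S : Finset (Edge d)) (c : S → ℝ) :
      ∑ b : S, Finsupp.single (b : Edge d) (c b) = T S c := by simp [T]
  refine congrFun (eq_of_forall_rat
    (F := fun θ => ∫ φ, Complex.exp (finPairing θ (grad φ) * Complex.I) ∂P)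
    (G := fun θ => ((Real.exp (-(‖gradPart κ θ‖ ^ 2 / 2)) : ℝ) : ℂ))
    (fun S => ?_) (fun S => ?_) h) θ
  · simp only [hT]
    exact continuous_integral_cexp_linear
      (X := fun φ => (ContinuousLinearMap.coeLMₛₗ (.id ℝ) ∘ₗ finPairing ∘ₗ T S).flip (grad φ))
      fun v => ((finPairing (T S v)).continuous.comp continuous_grad).measurable
  · have hcont := (gradPart κ ∘ₗ T S).continuous_of_finiteDimensional
    simp only [hT]
    exact Complex.continuous_ofReal.comp
      (Real.continuous_exp.comp ((hcont.norm.pow 2).div_const 2).neg)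

theorem ae_hasLaw_condLaw [NeZero d] {ϱ : Measure ℝ} [IsFiniteMeasure ϱ]
    {μ : Measure (Edge d → ℝ)} [IsProbabilityMeasure μ]
    {μt : Measure ((Edge d → ℝ) × (Edge d → ℝ))} [IsProbabilityMeasure μt]
    {a c : ℝ} (ha : 0 < a) (hϱ : ∀ᵐ k ∂ϱ, k ∈ Set.Icc a c) (hG : IsGradientGibbs ϱ μ)
    (hinv : IsTranslationInvariant μ) (htilt : HasZeroTilt μ) (hext : IsExtension ϱ μ μt)
    (herg : IsErgodic μ) :
    ∀ᵐ κ ∂μt.map Prod.snd, ∀ f : Lattice d →₀ ℝ,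
      HasLaw (finPairing f) (gaussianReal 0 (‖(gradPart κ ∘ₗ flow) f‖₊ ^ 2)) (condLaw μt κ) := by
  have hrat := ae_all_iff.2 fun S : Finset (Edge d) => ae_all_iff.2 fun q : S → ℚ =>
    ae_integral_cexp_condLaw ha hϱ hG hinv htilt hext herg
      (∑ b : S, Finsupp.single (b : Edge d) (q b : ℝ))
  filter_upwards [ae_condLaw_zero μt, hrat] with κ h₀ hq
  refine hasLaw_finPairing fun f => ?_
  rw [LinearMap.comp_apply, ← integral_cexp_finPairing_grad_of_rat hq (flow f)]
  exact integral_congr_ae (h₀.mono fun φ hφ => by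
    simp only [finPairing_flow_of_zero hφ, pair_eq_finPairing])

end GradientGibbs

open MeasureTheory ProbabilityTheory GradientGibbs in
theorem lemma3p4 {d : ℕ} (hd : 1 ≤ d)
    (ϱ : Measure ℝ) [IsFiniteMeasure ϱ] (hϱ : ϱ ≠ 0)
    (hsupp : ∃ a b : ℝ, 0 < a ∧ ϱ (Set.Icc a b)ᶜ = 0)
    (μ : Measure (Edge d → ℝ)) [IsProbabilityMeasure μ]
    (hGibbs : IsGradientGibbs ϱ μ) (hinv : IsTranslationInvariant μ)
    (herg : IsErgodic μ) (htilt : HasZeroTilt μ)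
    (μt : Measure ((Edge d → ℝ) × (Edge d → ℝ))) [IsProbabilityMeasure μt]
    (hext : IsExtension ϱ μ μt) :
    ∀ᵐ κ ∂(μt.map Prod.snd),
      condLaw μt κ {φ | φ 0 = 0}ᶜ = 0 ∧
      IsGaussian (condLaw μt κ) ∧
      (∀ x : Lattice d, ∫ φ, φ x ∂(condLaw μt κ) = 0) ∧
      ∀ f : Lattice d →₀ ℝ, (f.sum fun _ a => a) = 0 →
        (∃ g, IsInverseImage κ f g) ∧
        ∀ g, IsInverseImage κ f g →
          variance (pair f) (condLaw μt κ) = pair f g ∧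
          ∀ f' : Lattice d →₀ ℝ, (f'.sum fun _ a => a) = 0 →
            covariance (pair f') (pair f) (condLaw μt κ) = pair f' g := by
  have : NeZero d := ⟨by lia⟩
  obtain ⟨a, c, ha, hac⟩ := hsupp
  have hϱ_Icc : ∀ᵐ k ∂ϱ, k ∈ Set.Icc a c := hac
  filter_upwards [ae_snd_pos (hϱ_Icc.mono fun k hk => ha.trans_le hk.1) hext, ae_condLaw_zero μt,
    ae_hasLaw_condLaw ha hϱ_Icc hGibbs hinv htilt hext herg] with κ hκ hzero hlaw
  have hmean (x : Lattice d) : ∫ φ, φ x ∂condLaw μt κ = 0 := by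
    simpa [finPairing_single] using integral_finPairing_eq_zero hlaw (Finsupp.single x 1)
  refine ⟨hzero, isGaussian_of_hasLaw_finPairing hlaw, hmean, fun f hf =>
    ⟨exists_isInverseImage hκ hf, fun g hg => ?_⟩⟩
  have hcov (f' : Lattice d →₀ ℝ) (hf' : (f'.sum fun _ a => a) = 0) :
      covariance (pair f') (pair f) (condLaw μt κ) = pair f' g := by
    rw [pair_eq_finPairing f', pair_eq_finPairing f, covariance_finPairing hlaw,
      ← pair_eq_finPairing]
    exact inner_gradPart_flow hκ hf hf' hg
  refine ⟨?_, hcov⟩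
  rw [← hcov f hf, covariance_self]
  exact pair_eq_finPairing f ▸ (hlaw f).aemeasurable
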